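/- Let $n\ge 1$, and let $A=(a_{ij})$ be a real $n\times n$ matrix all of whose complex eigenvalues have modulus $>1$; put $b=|\det A|$ and $\|A\|=(\sum_{i,j}|a_{ij}|^2)^{1/2}$. Let $\Delta\subset\mathbb R^n$ be an open ellipsoid centred at the origin with $|\Delta|=1$ and $\Delta\subset r\Delta\subset A\Delta$ for some $r>1$. For $k\in\mathbb Z$ put $B_k=A^k\Delta$ and call the sets $x+B_k$ ($x\in\mathbb R^n$, $k\in\mathbb Z$) dilated balls. Let $\rho(0)=0$ and $\rho(x)=b^k$ for $x\in B_{k+1}\setminus B_k$, and let $\mathcal M f(x)$ be the supremum of $\frac1{|B|}\int_B|f|$ over all dilated balls $B\ni x$; for $\alpha>0$ put $\mathcal M^{(\alpha)}(f)=\mathcal M(|f|^\alpha)^{1/\alpha}$. Let $X$ be a ball quasi-Banach function space on $\mathbb R^n$: a quasi-norm $\|\cdot\|_X$ with values in $[0,\infty]$, defined on all measurable functions, with $X=\{f:\|f\|_X<\infty\}$, such that $\|f\|_X=0$ implies $f=0$ a.e.; $|g|\le|f|$ a.e. implies $\|g\|_X\le\|f\|_X$; $0\le f_m\uparrow f$ a.e.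 implies $\|f_m\|_X\uparrow\|f\|_X$; and $\mathbf 1_B\in X$ for all dilated balls $B$. It is a ball Banach function space if moreover $\|f+g\|_X\le\|f\|_X+\|g\|_X$ and, for each dilated ball $B$, there is $C_{(B)}$ with $\int_B|f|\le C_{(B)}\|f\|_X$ for all $f\in X$. For $p>0$ let $\|f\|_{X^p}=\||f|^p\|_X^{1/p}$, and for a ball Banach function space $Y$ let $\|f\|_{Y'}=\sup\{\|fg\|_{L^1}:\|g\|_Y=1\}$. Assume that for some $p_-\in(0,\infty)$: (1) for all $p\in(0,p_-)$ and $u\in(1,\infty)$ there is a constant $C$ such that, for all sequences $(f_k)_{k\ge1}$ of measurable functions, $$\Big\|\Big\{\sum_{k}[\mathcal M(f_k)]^u\Big\}^{1/u}\Big\|_{X^{1/p}}\le C\,\Big\|\Big\{\sum_{k}|f_k|^u\Big\}^{1/u}\Big\|_{X^{1/p}};$$ (2) for some $\theta_0\in(0,\min\{p_-,1\})$ and $p_0\in(\theta_0,\infty)$, $X^{1/\theta_0}$ is a ball Banach function space and there is a constant $C$ with $$\|\mathcal M^{((p_0/\theta_0)')}(f)\|_{(X^{1/\theta_0})'}\le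 C\|f\|_{(X^{1/\theta_0})'}\quad\text{for all } f\in(X^{1/\theta_0})',$$ where $q'=q/(q-1)$ is the conjugate index. Let $d\in\{0,1,2,\dots\}$ and let $\phi,\psi\in C_c^\infty(\mathbb R^n)$ be such that each $\eta\in\{\phi,\psi\}$ vanishes outside $B_0$, satisfies $\int x^\gamma\eta(x)\,dx=0$ for all multi-indices $\gamma$ with $|\gamma|\le d$, and satisfies $|\widehat\eta(\xi)|\ge c_\eta$ for some constant $c_\eta>0$ and all $\xi$ with $(2\|A\|)^{-1}\le\rho(\xi)\le1$, where $\widehat\eta(\xi)=\int\eta(x)e^{-2\pi i x\cdot\xi}dx$. For $\varphi\in\mathcal S(\mathbb R^n)$ put $\varphi_k(x)=b^{-k}\varphi(A^{-k}x)$, and for $f\in\mathcal S'(\mathbb R^n)$ put $$S_\varphi(f)(x)=\Big[\sum_{k\in\mathbb Z}b^{-k}\int_{x+B_k}|f*\varphi_k(y)|^2dy\Big]^{1/2}\in[0,\infty].$$ Then there is a constant $C\in(0,\infty)$ such that, for every $f\in\mathcal S'(\mathbb R^n)$ that vanishes weakly at infinity (that is, $f*\varphi_k\to0$ in $\mathcal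 S'(\mathbb R^n)$ as $k\to\infty$ for every $\varphi\in\mathcal S(\mathbb R^n)$), $$\|S_\phi(f)\|_X\le C\|S_\psi(f)\|_X\quad\text{and}\quad\|S_\psi(f)\|_X\le C\|S_\phi(f)\|_X .$$ -/

import Mathlib

open MeasureTheory Filter Topology
open scoped NNReal ENNReal SchwartzMap FourierTransform Pointwise

noncomputable section

namespace AnisoLP

/-- `ℝⁿ` with its Euclidean norm and Lebesgue measure. -/
abbrev Rn (n : ℕ) : Type := EuclideanSpace ℝ (Fin n)

/-! ### Dilations, dilated balls and the step homogeneous quasi-norm -/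

/-- An expansive matrix (a dilation): all complex eigenvalues have modulus `> 1`. -/
structure Dilation (n : ℕ) where
  mat : Matrix (Fin n) (Fin n) ℝ
  expansive : ∀ μ ∈ spectrum ℂ (mat.map (algebraMap ℝ ℂ)), 1 < ‖μ‖

namespace Dilation

variable {n : ℕ} (A : Dilation n)

theorem isUnit_mat : IsUnit A.mat := by
  have h0 : IsUnit (A.mat.map (algebraMap ℝ ℂ)) := by
    by_contra h
    have h1 := A.expansive 0 (spectrum.zero_mem (R := ℂ) h)
    simp only [norm_zero] at h1
    linarith
  rw [Matrix.isUnit_iff_isUnit_det, isUnit_iff_ne_zero] at h0 ⊢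
  intro h
  apply h0
  have := (algebraMap ℝ ℂ).map_det A.mat
  rw [h, map_zero] at this
  exact this.symm

/-- The invertible linear map `x ↦ A x` on `ℝⁿ`. -/
def toCLE : Rn n ≃L[ℝ] Rn n :=
  ContinuousLinearEquiv.equivOfInverse
    (Matrix.toEuclideanCLM (n := Fin n) (𝕜 := ℝ) A.mat)
    (Matrix.toEuclideanCLM (n := Fin n) (𝕜 := ℝ) A.mat⁻¹)
    (fun x => by
      rw [← mul_apply_eq_comp, ← map_mul,
        Matrix.nonsing_inv_mul _ ((Matrix.isUnit_iff_isUnit_det _).1 A.isUnit_mat), map_one,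
        one_apply_eq_self])
    (fun x => by
      rw [← mul_apply_eq_comp, ← map_mul,
        Matrix.mul_nonsing_inv _ ((Matrix.isUnit_iff_isUnit_det _).1 A.isUnit_mat), map_one,
        one_apply_eq_self])

/-- The invertible linear map `x ↦ Aᵏ x`, for `k ∈ ℤ`. -/
def pow (k : ℤ) : Rn n ≃L[ℝ] Rn n := A.toCLE ^ k

/-- `b = |det A|`. -/
def b : ℝ := |A.mat.det|

/-- `‖A‖ = (∑ |a_{ij}|²)^{1/2}`. -/
def hsNorm : ℝ := Real.sqrt (∑ i, ∑ j, |A.mat i j| ^ 2)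

/-- `Δ` is an open ellipsoid centred at the origin, the image of the open unit ball under an
invertible linear map, with `|Δ| = 1` and `Δ ⊆ rΔ ⊆ AΔ` for some `r > 1`. -/
def IsUnitEllipsoid (Δ : Set (Rn n)) : Prop :=
  (∃ P : Rn n ≃L[ℝ] Rn n, Δ = P '' Metric.ball (0 : Rn n) 1) ∧
  volume Δ = 1 ∧
  ∃ r : ℝ, 1 < r ∧ Δ ⊆ r • Δ ∧ r • Δ ⊆ A.toCLE '' Δ

variable (Δ : Set (Rn n))

/-- `B_k = Aᵏ Δ`. -/
def B (k : ℤ) : Set (Rn n) := A.pow k '' Δ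

/-- The dilated ball `x + B_k`. -/
def dball (x : Rn n) (k : ℤ) : Set (Rn n) := (fun z => x + z) '' A.B Δ k

open Classical in
/-- The step homogeneous quasi-norm: `ρ(x) = bᵏ` if `x ∈ B_{k+1} \ B_k`, and `ρ(0) = 0`
(for `x ≠ 0` there is exactly one such `k`). -/
def rho (x : Rn n) : ℝ :=
  if h : ∃ k : ℤ, x ∈ A.B Δ (k + 1) \ A.B Δ k then A.b ^ h.choose else 0

/-- The Hardy-Littlewood maximal function `M(f)(x) = sup_{x ∈ z + B_k} ⨍_{z + B_k} f` of a
nonnegative function. -/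
def maximal (f : Rn n → ℝ≥0∞) (x : Rn n) : ℝ≥0∞ :=
  ⨆ (z : Rn n) (k : ℤ) (_ : x ∈ A.dball Δ z k), ⨍⁻ y in A.dball Δ z k, f y ∂volume

/-- The powered maximal function `M^{(α)}(f) = M(|f|^α)^{1/α}`. -/
def powMaximal (α : ℝ) (f : Rn n → ℝ≥0∞) (x : Rn n) : ℝ≥0∞ :=
  (A.maximal Δ (fun y => f y ^ α) x) ^ (1 / α)

end Dilation

/-! ### Ball quasi-Banach function spaces

A lattice quasi-norm on measurable functions satisfies `‖f‖ = ‖ |f| ‖`, so it is recorded by its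
values in `[0, ∞]` on `[0, ∞]`-valued Lebesgue measurable functions (the moduli `|f|`); the space
itself is `X = {f : ‖ |f| ‖_X < ∞}`. -/

/-- A functional on `[0, ∞]`-valued functions on `ℝⁿ`. -/
abbrev FunNorm (n : ℕ) : Type := (Rn n → ℝ≥0∞) → ℝ≥0∞

section BallSpaces

variable {n : ℕ} (A : Dilation n) (Δ : Set (Rn n))

/-- `X` is (the quasi-norm of) a ball quasi-Banach function space. -/
structure IsBallQuasiBanach (X : FunNorm n) : Prop where
  /-- homogeneity -/
  smul : ∀ (c : ℝ≥0) (f : Rn n → ℝ≥0∞), AEMeasurable f volume →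
    X (fun x => c * f x) = c * X f
  /-- quasi-triangle inequality -/
  add_le : ∃ K : ℝ≥0, ∀ f g : Rn n → ℝ≥0∞, AEMeasurable f volume → AEMeasurable g volume →
    X (fun x => f x + g x) ≤ K * (X f + X g)
  eq_zero : ∀ f : Rn n → ℝ≥0∞, AEMeasurable f volume → X f = 0 → ∀ᵐ x, f x = 0
  mono : ∀ f g : Rn n → ℝ≥0∞, AEMeasurable f volume → AEMeasurable g volume →
    (∀ᵐ x, g x ≤ f x) → X g ≤ X f
  /-- Fatou property: `0 ≤ fₘ ↑ f` a.e. implies `‖fₘ‖ ↑ ‖f‖` -/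
  fatou : ∀ (u : ℕ → Rn n → ℝ≥0∞) (f : Rn n → ℝ≥0∞), (∀ m, AEMeasurable (u m) volume) →
    AEMeasurable f volume → (∀ᵐ x, Monotone (fun m => u m x)) →
    (∀ᵐ x, Tendsto (fun m => u m x) atTop (𝓝 (f x))) →
    Tendsto (fun m => X (u m)) atTop (𝓝 (X f))
  indicator_lt_top : ∀ (x : Rn n) (k : ℤ), X ((A.dball Δ x k).indicator 1) < ∞

/-- `X` is (the norm of) a ball Banach function space. -/
structure IsBallBanach (X : FunNorm n) : Prop extends IsBallQuasiBanach A Δ X where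
  triangle : ∀ f g : Rn n → ℝ≥0∞, AEMeasurable f volume → AEMeasurable g volume →
    X (fun x => f x + g x) ≤ X f + X g
  lintegral_le : ∀ (x : Rn n) (k : ℤ), ∃ C : ℝ≥0, ∀ f : Rn n → ℝ≥0∞,
    AEMeasurable f volume → X f < ∞ → ∫⁻ y in A.dball Δ x k, f y ≤ C * X f

/-- The quasi-norm `‖f‖_{X^p} = ‖ |f|^p ‖_X^{1/p}` of the `p`-convexification. -/
def convexify (X : FunNorm n) (p : ℝ) : FunNorm n :=
  fun f => (X (fun x => f x ^ p)) ^ (1 / p)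

/-- The associate norm `‖f‖_{X'} = sup {‖f g‖_{L¹} : ‖g‖_X = 1}`. -/
def associate (X : FunNorm n) : FunNorm n :=
  fun f => ⨆ (g : Rn n → ℝ≥0∞) (_ : AEMeasurable g volume) (_ : X g = 1), ∫⁻ x, f x * g x

/-- The Fefferman-Stein vector-valued maximal inequality on `X^{1/p}`, `p ∈ (0, p_-)`. -/
def FeffermanStein (X : FunNorm n) (pm : ℝ) : Prop :=
  ∀ p : ℝ, 0 < p → p < pm → ∀ u : ℝ, 1 < u → ∃ C : ℝ≥0,
    ∀ F : ℕ → Rn n → ℝ≥0∞, (∀ k, AEMeasurable (F k) volume) →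
      convexify X (1 / p) (fun x => (∑' k, A.maximal Δ (F k) x ^ u) ^ (1 / u)) ≤
        C * convexify X (1 / p) (fun x => (∑' k, F k x ^ u) ^ (1 / u))

/-- `X^{1/θ₀}` is a ball Banach function space and the powered maximal operator of order
`(p₀/θ₀)'` is bounded on its associate space. -/
def AssociateMaximal (X : FunNorm n) (θ₀ p₀ : ℝ) : Prop :=
  IsBallBanach A Δ (convexify X (1 / θ₀)) ∧
  ∃ C : ℝ≥0, ∀ f : Rn n → ℝ≥0∞, AEMeasurable f volume →
    associate (convexify X (1 / θ₀)) f < ∞ →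
    associate (convexify X (1 / θ₀)) (A.powMaximal Δ (Real.conjExponent (p₀ / θ₀)) f) ≤
      C * associate (convexify X (1 / θ₀)) f

end BallSpaces

/-! ### Tempered distributions and the Lusin area function -/

section Area

variable {n : ℕ} (A : Dilation n) (Δ : Set (Rn n))

/-- `φ_k(x) = b^{-k} φ(A^{-k} x)`. -/
def dilate (φ : 𝓢(Rn n, ℂ)) (k : ℤ) : 𝓢(Rn n, ℂ) :=
  (A.b ^ (-k) : ℝ) • SchwartzMap.compCLMOfContinuousLinearEquiv ℝ (A.pow (-k)) φ

/-- The Schwartz function `z ↦ φ(y - z)`. -/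
def reflectTranslate (φ : 𝓢(Rn n, ℂ)) (y : Rn n) : 𝓢(Rn n, ℂ) :=
  SchwartzMap.compSubConstCLM ℝ y
    (SchwartzMap.compCLMOfContinuousLinearEquiv ℝ (ContinuousLinearEquiv.neg ℝ) φ)

/-- The convolution `(f ∗ φ)(y) = ⟨f, φ(y - ·)⟩` of `f ∈ 𝓢'` and `φ ∈ 𝓢`. -/
def conv (f : 𝓢'(Rn n, ℂ)) (φ : 𝓢(Rn n, ℂ)) (y : Rn n) : ℂ := f (reflectTranslate φ y)

/-- `f` vanishes weakly at infinity: for every `φ ∈ 𝓢`, `f ∗ φ_k → 0` in `𝓢'` as `k → ∞`,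
where the smooth, polynomially bounded function `f ∗ φ_k` acts on `𝓢` by integration. -/
def VanishesWeaklyAtInfinity (f : 𝓢'(Rn n, ℂ)) : Prop :=
  ∀ φ θ : 𝓢(Rn n, ℂ),
    Tendsto (fun k : ℤ => ∫ x, conv f (dilate A φ k) x * θ x) atTop (𝓝 0)

/-- The anisotropic Lusin area function
`S_φ(f)(x) = (∑_{k ∈ ℤ} b^{-k} ∫_{x + B_k} |f ∗ φ_k(y)|² dy)^{1/2} ∈ [0, ∞]`. -/
def area (φ : 𝓢(Rn n, ℂ)) (f : 𝓢'(Rn n, ℂ)) (x : Rn n) : ℝ≥0∞ :=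
  (∑' k : ℤ, ENNReal.ofReal (A.b ^ (-k)) *
    ∫⁻ y in A.dball Δ x k, ‖conv f (dilate A φ k) y‖ₑ ^ 2) ^ (1 / 2 : ℝ)

/-- `φ` is supported in `B_0` (hence `φ ∈ C_c^∞`), has vanishing moments up to order `d`, and
`|φ̂|` is bounded below on `{(2‖A‖)⁻¹ ≤ ρ ≤ 1}`. Here
`𝓕 φ ξ = ∫ φ(x) e^{-2πi x·ξ} dx`. -/
structure IsAdmissible (d : ℕ) (φ : 𝓢(Rn n, ℂ)) : Prop where
  compact_support : HasCompactSupport φ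
  support_subset : Function.support φ ⊆ A.B Δ 0
  moments : ∀ γ : Fin n → ℕ, ∑ i, γ i ≤ d →
    ∫ x : Rn n, ((∏ i, x i ^ γ i : ℝ) : ℂ) * φ x = 0
  lower_bound : ∃ C : ℝ, 0 < C ∧ ∀ ξ : Rn n,
    (2 * A.hsNorm)⁻¹ ≤ A.rho Δ ξ → A.rho Δ ξ ≤ 1 → C ≤ ‖𝓕 (φ : Rn n → ℂ) ξ‖

end Area

end AnisoLP

end

/-! By symmetry it is enough to dominate S_φ by S_ψ. Let G_k(y) be the square average of f∗ψ_k over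
y + B_k, so that S_ψ(f)² = ∑ G_k². The core is a pointwise bound, `Gauge.exists_area_le`: for every
p > 0, S_φ(f) is at most a constant times (∑_k M(G_k^p)^{2/p})^{1/2}. The Fefferman-Stein inequality
on X^{1/p} with exponent u = 2/p then removes the maximal operator (`exists_norm_area_le`).

The pointwise bound has three ingredients. A discrete Calderón formula (`exists_calderon`) recovers
f∗φ_j from the f∗ψ_k through kernels (ζ_m)_k ∗ φ_j, where the Fourier transform of ζ_m lives in an
annulus. Almost orthogonality (`FourierAnnular.exists_almost_orthogonal`) gives these kernels rapid
decay at scale k and size r^{-|j-k|}: for j ≥ k derivatives are moved from ζ_m to φ, for j ≤ k the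
mean zero of φ is used. Finally, integrals of |f∗ψ_k| against such kernels are at most a constant
times M(G_k^p)^{1/p}, for p as small as desired, because the mean of |f∗ψ_k| over a small dilated
ball is dominated by G_k at every point of that ball. Young's inequality sums the scales.

The delicate point is that the Calderón formula needs ψ̂ to be non-zero somewhere on every orbit of
the transpose of A, while the lower bound is given on an annulus for ρ, whose geometry is that of A
and not of its transpose. Suppose that ψ̂ vanishes on a whole orbit. The orbit contracts to 0 in
negative time, and its coordinates are exponential polynomials ∑ p_ν(k) ν^k with |ν| < 1. Replacing
ν^k by |ν|^s and p_ν(k) by p_ν(0) is a ring homomorphism on formal exponential polynomials. It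
therefore carries the Taylor polynomials of ψ̂ along the orbit, which are as small as the Taylor
remainders, to equally small functions along a continuous flow. So the entire extension of ψ̂ decays
along the flow faster than any exponential, and by Phragmén-Lindelöf it vanishes there
(`exists_curve_of_fourier_orbit_eq_zero`). The flow is a real continuous curve ending at 0; started
outside Δ it crosses the boundary of Δ, where ρ = 1 and ψ̂ is bounded below. This is a
contradiction. -/

noncomputable section

namespace AnisoLP

/-! ### Geometry of dilated balls -/

section Geometry

variable {n : ℕ} {A : Dilation n} {Δ : Set (Rn n)}

namespace Dilation

theorem pow_add_apply (A : Dilation n) (j k : ℤ) (x : Rn n) :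
    A.pow (j + k) x = A.pow j (A.pow k x) := by
  simp only [pow, zpow_add]
  rfl

@[simp] theorem pow_zero_apply (A : Dilation n) (x : Rn n) : A.pow 0 x = x := by
  simp only [pow, zpow_zero]
  rfl

@[simp] theorem pow_neg_pow (A : Dilation n) (k : ℤ) (x : Rn n) :
    A.pow (-k) (A.pow k x) = x := by
  rw [← pow_add_apply]; simp

@[simp] theorem pow_pow_neg (A : Dilation n) (k : ℤ) (x : Rn n) :
    A.pow k (A.pow (-k) x) = x := by
  rw [← pow_add_apply]; simp

theorem pow_one_apply (A : Dilation n) (x : Rn n) : A.pow 1 x = A.toCLE x := by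
  simp only [pow, zpow_one]

theorem det_toCLE (A : Dilation n) :
    LinearMap.det ((A.toCLE : Rn n →L[ℝ] Rn n) : Rn n →ₗ[ℝ] Rn n) = A.mat.det := by
  have h : ((A.toCLE : Rn n →L[ℝ] Rn n) : Rn n →ₗ[ℝ] Rn n) = Matrix.toEuclideanLin A.mat := by
    rw [← Matrix.coe_toEuclideanCLM_eq_toEuclideanLin]
    rfl
  rw [h, Matrix.toEuclideanLin_eq_toLin_orthonormal, LinearMap.det_toLin]

theorem b_pos (A : Dilation n) : 0 < A.b :=
  abs_pos.2 ((Matrix.isUnit_iff_isUnit_det _).1 A.isUnit_mat).ne_zero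

theorem volume_image_toCLE (A : Dilation n) (s : Set (Rn n)) :
    volume (A.toCLE '' s) = ENNReal.ofReal A.b * volume s := by
  have := Measure.addHaar_image_continuousLinearMap (volume : Measure (Rn n))
    (A.toCLE : Rn n →L[ℝ] Rn n) s
  rw [det_toCLE] at this
  exact this

theorem volume_image_pow (A : Dilation n) (k : ℤ) (s : Set (Rn n)) :
    volume (A.pow k '' s) = ENNReal.ofReal (A.b ^ k) * volume s := by
  have hb := A.b_pos
  have hstep : ∀ (k : ℤ), volume (A.pow (k + 1) '' s) =
      ENNReal.ofReal A.b * volume (A.pow k '' s) := by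
    intro k
    rw [← A.volume_image_toCLE, Set.image_image]
    congr 1
    refine Set.image_congr fun x _ => ?_
    rw [add_comm, pow_add_apply, pow_one_apply]
  induction k using Int.induction_on with
  | zero => simp
  | succ i ih =>
    rw [hstep, ih, zpow_add₀ hb.ne', ← mul_assoc, ← ENNReal.ofReal_mul hb.le, zpow_one,
      mul_comm (A.b)]
  | pred i ih =>
    have h := hstep (-(i : ℤ) - 1)
    rw [sub_add_cancel, ih] at h
    have h2 : ENNReal.ofReal A.b ≠ 0 := by simpa using hb
    rw [zpow_sub₀ hb.ne', zpow_one, div_eq_inv_mul, ENNReal.ofReal_mul (by positivity), mul_assoc,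
      h, ← mul_assoc, ← ENNReal.ofReal_mul (by positivity), inv_mul_cancel₀ hb.ne']
    simp

end Dilation

/-- An invertible linear map `P` with `Δ = {‖P x‖ < 1}` together with a contraction factor of
`A⁻¹` for the norm `‖P x‖`. -/
structure Gauge (A : Dilation n) (Δ : Set (Rn n)) where
  P : Rn n ≃L[ℝ] Rn n
  r : ℝ
  one_lt : 1 < r
  mem_iff : ∀ x, x ∈ Δ ↔ ‖P x‖ < 1
  contr : ∀ x, r * ‖P (A.pow (-1) x)‖ ≤ ‖P x‖
  vol : volume Δ = 1

/-- The inclusion rΔ ⊆ AΔ says exactly that A⁻¹ contracts the gauge ‖P x‖ by the factor r. All later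
geometry uses only this contraction. -/
theorem Dilation.IsUnitEllipsoid.exists_gauge (hΔ : A.IsUnitEllipsoid Δ) :
    Nonempty (Gauge A Δ) := by
  obtain ⟨⟨P, hP⟩, hv, r, hr, -, hrA⟩ := hΔ
  have hmem : ∀ x, x ∈ Δ ↔ ‖P.symm x‖ < 1 := by
    intro x
    rw [hP]
    constructor
    · rintro ⟨y, hy, rfl⟩
      simpa using hy
    · intro h
      exact ⟨P.symm x, by simpa using h, by simp⟩
  have hr0 : 0 < r := by linarith
  have key : ∀ z, ‖P.symm z‖ < 1 → r * ‖P.symm (A.pow (-1) z)‖ < 1 := by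
    intro z hz
    have : r • z ∈ A.toCLE '' Δ := hrA (Set.smul_mem_smul_set ((hmem z).2 hz))
    obtain ⟨w, hw, hwz⟩ := this
    have h1 : A.pow (-1) (r • z) = w := by
      rw [← hwz, ← A.pow_one_apply, A.pow_neg_pow]
    rw [hmem, ← h1] at hw
    simpa [norm_smul, abs_of_pos hr0] using hw
  refine ⟨⟨P.symm, r, hr, hmem, fun x => ?_, hv⟩⟩
  -- Homogeneity: for t > ‖P x‖ the vector x/t lies in Δ, where the inclusion applies.
  refine le_of_forall_gt_imp_ge_of_dense fun t ht => ?_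
  have ht0 : 0 < t := (norm_nonneg _).trans_lt ht
  have := key (t⁻¹ • x) (by
    simp only [map_smul, norm_smul, norm_inv, Real.norm_eq_abs, abs_of_pos ht0]
    rw [inv_mul_lt_iff₀ ht0]; simpa using ht)
  simp only [map_smul, norm_smul, norm_inv, Real.norm_eq_abs, abs_of_pos ht0] at this
  have h2 : t⁻¹ * (r * ‖P.symm (A.pow (-1) x)‖) < 1 := by linarith
  rw [inv_mul_lt_iff₀ ht0] at h2
  linarith

namespace Gauge

variable (g : Gauge A Δ)
include g

theorem r_pos : 0 < g.r := one_pos.trans g.one_lt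

theorem mem_B {k : ℤ} {x : Rn n} : x ∈ A.B Δ k ↔ ‖g.P (A.pow (-k) x)‖ < 1 := by
  rw [← g.mem_iff]
  constructor
  · rintro ⟨y, hy, rfl⟩
    simpa using hy
  · intro h
    exact ⟨_, h, by simp⟩

theorem mem_dball {k : ℤ} {x y : Rn n} :
    y ∈ A.dball Δ x k ↔ ‖g.P (A.pow (-k) (y - x))‖ < 1 := by
  rw [← g.mem_B]
  constructor
  · rintro ⟨z, hz, rfl⟩
    simpa using hz
  · intro h
    exact ⟨_, h, by simp⟩

theorem mem_dball_comm {k : ℤ} {x y : Rn n} : y ∈ A.dball Δ x k ↔ x ∈ A.dball Δ y k := by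
  rw [g.mem_dball, g.mem_dball, ← neg_sub x y, map_neg, map_neg, norm_neg]

theorem isOpen_dball (x : Rn n) (k : ℤ) : IsOpen (A.dball Δ x k) := by
  have : A.dball Δ x k = {y | ‖g.P (A.pow (-k) (y - x))‖ < 1} := by
    ext y; exact g.mem_dball
  rw [this]
  exact isOpen_lt (by fun_prop) continuous_const

theorem measurableSet_dball (x : Rn n) (k : ℤ) : MeasurableSet (A.dball Δ x k) :=
  (g.isOpen_dball x k).measurableSet

theorem volume_dball (x : Rn n) (k : ℤ) : volume (A.dball Δ x k) = ENNReal.ofReal (A.b ^ k) := by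
  rw [Dilation.dball, Set.image_add_left, measure_preimage_add, Dilation.B,
    Dilation.volume_image_pow, g.vol, mul_one]

theorem contr_pow (m : ℕ) (x : Rn n) : g.r ^ m * ‖g.P (A.pow (-m) x)‖ ≤ ‖g.P x‖ := by
  induction m generalizing x with
  | zero => simp
  | succ m ih =>
    have h1 := ih (A.pow (-1) x)
    rw [← A.pow_add_apply] at h1
    have h2 := g.contr x
    have : (-((m + 1 : ℕ) : ℤ)) = -(m : ℤ) + -1 := by push_cast; ring
    rw [this, pow_succ, mul_right_comm]
    nlinarith [g.r_pos]

theorem norm_pow_neg_le : ∃ C : ℝ, 1 ≤ C ∧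
    ∀ m : ℕ, ‖(A.pow (-m) : Rn n →L[ℝ] Rn n)‖ ≤ C * (g.r ^ m)⁻¹ := by
  refine ⟨max 1 (‖(g.P.symm : Rn n →L[ℝ] Rn n)‖ * ‖(g.P : Rn n →L[ℝ] Rn n)‖), le_max_left _ _,
    fun m => ?_⟩
  have hr := pow_pos g.r_pos m
  refine ContinuousLinearMap.opNorm_le_bound _ (by positivity) fun x => ?_
  have h1 := g.contr_pow m x
  have h2 : ‖A.pow (-m) x‖ ≤ ‖(g.P.symm : Rn n →L[ℝ] Rn n)‖ * ‖g.P (A.pow (-m) x)‖ := by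
    simpa using (g.P.symm : Rn n →L[ℝ] Rn n).le_opNorm (g.P (A.pow (-m) x))
  have h3 : ‖g.P x‖ ≤ ‖(g.P : Rn n →L[ℝ] Rn n)‖ * ‖x‖ := (g.P : Rn n →L[ℝ] Rn n).le_opNorm x
  have h4 : ‖g.P (A.pow (-m) x)‖ ≤ (g.r ^ m)⁻¹ * ‖g.P x‖ := by
    rw [le_inv_mul_iff₀ hr]; exact h1
  calc ‖A.pow (-m) x‖ ≤ ‖(g.P.symm : Rn n →L[ℝ] Rn n)‖ *
        ((g.r ^ m)⁻¹ * (‖(g.P : Rn n →L[ℝ] Rn n)‖ * ‖x‖)) :=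
        h2.trans (by gcongr; exact h4.trans (by gcongr))
    _ = (‖(g.P.symm : Rn n →L[ℝ] Rn n)‖ * ‖(g.P : Rn n →L[ℝ] Rn n)‖) * (g.r ^ m)⁻¹ * ‖x‖ := by
        ring
    _ ≤ _ := by gcongr; exact le_max_right _ _

/-- Converts both volumes (powers of b) and operator norms of positive powers into powers of the
single number r, so that they can be compared with the decay in `norm_pow_neg_le`. -/
theorem exists_growth_exponent : ∃ Q : ℕ, A.b ≤ g.r ^ Q ∧
    ∀ m : ℕ, ‖(A.pow m : Rn n →L[ℝ] Rn n)‖ ≤ (g.r ^ m) ^ Q := by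
  obtain ⟨Q, hQ⟩ := pow_unbounded_of_one_lt (max A.b ‖(A.toCLE : Rn n →L[ℝ] Rn n)‖) g.one_lt
  refine ⟨Q, (le_max_left _ _).trans hQ.le, fun m => ?_⟩
  have hA : ‖(A.toCLE : Rn n →L[ℝ] Rn n)‖ ≤ g.r ^ Q := (le_max_right _ _).trans hQ.le
  refine ContinuousLinearMap.opNorm_le_bound _ (by have := g.r_pos; positivity) fun x => ?_
  induction m with
  | zero => simp
  | succ m ih =>
    have : ((m + 1 : ℕ) : ℤ) = 1 + m := by push_cast; ring
    have hx : A.pow ((m + 1 : ℕ) : ℤ) x = A.toCLE (A.pow m x) := by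
      rw [this, A.pow_add_apply, A.pow_one_apply]
    have h1 : ‖A.toCLE (A.pow m x)‖ ≤ ‖(A.toCLE : Rn n →L[ℝ] Rn n)‖ * ‖A.pow m x‖ :=
      (A.toCLE : Rn n →L[ℝ] Rn n).le_opNorm _
    have hr := g.r_pos
    calc ‖A.pow ((m + 1 : ℕ) : ℤ) x‖ = ‖A.toCLE (A.pow m x)‖ := by rw [hx]
      _ ≤ g.r ^ Q * ((g.r ^ m) ^ Q * ‖x‖) := h1.trans (by gcongr; exact ih)
      _ = _ := by ring

theorem monotone_mem {j k : ℤ} (hjk : j ≤ k) (x : Rn n) :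
    ‖g.P (A.pow (-k) x)‖ ≤ ‖g.P (A.pow (-j) x)‖ := by
  obtain ⟨m, rfl⟩ := Int.le.dest hjk
  have h := g.contr_pow m (A.pow (-j) x)
  rw [← A.pow_add_apply, show -(m : ℤ) + -j = -(j + m) by ring] at h
  have h1 : 1 ≤ g.r ^ m := one_le_pow₀ g.one_lt.le
  nlinarith [norm_nonneg (g.P (A.pow (-(j + m)) x))]

/-- The sets B_k are nested, so the index selected in `rho` is forced to be 0. The boundary of Δ
lies in this level set. -/
theorem rho_eq_one {x : Rn n} (h1 : x ∈ A.B Δ 1) (h0 : x ∉ A.B Δ 0) : A.rho Δ x = 1 := by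
  have hex : ∃ k : ℤ, x ∈ A.B Δ (k + 1) \ A.B Δ k := ⟨0, by simpa using h1, h0⟩
  rw [Dilation.rho, dif_pos hex]
  obtain ⟨h2, h3⟩ := hex.choose_spec
  set k := hex.choose
  rw [g.mem_B] at h1 h0 h2 h3
  have hk0 : 0 ≤ k := by
    by_contra hk
    exact h0 ((g.monotone_mem (show k + 1 ≤ 0 by omega) x).trans_lt h2)
  have hk1 : k ≤ 0 := by
    by_contra hk
    exact h3 ((g.monotone_mem (show 1 ≤ k by omega) x).trans_lt h1)
  rw [le_antisymm hk1 hk0, zpow_zero]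

theorem tendsto_norm_pow {x : Rn n} (hx : x ≠ 0) :
    Tendsto (fun m : ℕ => ‖A.pow m x‖) atTop atTop := by
  have h1 : ∀ m : ℕ, g.r ^ m * (‖g.P x‖ / (‖(g.P : Rn n →L[ℝ] Rn n)‖ + 1)) ≤ ‖A.pow m x‖ := by
    intro m
    have h := g.contr_pow m (A.pow m x)
    rw [A.pow_neg_pow] at h
    have h3 : ‖g.P (A.pow m x)‖ ≤ ‖(g.P : Rn n →L[ℝ] Rn n)‖ * ‖A.pow m x‖ :=
      (g.P : Rn n →L[ℝ] Rn n).le_opNorm _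
    rw [← mul_div_assoc, div_le_iff₀ (by positivity)]
    nlinarith [norm_nonneg (A.pow m x)]
  refine tendsto_atTop_mono h1 ((tendsto_pow_atTop_atTop_of_one_lt g.one_lt).atTop_mul_const ?_)
  have : 0 < ‖g.P x‖ := by simpa using hx
  positivity

/-- If the Hilbert-Schmidt norm were below 1, A would not increase Euclidean norms, against
`tendsto_norm_pow`. The bound places the value ρ = 1 inside the annulus of the Tauberian condition.
-/
theorem one_le_hsNorm (hn : 0 < n) : 1 ≤ A.hsNorm := by
  by_contra hlt
  push Not at hlt
  have hA : ∀ x : Rn n, ‖A.toCLE x‖ ≤ ‖x‖ := by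
    intro x
    have h1 : ∀ i, (A.toCLE x) i = ∑ j, A.mat i j * x j := by
      intro i
      change (Matrix.toEuclideanCLM (n := Fin n) (𝕜 := ℝ) A.mat x) i = _
      rw [Matrix.ofLp_toEuclideanCLM]
      rfl
    have h2 : ‖A.toCLE x‖ ^ 2 ≤ A.hsNorm ^ 2 * ‖x‖ ^ 2 := by
      rw [Dilation.hsNorm, Real.sq_sqrt (by positivity), EuclideanSpace.norm_sq_eq,
        EuclideanSpace.norm_sq_eq, Finset.sum_mul]
      refine Finset.sum_le_sum fun i _ => ?_
      rw [h1, Real.norm_eq_abs, sq_abs]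
      simp only [Real.norm_eq_abs, sq_abs]
      exact Finset.sum_mul_sq_le_sq_mul_sq _ _ _
    have h3 : A.hsNorm ^ 2 ≤ 1 := by
      have : 0 ≤ A.hsNorm := Real.sqrt_nonneg _
      nlinarith
    refine le_of_sq_le_sq ?_ (norm_nonneg _)
    nlinarith [sq_nonneg ‖x‖]
  have hpow : ∀ (m : ℕ) (x : Rn n), ‖A.pow m x‖ ≤ ‖x‖ := by
    intro m x
    induction m with
    | zero => simp
    | succ m ih =>
      rw [show ((m + 1 : ℕ) : ℤ) = 1 + m by push_cast; ring, A.pow_add_apply, A.pow_one_apply]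
      exact (hA _).trans ih
  have : Nonempty (Fin n) := ⟨⟨0, hn⟩⟩
  obtain ⟨x, hx⟩ := exists_ne (0 : Rn n)
  have := (g.tendsto_norm_pow hx).eventually_gt_atTop ‖x‖
  obtain ⟨m, hm⟩ := this.exists
  exact absurd (hpow m x) (not_le.2 hm)

end Gauge

end Geometry

end AnisoLP

namespace AnisoLP

/-! ### Convolution of Schwartz functions -/

section SchwartzConvolution

variable {n : ℕ}

/-- The convolution of two complex-valued Schwartz functions. -/
def sconv (a b : 𝓢(Rn n, ℂ)) : 𝓢(Rn n, ℂ) :=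
  SchwartzMap.convolution (ContinuousLinearMap.mul ℂ ℂ) a b

theorem sconv_apply (a b : 𝓢(Rn n, ℂ)) (x : Rn n) : sconv a b x = ∫ t, a t * b (x - t) := by
  rw [sconv, SchwartzMap.convolution_apply]
  rfl

theorem fourier_sconv (a b : 𝓢(Rn n, ℂ)) (ξ : Rn n) :
    𝓕 (sconv a b) ξ = 𝓕 a ξ * 𝓕 b ξ := by
  rw [sconv, SchwartzMap.fourier_convolution]
  rfl

/-- All algebra of convolutions, dilates and derivatives below is checked on the Fourier side, where
it becomes algebra of pointwise products. -/
theorem eq_of_fourier_eq {a b : 𝓢(Rn n, ℂ)} (h : ∀ ξ, 𝓕 a ξ = 𝓕 b ξ) : a = b := by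
  have : 𝓕 a = 𝓕 b := SchwartzMap.ext h
  rw [← FourierTransform.fourierInv_fourier_eq (F := 𝓢(Rn n, ℂ)) a, this,
    FourierTransform.fourierInv_fourier_eq]

theorem sconv_comm (a b : 𝓢(Rn n, ℂ)) : sconv a b = sconv b a :=
  eq_of_fourier_eq fun ξ => by rw [fourier_sconv, fourier_sconv, mul_comm]

theorem sconv_assoc (a b c : 𝓢(Rn n, ℂ)) : sconv (sconv a b) c = sconv a (sconv b c) :=
  eq_of_fourier_eq fun ξ => by simp only [fourier_sconv, mul_assoc]

theorem sconv_apply' (a b : 𝓢(Rn n, ℂ)) (x : Rn n) : sconv a b x = ∫ t, a (x - t) * b t := by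
  rw [sconv_comm, sconv_apply]
  simp only [mul_comm]

theorem fourier_lineDeriv (g : 𝓢(Rn n, ℂ)) (v ξ : Rn n) :
    𝓕 (LineDeriv.lineDerivOp v g) ξ = 2 * Real.pi * Complex.I * (inner ℝ ξ v : ℝ) * 𝓕 g ξ := by
  rw [SchwartzMap.fourier_lineDerivOp_eq, smul_apply,
    SchwartzMap.smulLeftCLM_apply_apply (by fun_prop), smul_eq_mul, Complex.real_smul]
  ring

theorem lineDeriv_sconv (a b : 𝓢(Rn n, ℂ)) (v : Rn n) :
    LineDeriv.lineDerivOp v (sconv a b) = sconv (LineDeriv.lineDerivOp v a) b :=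
  eq_of_fourier_eq fun ξ => by
    simp only [fourier_lineDeriv, fourier_sconv]; ring

theorem iteratedLineDeriv_sconv (a b : 𝓢(Rn n, ℂ)) {l : ℕ} (m : Fin l → Rn n) :
    LineDeriv.iteratedLineDerivOp m (sconv a b) = sconv (LineDeriv.iteratedLineDerivOp m a) b := by
  induction l with
  | zero => simp
  | succ l ih =>
    rw [LineDeriv.iteratedLineDerivOp_succ_left, LineDeriv.iteratedLineDerivOp_succ_left, ih,
      lineDeriv_sconv]

theorem sconv_sub_left (a b c : 𝓢(Rn n, ℂ)) : sconv (a - b) c = sconv a c - sconv b c := by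
  simp [sconv]

theorem sconv_sum_left {ι : Type*} (s : Finset ι) (a : ι → 𝓢(Rn n, ℂ)) (c : 𝓢(Rn n, ℂ)) :
    sconv (∑ i ∈ s, a i) c = ∑ i ∈ s, sconv (a i) c := by
  simp [sconv]

end SchwartzConvolution

/-! ### Tempered distributions: growth and convolution -/

section Distributions

variable {n : ℕ}

/-- The translate `z ↦ g (z - y)`. -/
abbrev translate (g : 𝓢(Rn n, ℂ)) (y : Rn n) : 𝓢(Rn n, ℂ) := SchwartzMap.compSubConstCLM ℝ y g

theorem iteratedFDeriv_translate (g : 𝓢(Rn n, ℂ)) (y x : Rn n) (l : ℕ) :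
    iteratedFDeriv ℝ l (translate g y) x = iteratedFDeriv ℝ l g (x - y) :=
  iteratedFDeriv_comp_sub l y x

theorem pow_norm_le_shift (x y : Rn n) (k : ℕ) :
    ‖x‖ ^ k ≤ (1 + ‖y‖) ^ k * (1 + ‖x - y‖) ^ k := by
  rw [← mul_pow]
  have : ‖x‖ ≤ ‖x - y‖ + ‖y‖ := by simpa using norm_add_le (x - y) y
  gcongr
  nlinarith [norm_nonneg (x - y), norm_nonneg y]

theorem seminorm_translate_le (g : 𝓢(Rn n, ℂ)) (k l : ℕ) : ∃ C : ℝ, 0 ≤ C ∧ ∀ y,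
    SchwartzMap.seminorm ℂ k l (translate g y) ≤ C * (1 + ‖y‖) ^ k := by
  refine ⟨2 ^ k * ((Finset.Iic (k, l)).sup fun m => SchwartzMap.seminorm ℂ m.1 m.2) g,
    by positivity, fun y => ?_⟩
  refine SchwartzMap.seminorm_le_bound ℂ k l _ (by positivity) fun x => ?_
  rw [iteratedFDeriv_translate]
  have h := SchwartzMap.one_add_le_sup_seminorm_apply (𝕜 := ℂ) (m := (k, l)) le_rfl le_rfl g (x - y)
  calc ‖x‖ ^ k * ‖iteratedFDeriv ℝ l g (x - y)‖
      ≤ (1 + ‖y‖) ^ k * (1 + ‖x - y‖) ^ k * ‖iteratedFDeriv ℝ l g (x - y)‖ := by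
        gcongr; exact pow_norm_le_shift x y k
    _ = (1 + ‖y‖) ^ k * ((1 + ‖x - y‖) ^ k * ‖iteratedFDeriv ℝ l g (x - y)‖) := by ring
    _ ≤ (1 + ‖y‖) ^ k *
        (2 ^ k * ((Finset.Iic (k, l)).sup fun m => SchwartzMap.seminorm ℂ m.1 m.2) g) := by
        gcongr
    _ = _ := by ring

/-- Mean value inequality on the unit ball around u, over which the weight 1 + ‖·‖ changes by a
factor at most 2. -/
theorem norm_iteratedFDeriv_sub_le (g : 𝓢(Rn n, ℂ)) (k l : ℕ) : ∃ C : ℝ, 0 ≤ C ∧ ∀ u h : Rn n,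
    ‖h‖ ≤ 1 → (1 + ‖u‖) ^ k * ‖iteratedFDeriv ℝ l g (u + h) - iteratedFDeriv ℝ l g u‖ ≤
      C * ‖h‖ := by
  refine ⟨2 ^ k * (2 ^ k * ((Finset.Iic (k, l + 1)).sup
    fun m => SchwartzMap.seminorm ℂ m.1 m.2) g), by positivity, fun u h hh => ?_⟩
  set S := 2 ^ k * ((Finset.Iic (k, l + 1)).sup fun m => SchwartzMap.seminorm ℂ m.1 m.2) g with hS
  have hd : ∀ v, ‖v - u‖ ≤ 1 → (1 + ‖u‖) ^ k * ‖iteratedFDeriv ℝ (l + 1) g v‖ ≤ 2 ^ k * S := by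
    intro v hv
    have h := SchwartzMap.one_add_le_sup_seminorm_apply (𝕜 := ℂ) (m := (k, l + 1)) le_rfl le_rfl g v
    have h2 : ‖u‖ ≤ ‖v‖ + ‖v - u‖ := by
      have := norm_sub_le v (v - u); simpa using this
    calc (1 + ‖u‖) ^ k * ‖iteratedFDeriv ℝ (l + 1) g v‖
        ≤ (2 * (1 + ‖v‖)) ^ k * ‖iteratedFDeriv ℝ (l + 1) g v‖ := by
          gcongr; linarith [norm_nonneg v]
      _ = 2 ^ k * ((1 + ‖v‖) ^ k * ‖iteratedFDeriv ℝ (l + 1) g v‖) := by rw [mul_pow]; ring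
      _ ≤ 2 ^ k * S := by gcongr
  have hpos : 0 < (1 + ‖u‖) ^ k := by positivity
  have hmv := Convex.norm_image_sub_le_of_norm_fderiv_le (𝕜 := ℝ)
    (f := iteratedFDeriv ℝ l g) (s := Metric.closedBall u 1) (x := u) (y := u + h)
    (C := 2 ^ k * S / (1 + ‖u‖) ^ k)
    (fun v _ => ((g.smooth (l + 1 : ℕ)).differentiable_iteratedFDeriv
      (by exact_mod_cast Nat.lt_succ_self l)) v)
    (fun v hv => by
      rw [norm_fderiv_iteratedFDeriv, le_div_iff₀ hpos, mul_comm]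
      exact hd v (by simpa [dist_eq_norm] using hv))
    (convex_closedBall _ _) (by simp) (by simpa using hh)
  rw [add_sub_cancel_left] at hmv
  calc _ ≤ (1 + ‖u‖) ^ k * (2 ^ k * S / (1 + ‖u‖) ^ k * ‖h‖) := by gcongr
    _ = 2 ^ k * S * ‖h‖ := by field_simp

theorem continuous_translate (g : 𝓢(Rn n, ℂ)) : Continuous (translate g) := by
  rw [continuous_iff_continuousAt]
  intro y₀
  refine ((schwartz_withSeminorms ℂ (Rn n) ℂ).tendsto_nhds _ _).2 fun ⟨k, l⟩ ε hε => ?_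
  obtain ⟨C, hC, hb⟩ := norm_iteratedFDeriv_sub_le g k l
  have hlim : Tendsto (fun y => (1 + ‖y₀‖) ^ k * (C * ‖y₀ - y‖)) (𝓝 y₀) (𝓝 0) := by
    have : Continuous fun y => (1 + ‖y₀‖) ^ k * (C * ‖y₀ - y‖) := by fun_prop
    simpa using this.tendsto y₀
  have hnear : ∀ᶠ y in 𝓝 y₀, ‖y₀ - y‖ ≤ 1 := by
    have : Continuous fun y => ‖y₀ - y‖ := by fun_prop
    exact (this.tendsto y₀).eventually (eventually_le_nhds (by simp))
  filter_upwards [hlim.eventually (gt_mem_nhds hε), hnear] with y hy hy1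
  refine lt_of_le_of_lt ?_ hy
  rw [SchwartzMap.schwartzSeminormFamily_apply]
  refine SchwartzMap.seminorm_le_bound ℂ k l _ (by positivity) fun x => ?_
  have hsub : iteratedFDeriv ℝ l (translate g y - translate g y₀ : 𝓢(Rn n, ℂ)) x =
      iteratedFDeriv ℝ l g (x - y₀ + (y₀ - y)) - iteratedFDeriv ℝ l g (x - y₀) := by
    rw [show x - y₀ + (y₀ - y) = x - y by abel, ← iteratedFDeriv_translate,
      ← iteratedFDeriv_translate]
    have : ((translate g y - translate g y₀ : 𝓢(Rn n, ℂ)) : Rn n → ℂ) =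
      (translate g y : Rn n → ℂ) - (translate g y₀ : Rn n → ℂ) := rfl
    rw [this, iteratedFDeriv_sub_apply]
    · exact (SchwartzMap.smooth _ l).contDiffAt
    · exact (SchwartzMap.smooth _ l).contDiffAt
  rw [hsub]
  calc _ ≤ (1 + ‖y₀‖) ^ k * (1 + ‖x - y₀‖) ^ k *
        ‖iteratedFDeriv ℝ l g (x - y₀ + (y₀ - y)) - iteratedFDeriv ℝ l g (x - y₀)‖ := by
        gcongr; exact pow_norm_le_shift x y₀ k
    _ = (1 + ‖y₀‖) ^ k * ((1 + ‖x - y₀‖) ^ k *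
        ‖iteratedFDeriv ℝ l g (x - y₀ + (y₀ - y)) - iteratedFDeriv ℝ l g (x - y₀)‖) := by ring
    _ ≤ _ := by gcongr ?_ * ?_; exact hb _ _ hy1

/-! ### Distributions as functionals on a Banach space; exchanging them with integrals -/

theorem continuous_distribution (f : 𝓢'(Rn n, ℂ)) : Continuous f := map_continuous f

theorem exists_seminorm_bound (f : 𝓢'(Rn n, ℂ)) : ∃ (s : Finset (ℕ × ℕ)) (C : ℝ), 0 ≤ C ∧
    ∀ φ : 𝓢(Rn n, ℂ), ‖f φ‖ ≤ C * (s.sup (schwartzSeminormFamily ℂ (Rn n) ℂ)) φ := by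
  let L : 𝓢(Rn n, ℂ) →ₗ[ℂ] ℂ := ⟨⟨f, map_add f⟩, map_smul f⟩
  obtain ⟨s, C, -, h⟩ := Seminorm.bound_of_continuous (schwartz_withSeminorms ℂ (Rn n) ℂ)
    ((normSeminorm ℂ ℂ).comp L) (continuous_norm.comp (continuous_distribution f))
  exact ⟨s, C, C.2, fun φ => h φ⟩

theorem exists_growth_translate (f : 𝓢'(Rn n, ℂ)) (g : 𝓢(Rn n, ℂ)) : ∃ (C : ℝ) (K : ℕ), 0 ≤ C ∧
    ∀ y, ‖f (translate g y)‖ ≤ C * (1 + ‖y‖) ^ K := by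
  obtain ⟨s, C, hC, hf⟩ := exists_seminorm_bound f
  choose D hD hDb using fun i : ℕ × ℕ => seminorm_translate_le g i.1 i.2
  refine ⟨C * ∑ i ∈ s, D i, s.sup Prod.fst, mul_nonneg hC (Finset.sum_nonneg fun i _ => hD i),
    fun y => (hf _).trans ?_⟩
  rw [mul_assoc]
  refine mul_le_mul_of_nonneg_left ?_ hC
  refine Seminorm.finset_sup_apply_le
    (mul_nonneg (Finset.sum_nonneg fun i _ => hD i) (by positivity)) fun i hi => ?_
  refine (hDb i y).trans ?_
  have hi1 : i.1 ≤ s.sup Prod.fst := Finset.le_sup (f := Prod.fst) hi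
  have hi2 : D i ≤ ∑ i ∈ s, D i := Finset.single_le_sum (f := D) (fun i _ => hD i) hi
  have h1 : 1 ≤ 1 + ‖y‖ := by simp
  exact mul_le_mul hi2 (pow_le_pow_right₀ h1 hi1) (by positivity) ((hD i).trans hi2)

/-- Indices of the functionals `φ ↦ ‖x‖ᵏ ∂^m φ(x)`, with `‖m_i‖ ≤ 1` and `(k, l) ∈ s`. -/
structure SeminormIndex (n : ℕ) (s : Finset (ℕ × ℕ)) where
  i : ℕ × ℕ
  hi : i ∈ s
  x : Rn n
  m : Fin i.2 → Rn n
  hm : ∀ j, ‖m j‖ ≤ 1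

/-- With the discrete topology every bounded family of values is a bounded continuous function, so
the sup norm over the indices lives on a Banach space. -/
instance (s : Finset (ℕ × ℕ)) : TopologicalSpace (SeminormIndex n s) := ⊥

instance (s : Finset (ℕ × ℕ)) : DiscreteTopology (SeminormIndex n s) := ⟨rfl⟩

/-- The functional `φ ↦ ‖x‖ᵏ ∂^m φ(x)`. -/
def seminormFunctional {s : Finset (ℕ × ℕ)} (j : SeminormIndex n s) (φ : 𝓢(Rn n, ℂ)) : ℂ :=
  (‖j.x‖ ^ j.i.1 : ℝ) * LineDeriv.iteratedLineDerivOp j.m φ j.x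

theorem norm_seminormFunctional_le {s : Finset (ℕ × ℕ)} (j : SeminormIndex n s)
    (φ : 𝓢(Rn n, ℂ)) :
    ‖seminormFunctional j φ‖ ≤ (s.sup (schwartzSeminormFamily ℂ (Rn n) ℂ)) φ := by
  have h1 : ‖seminormFunctional j φ‖ ≤ ‖j.x‖ ^ j.i.1 * ‖iteratedFDeriv ℝ j.i.2 φ j.x‖ := by
    rw [seminormFunctional, SchwartzMap.iteratedLineDerivOp_eq_iteratedFDeriv, norm_mul,
      Complex.norm_real, norm_pow, norm_norm]
    gcongr
    refine (ContinuousMultilinearMap.le_opNorm _ _).trans ?_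
    exact mul_le_of_le_one_right (norm_nonneg _)
      (Finset.prod_le_one (fun _ _ => norm_nonneg _) fun k _ => j.hm k)
  refine (h1.trans (SchwartzMap.le_seminorm ℂ _ _ φ j.x)).trans ?_
  exact Seminorm.le_def.1 (Finset.le_sup (f := schwartzSeminormFamily ℂ (Rn n) ℂ) j.hi) φ

/-- The norm of a multilinear map is determined by its values on vectors of norm at most 1: each
non-zero direction is normalised, and zero directions contribute nothing. -/
theorem sup_seminorm_le {s : Finset (ℕ × ℕ)} {φ : 𝓢(Rn n, ℂ)} {M : ℝ} (hM : 0 ≤ M)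
    (h : ∀ j : SeminormIndex n s, ‖seminormFunctional j φ‖ ≤ M) :
    (s.sup (schwartzSeminormFamily ℂ (Rn n) ℂ)) φ ≤ M := by
  refine Seminorm.finset_sup_apply_le hM fun i hi => ?_
  refine SchwartzMap.seminorm_le_bound ℂ i.1 i.2 _ hM fun x => ?_
  rcases (pow_nonneg (norm_nonneg x) i.1).eq_or_lt with h0 | h0
  · rw [← h0, zero_mul]; exact hM
  rw [← le_div_iff₀' h0]
  refine ContinuousMultilinearMap.opNorm_le_bound (by positivity) fun m => ?_
  have hm : m = fun k => ‖m k‖ • (‖m k‖⁻¹ • m k) := by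
    funext k
    rcases eq_or_ne (m k) 0 with hk | hk
    · simp [hk]
    · rw [smul_smul, mul_inv_cancel₀ (norm_ne_zero_iff.2 hk), one_smul]
  have h1 := h ⟨i, hi, x, fun k => ‖m k‖⁻¹ • m k, fun k => by
    rw [norm_smul, norm_inv, norm_norm]; exact inv_mul_le_one⟩
  rw [seminormFunctional, SchwartzMap.iteratedLineDerivOp_eq_iteratedFDeriv, norm_mul,
    Complex.norm_real, norm_pow, norm_norm, ← le_div_iff₀' h0] at h1
  conv_lhs => rw [hm]
  rw [ContinuousMultilinearMap.map_smul_univ, norm_smul, Finset.prod_congr rfl fun _ _ => rfl,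
    mul_comm]
  simp only [norm_prod, norm_norm]
  gcongr

theorem seminormFunctional_add {s : Finset (ℕ × ℕ)} (j : SeminormIndex n s) (φ ψ : 𝓢(Rn n, ℂ)) :
    seminormFunctional j (φ + ψ) = seminormFunctional j φ + seminormFunctional j ψ := by
  simp only [seminormFunctional, LineDeriv.iteratedLineDerivOp_add, add_apply, mul_add]

theorem seminormFunctional_smul {s : Finset (ℕ × ℕ)} (j : SeminormIndex n s) (c : ℂ)
    (φ : 𝓢(Rn n, ℂ)) : seminormFunctional j (c • φ) = c * seminormFunctional j φ := by
  simp only [seminormFunctional, LineDeriv.iteratedLineDerivOp_smul, smul_apply, smul_eq_mul]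
  ring

/-- Schwartz space embedded into bounded functions by finitely many of its seminorms. -/
def seminormEmbedding (s : Finset (ℕ × ℕ)) :
    𝓢(Rn n, ℂ) →ₗ[ℂ] BoundedContinuousFunction (SeminormIndex n s) ℂ where
  toFun φ := BoundedContinuousFunction.ofNormedAddCommGroupDiscrete
    (fun j => seminormFunctional j φ) _ fun j => norm_seminormFunctional_le j φ
  map_add' φ ψ := by
    ext j; exact seminormFunctional_add j φ ψ
  map_smul' c φ := by
    ext j; exact seminormFunctional_smul j c φ

theorem seminormEmbedding_apply (s : Finset (ℕ × ℕ)) (φ : 𝓢(Rn n, ℂ)) (j : SeminormIndex n s) :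
    seminormEmbedding s φ j = seminormFunctional j φ := rfl

theorem norm_seminormEmbedding (s : Finset (ℕ × ℕ)) (φ : 𝓢(Rn n, ℂ)) :
    ‖seminormEmbedding s φ‖ = (s.sup (schwartzSeminormFamily ℂ (Rn n) ℂ)) φ := by
  refine le_antisymm ?_ ?_
  · exact (BoundedContinuousFunction.norm_le (apply_nonneg _ _)).2 fun j =>
      norm_seminormFunctional_le j φ
  · exact sup_seminorm_le (norm_nonneg _) fun j => (seminormEmbedding s φ).norm_coe_le_norm j

/-- A distribution is bounded by finitely many seminorms, so it descends to the range of
`seminormEmbedding` as a bounded functional, and Hahn-Banach extends it to a Banach space. There it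
commutes with Bochner integrals. -/
theorem exists_extension (f : 𝓢'(Rn n, ℂ)) : ∃ (s : Finset (ℕ × ℕ))
    (F : BoundedContinuousFunction (SeminormIndex n s) ℂ →L[ℂ] ℂ),
    ∀ φ, f φ = F (seminormEmbedding s φ) := by
  obtain ⟨s, C, hC, hf⟩ := exists_seminorm_bound f
  let L : 𝓢(Rn n, ℂ) →ₗ[ℂ] ℂ := ⟨⟨f, map_add f⟩, map_smul f⟩
  -- A Schwartz function killed by the chosen seminorms is killed by f.
  have hker : LinearMap.ker (seminormEmbedding s) ≤ LinearMap.ker L := by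
    intro φ hφ
    have h1 := hf φ
    rw [← norm_seminormEmbedding, LinearMap.mem_ker.1 hφ, norm_zero, mul_zero] at h1
    exact norm_le_zero_iff.1 h1
  let G : LinearMap.range (seminormEmbedding (n := n) s) →ₗ[ℂ] ℂ :=
    (LinearMap.ker (seminormEmbedding s)).liftQ L hker ∘ₗ
      (seminormEmbedding s).quotKerEquivRange.symm.toLinearMap
  have hG : ∀ φ, G ⟨seminormEmbedding s φ, φ, rfl⟩ = f φ := by
    intro φ
    have : (⟨seminormEmbedding s φ, φ, rfl⟩ : LinearMap.range (seminormEmbedding (n := n) s)) =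
      (seminormEmbedding s).quotKerEquivRange (Submodule.Quotient.mk φ) := rfl
    rw [this]
    simp only [G, LinearMap.comp_apply, LinearEquiv.coe_coe, LinearEquiv.symm_apply_apply]
    rfl
  let G' : StrongDual ℂ (LinearMap.range (seminormEmbedding (n := n) s)) :=
    G.mkContinuous C (by
      rintro ⟨_, φ, rfl⟩
      rw [hG]
      refine (hf φ).trans_eq ?_
      rw [← norm_seminormEmbedding]
      rfl)
  obtain ⟨F, hF, -⟩ := exists_extension_norm_eq _ G'
  exact ⟨s, F, fun φ => (hG φ).symm.trans (hF ⟨seminormEmbedding s φ, φ, rfl⟩).symm⟩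

theorem continuous_seminormEmbedding (s : Finset (ℕ × ℕ)) :
    Continuous (seminormEmbedding (n := n) s) :=
  (schwartz_withSeminorms ℂ (Rn n) ℂ).continuous_normedSpace_rng _
    (seminormEmbedding s) ⟨s, 1, fun φ => by
      simp only [Seminorm.comp_apply, coe_normSeminorm, norm_seminormEmbedding, one_smul]; rfl⟩

theorem integrable_growth_mul (β : 𝓢(Rn n, ℂ)) (K : ℕ) :
    Integrable fun z => (1 + ‖z‖) ^ K * ‖β z‖ := by
  have h : ∀ z, (1 + ‖z‖) ^ K * ‖β z‖ = ∑ i ∈ Finset.range (K + 1), (K.choose i : ℝ) *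
      (‖z‖ ^ i * ‖β z‖) := by
    intro z
    rw [add_comm, add_pow, Finset.sum_mul]
    refine Finset.sum_congr rfl fun i _ => ?_
    rw [one_pow]; ring
  simp only [h]
  exact integrable_finsetSum _ fun i _ => (β.integrable_pow_mul volume i).const_mul _

/-- The convolution is a superposition of translates of g. In the Banach space of
`seminormEmbedding` this is a Bochner integral, convergent because seminorms of translates grow
polynomially and β decays rapidly, and the extended functional passes under it. -/
theorem distribution_sconv (f : 𝓢'(Rn n, ℂ)) (g β : 𝓢(Rn n, ℂ)) :
    f (sconv g β) = ∫ z, f (translate g z) * β z := by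
  obtain ⟨s, F, hF⟩ := exists_extension f
  have hint : Integrable fun z => β z • seminormEmbedding s (translate g z) := by
    choose D hD hDb using fun i : ℕ × ℕ => seminorm_translate_le g i.1 i.2
    have hb : ∀ z, ‖seminormEmbedding s (translate g z)‖ ≤
        (∑ i ∈ s, D i) * (1 + ‖z‖) ^ (s.sup Prod.fst) := by
      intro z
      rw [norm_seminormEmbedding]
      refine Seminorm.finset_sup_apply_le
        (mul_nonneg (Finset.sum_nonneg fun i _ => hD i) (by positivity)) fun i hi => ?_
      refine (hDb i z).trans ?_
      have hi1 : i.1 ≤ s.sup Prod.fst := Finset.le_sup (f := Prod.fst) hi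
      have hi2 : D i ≤ ∑ i ∈ s, D i := Finset.single_le_sum (f := D) (fun i _ => hD i) hi
      have h1 : 1 ≤ 1 + ‖z‖ := by simp
      exact mul_le_mul hi2 (pow_le_pow_right₀ h1 hi1) (by positivity) ((hD i).trans hi2)
    refine ((integrable_growth_mul β (s.sup Prod.fst)).const_mul (∑ i ∈ s, D i)).mono'
      (β.continuous.smul ((continuous_seminormEmbedding s).comp
        (continuous_translate g))).aestronglyMeasurable (ae_of_all _ fun z => ?_)
    rw [norm_smul]
    calc ‖β z‖ * ‖seminormEmbedding s (translate g z)‖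
        ≤ ‖β z‖ * ((∑ i ∈ s, D i) * (1 + ‖z‖) ^ (s.sup Prod.fst)) := by gcongr; exact hb z
      _ = _ := by ring
  -- Checked coordinate by coordinate: all derivatives of the convolution can be put on g.
  have hI : ∫ z, β z • seminormEmbedding s (translate g z) = seminormEmbedding s (sconv g β) := by
    ext j
    have h1 := (BoundedContinuousFunction.evalCLM ℂ j).integral_comp_comm hint
    have h2 : (∫ z, β z • seminormEmbedding s (translate g z)) j =
      ∫ z, β z * seminormFunctional j (translate g z) := h1.symm
    rw [h2, seminormEmbedding_apply, seminormFunctional, iteratedLineDeriv_sconv, sconv_apply',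
      ← integral_const_mul]
    refine integral_congr_ae (ae_of_all _ fun z => ?_)
    simp only [seminormFunctional, SchwartzMap.iteratedLineDerivOp_eq_iteratedFDeriv,
      iteratedFDeriv_translate]
    ring
  rw [hF, ← hI, ← F.integral_comp_comm hint]
  refine integral_congr_ae (ae_of_all _ fun z => ?_)
  simp only [map_smul, smul_eq_mul, ← hF]
  ring

/-- The reflection `z ↦ φ (-z)`. -/
abbrev reflect (φ : 𝓢(Rn n, ℂ)) : 𝓢(Rn n, ℂ) :=
  SchwartzMap.compCLMOfContinuousLinearEquiv ℝ (ContinuousLinearEquiv.neg ℝ) φ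

theorem reflectTranslate_apply (φ : 𝓢(Rn n, ℂ)) (y z : Rn n) :
    reflectTranslate φ y z = φ (y - z) := by
  change φ (-(z - y)) = _
  rw [neg_sub]

theorem continuous_conv (f : 𝓢'(Rn n, ℂ)) (φ : 𝓢(Rn n, ℂ)) : Continuous (conv f φ) :=
  (continuous_distribution f).comp (continuous_translate (reflect φ))

theorem exists_growth_conv (f : 𝓢'(Rn n, ℂ)) (φ : 𝓢(Rn n, ℂ)) : ∃ (C : ℝ) (K : ℕ), 0 ≤ C ∧
    ∀ y, ‖conv f φ y‖ ≤ C * (1 + ‖y‖) ^ K :=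
  exists_growth_translate f (reflect φ)

theorem reflectTranslate_sconv (a c : 𝓢(Rn n, ℂ)) (y : Rn n) :
    reflectTranslate (sconv a c) y = sconv (reflect a) (reflectTranslate c y) := by
  ext x
  rw [reflectTranslate_apply, sconv_apply, sconv_apply]
  rw [← integral_neg_eq_self]
  refine integral_congr_ae (ae_of_all _ fun t => ?_)
  simp only [reflectTranslate_apply]
  change a (-t) * c (y - x - -t) = a (-t) * c (y - (x - t))
  congr 2
  abel

theorem conv_sconv (f : 𝓢'(Rn n, ℂ)) (a c : 𝓢(Rn n, ℂ)) (y : Rn n) :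
    conv f (sconv a c) y = ∫ z, conv f a z * c (y - z) := by
  rw [conv, reflectTranslate_sconv, distribution_sconv]
  simp only [reflectTranslate_apply]
  rfl

theorem conv_sub (f : 𝓢'(Rn n, ℂ)) (a c : 𝓢(Rn n, ℂ)) (y : Rn n) :
    conv f (a - c) y = conv f a y - conv f c y := by
  simp only [conv, reflectTranslate, map_sub]

theorem conv_sum (f : 𝓢'(Rn n, ℂ)) {ι : Type*} (s : Finset ι) (a : ι → 𝓢(Rn n, ℂ)) (y : Rn n) :
    conv f (∑ i ∈ s, a i) y = ∑ i ∈ s, conv f (a i) y := by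
  simp only [conv, reflectTranslate, map_sum]

end Distributions

end AnisoLP

namespace AnisoLP

/-! ### Exponential polynomials -/

section ExponentialPolynomials

open Polynomial

/-- Formal exponential polynomials `∑ p_ν(k) νᵏ`. -/
abbrev ExpPoly : Type := MonoidAlgebra ℂ[X] ℂˣ

/-- The value `∑ p_ν(k) νᵏ` at a natural number `k`. -/
def ExpPoly.evalNat (k : ℕ) : ExpPoly →+* ℂ :=
  MonoidAlgebra.liftNCRingHom (evalRingHom (k : ℂ)) ((powMonoidHom k).comp (Units.coeHom ℂ))
    fun _ _ => Commute.all _ _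

/-- The value `∑ p_ν(0) |ν|ˢ` of the modulus flow at a complex time `s`. -/
def ExpPoly.evalFlow (s : ℂ) : ExpPoly →+* ℂ :=
  MonoidAlgebra.liftNCRingHom (evalRingHom (0 : ℂ))
    { toFun := fun ν => ((‖(ν : ℂ)‖ : ℝ) : ℂ) ^ s
      map_one' := by simp
      map_mul' := fun ν μ => by
        rw [Units.val_mul, norm_mul, Complex.ofReal_mul,
          Complex.mul_cpow_ofReal_nonneg (norm_nonneg _) (norm_nonneg _)] }
    fun _ _ => Commute.all _ _

namespace ExpPoly

theorem evalNat_single (k : ℕ) (ν : ℂˣ) (p : ℂ[X]) :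
    evalNat k (MonoidAlgebra.single ν p) = p.eval (k : ℂ) * (ν : ℂ) ^ k := by
  simp [evalNat]

theorem evalFlow_single (s : ℂ) (ν : ℂˣ) (p : ℂ[X]) :
    evalFlow s (MonoidAlgebra.single ν p) = p.eval 0 * ((‖(ν : ℂ)‖ : ℝ) : ℂ) ^ s := by
  simp [evalFlow]

theorem evalNat_eq_sum (k : ℕ) (β : ExpPoly) :
    evalNat k β = β.coeff.sum fun ν p => p.eval (k : ℂ) * (ν : ℂ) ^ k := by
  conv_lhs => rw [← MonoidAlgebra.sum_coeff_single β]
  rw [map_finsuppSum]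
  simp only [evalNat_single]

theorem evalFlow_eq_sum (s : ℂ) (β : ExpPoly) :
    evalFlow s β = β.coeff.sum fun ν p => p.eval 0 * ((‖(ν : ℂ)‖ : ℝ) : ℂ) ^ s := by
  conv_lhs => rw [← MonoidAlgebra.sum_coeff_single β]
  rw [map_finsuppSum]
  simp only [evalFlow_single]

/-- At time 0 only the numbers p_ν(0) enter, so the flow starts at the initial point of the orbit.
-/
theorem evalFlow_zero (β : ExpPoly) : evalFlow 0 β = evalNat 0 β := by
  simp [evalNat_eq_sum, evalFlow_eq_sum]

/-- Complex conjugation of exponential polynomials. -/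
def conj : ExpPoly →+* ExpPoly :=
  (MonoidAlgebra.mapRingHom ℂˣ (mapRingHom (starRingEnd ℂ))).comp
    (MonoidAlgebra.mapDomainRingHom ℂ[X] (Units.map (starRingEnd ℂ : ℂ →* ℂ)))

theorem conj_single (ν : ℂˣ) (p : ℂ[X]) : conj (MonoidAlgebra.single ν p) =
    MonoidAlgebra.single (Units.map (starRingEnd ℂ : ℂ →* ℂ) ν) (p.map (starRingEnd ℂ)) := by
  simp [conj]

theorem eval_map_conj (p : ℂ[X]) (x : ℝ) :
    (p.map (starRingEnd ℂ)).eval (x : ℂ) = starRingEnd ℂ (p.eval (x : ℂ)) := by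
  have h := eval₂_at_apply (p := p) (starRingEnd ℂ) (x : ℂ)
  rwa [Complex.conj_ofReal, ← eval_map] at h

theorem evalNat_conj (k : ℕ) (β : ExpPoly) :
    evalNat k (conj β) = starRingEnd ℂ (evalNat k β) := by
  induction β using MonoidAlgebra.induction_linear with
  | zero => simp
  | add f g hf hg => simp [hf, hg]
  | single ν p =>
    rw [conj_single, evalNat_single, evalNat_single, map_mul, map_pow]
    have := eval_map_conj p (k : ℝ)
    rw [Complex.ofReal_natCast] at this
    rw [this]
    rfl

theorem evalFlow_conj (s : ℂ) (β : ExpPoly) :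
    evalFlow s (conj β) = starRingEnd ℂ (evalFlow (starRingEnd ℂ s) β) := by
  induction β using MonoidAlgebra.induction_linear with
  | zero => simp
  | add f g hf hg => simp [hf, hg]
  | single ν p =>
    rw [conj_single, evalFlow_single, evalFlow_single, map_mul]
    have := eval_map_conj p 0
    rw [Complex.ofReal_zero] at this
    have hν : ‖((Units.map (starRingEnd ℂ : ℂ →* ℂ) ν : ℂˣ) : ℂ)‖ = ‖(ν : ℂ)‖ :=
      Complex.norm_conj _
    have harg : ((‖(ν : ℂ)‖ : ℝ) : ℂ).arg ≠ Real.pi := by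
      rw [Complex.arg_ofReal_of_nonneg (norm_nonneg _)]
      exact Real.pi_pos.ne
    rw [this, hν, Complex.cpow_conj _ _ harg, Complex.conj_ofReal, Complex.conj_conj]

end ExpPoly

/-! ### Growth of exponential polynomials -/

theorem eval_nat_not_tendsto_zero {q : ℂ[X]}
    (h : Tendsto (fun k : ℕ => ‖q.eval (k : ℂ)‖) atTop (𝓝 0)) : q = 0 := by
  rcases lt_or_ge 0 q.degree with hd | hd
  · have h1 : Tendsto (fun k : ℕ => ‖(k : ℂ)‖) atTop atTop := by
      simpa using tendsto_natCast_atTop_atTop (R := ℝ)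
    exact absurd h (not_tendsto_nhds_of_tendsto_atTop (q.tendsto_norm_atTop hd h1) 0)
  · rw [eq_C_of_degree_le_zero hd] at h ⊢
    simp only [eval_C] at h
    have := tendsto_nhds_unique h tendsto_const_nhds
    rw [norm_eq_zero.1 this.symm, C_0]

theorem taylor_shift_ne_zero {ν μ : ℂ} (h : ν ≠ μ) {p : ℂ[X]} (hp : p ≠ 0) :
    C ν * taylor 1 p - C μ * p ≠ 0 := by
  intro h0
  have h1 := congrArg leadingCoeff (sub_eq_zero.1 h0)
  simp only [leadingCoeff_mul, leadingCoeff_C, leadingCoeff_taylor] at h1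
  exact h (mul_right_cancel₀ (leadingCoeff_ne_zero.2 hp) h1)

theorem degree_taylor_sub_lt {p : ℂ[X]} (hp : p ≠ 0) (c : ℂ) :
    (C c * taylor 1 p - C c * p).degree < p.degree := by
  rw [← mul_sub]
  rcases eq_or_ne c 0 with rfl | hc
  · simpa [bot_lt_iff_ne_bot] using hp
  rw [degree_C_mul hc]
  have := degree_sub_lt_left (degree_taylor p 1) (by rwa [Ne, taylor_eq_zero])
    (leadingCoeff_taylor 1 p)
  rwa [degree_taylor] at this

/-- If an exponential polynomial is `O(θᵏ)`, the terms with `|ν| > θ` vanish. -/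
theorem norm_le_of_sum_isBigO {θ : ℝ} (hθ : 0 < θ) (s : Finset ℂ) : ∀ (P : ℂ → ℂ[X]) (ν₀ : ℂ),
    ν₀ ∉ s → P ν₀ ≠ 0 → (∃ K : ℝ, ∀ k : ℕ, ‖(P ν₀).eval (k : ℂ) * ν₀ ^ k +
      ∑ ν ∈ s, (P ν).eval (k : ℂ) * ν ^ k‖ ≤ K * θ ^ k) → ‖ν₀‖ ≤ θ := by
  classical
  induction s using Finset.induction_on with
  | empty =>
    rintro P ν₀ - hP ⟨K, hK⟩
    -- If |ν₀| > θ, dividing by ν₀^k leaves a polynomial that tends to 0 along the integers, hence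
    -- the zero polynomial.
    by_contra hlt
    push Not at hlt
    have hν : 0 < ‖ν₀‖ := hθ.trans hlt
    refine hP (eval_nat_not_tendsto_zero (squeeze_zero (fun _ => norm_nonneg _)
      (g := fun k : ℕ => K * (θ / ‖ν₀‖) ^ k) (fun k => ?_) ?_))
    · have := hK k
      simp only [Finset.sum_empty, add_zero, norm_mul, norm_pow] at this
      rw [div_pow, ← mul_div_assoc, le_div_iff₀ (by positivity)]
      exact this
    · have h1 : Tendsto (fun k : ℕ => (θ / ‖ν₀‖) ^ k) atTop (𝓝 0) :=
        tendsto_pow_atTop_nhds_zero_of_lt_one (by positivity) ((div_lt_one hν).2 hlt)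
      simpa using h1.const_mul K
  | insert μ s hμ ih =>
    -- The operator a_k ↦ a_{k+1} - μ a_k replaces p_ν by ν p_ν(· + 1) - μ p_ν. It preserves the
    -- bound O(θ^k), lowers the degree of p_μ, and cannot kill p_{ν₀} since ν₀ ≠ μ. Iterating
    -- removes the term at μ; the induction is on a strict bound N of the degree, and N = 0 forces
    -- p_μ = 0.
    have main : ∀ (N : ℕ) (P : ℂ → ℂ[X]) (ν₀ : ℂ), (P μ).degree < N → ν₀ ∉ insert μ s →
        P ν₀ ≠ 0 → (∃ K : ℝ, ∀ k : ℕ, ‖(P ν₀).eval (k : ℂ) * ν₀ ^ k +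
        ∑ ν ∈ insert μ s, (P ν).eval (k : ℂ) * ν ^ k‖ ≤ K * θ ^ k) → ‖ν₀‖ ≤ θ := by
      intro N
      induction N with
      | zero =>
        rintro P ν₀ hN hν₀ hP ⟨K, hK⟩
        have hPμ : P μ = 0 := by
          rw [← degree_eq_bot]; simpa using hN
        refine ih P ν₀ (fun h => hν₀ (Finset.mem_insert_of_mem h)) hP ⟨K, fun k => ?_⟩
        have := hK k
        rwa [Finset.sum_insert hμ, hPμ, eval_zero, zero_mul, zero_add] at this
      | succ N ihN =>
        rintro P ν₀ hN hν₀ hP ⟨K, hK⟩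
        have hne : ν₀ ≠ μ := fun h => hν₀ (h ▸ Finset.mem_insert_self _ _)
        refine ihN (fun ν => C ν * taylor 1 (P ν) - C μ * P ν) ν₀ ?_ hν₀
          (taylor_shift_ne_zero hne hP) ⟨K * θ + ‖μ‖ * K, fun k => ?_⟩
        · rcases eq_or_ne (P μ) 0 with h0 | h0
          · simp only [h0, map_zero, mul_zero, sub_zero, degree_zero]
            exact bot_lt_iff_ne_bot.2 (by exact WithBot.coe_ne_bot)
          · refine (degree_taylor_sub_lt h0 μ).trans_le ?_
            rw [degree_eq_natDegree h0] at hN ⊢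
            exact_mod_cast Nat.lt_succ_iff.1 (by exact_mod_cast hN)
        · have hterm : ∀ ν : ℂ, (C ν * taylor 1 (P ν) - C μ * P ν).eval (k : ℂ) * ν ^ k =
              (P ν).eval ((k + 1 : ℕ) : ℂ) * ν ^ (k + 1) - μ * ((P ν).eval (k : ℂ) * ν ^ k) := by
            intro ν
            simp only [eval_sub, eval_mul, eval_C, taylor_eval, Nat.cast_add, Nat.cast_one]
            ring
          simp only [hterm, Finset.sum_sub_distrib, ← Finset.mul_sum]
          have h1 := hK k
          have h2 := hK (k + 1)
          calc _ = ‖((P ν₀).eval ((k + 1 : ℕ) : ℂ) * ν₀ ^ (k + 1) +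
                ∑ ν ∈ insert μ s, (P ν).eval ((k + 1 : ℕ) : ℂ) * ν ^ (k + 1)) -
                μ * ((P ν₀).eval (k : ℂ) * ν₀ ^ k +
                ∑ ν ∈ insert μ s, (P ν).eval (k : ℂ) * ν ^ k)‖ := by congr 1; ring
            _ ≤ K * θ ^ (k + 1) + ‖μ‖ * (K * θ ^ k) := by
              refine (norm_sub_le _ _).trans (add_le_add h2 ?_)
              rw [norm_mul]; gcongr
            _ = _ := by ring
    intro P ν₀ hν₀ hP hK
    exact main ((P μ).natDegree + 1) P ν₀ (by
      refine degree_le_natDegree.trans_lt ?_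
      exact_mod_cast Nat.lt_succ_self _) hν₀ hP hK

theorem ExpPoly.norm_le_of_isBigO {θ K : ℝ} (hθ : 0 < θ) (β : ExpPoly)
    (h : ∀ k, ‖evalNat k β‖ ≤ K * θ ^ k) : ∀ ν ∈ β.coeff.support, ‖(ν : ℂ)‖ ≤ θ := by
  classical
  intro ν₀ hν₀
  let P : ℂ → ℂ[X] := fun z => if hz : z = 0 then 0 else β.coeff (Units.mk0 z hz)
  have hP : ∀ ν : ℂˣ, P ν = β.coeff ν := fun ν => by
    simp [P]
  refine norm_le_of_sum_isBigO hθ ((β.coeff.support.erase ν₀).image Units.val) P ν₀ ?_ ?_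
    ⟨K, fun k => ?_⟩
  · intro hmem
    obtain ⟨ν, hν, hv⟩ := Finset.mem_image.1 hmem
    exact (Finset.mem_erase.1 hν).1 (Units.ext hv)
  · rw [hP]; exact Finsupp.mem_support_iff.1 hν₀
  · have := h k
    rw [evalNat_eq_sum, Finsupp.sum, ← Finset.add_sum_erase _ _ hν₀] at this
    rw [Finset.sum_image (fun _ _ _ _ h => Units.ext h)]
    simpa only [hP] using this

/-- The flow has frozen the polynomial factors at 0, so no polynomial loss appears and the rate θ is
attained exactly. -/
theorem ExpPoly.norm_evalFlow_le {θ : ℝ} (β : ExpPoly)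
    (h : ∀ ν ∈ β.coeff.support, ‖(ν : ℂ)‖ ≤ θ) :
    ∃ K : ℝ, 0 ≤ K ∧ ∀ s : ℂ, 0 ≤ s.re → ‖evalFlow s β‖ ≤ K * θ ^ s.re := by
  refine ⟨∑ ν ∈ β.coeff.support, ‖(β.coeff ν).eval 0‖,
    Finset.sum_nonneg fun _ _ => norm_nonneg _, fun s hs => ?_⟩
  rw [evalFlow_eq_sum, Finsupp.sum, Finset.sum_mul]
  refine norm_sum_le_of_le _ fun ν hν => ?_
  have h0 : 0 < ‖(ν : ℂ)‖ := norm_pos_iff.2 ν.ne_zero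
  rw [norm_mul, Complex.norm_cpow_eq_rpow_re_of_pos h0]
  gcongr
  exact h ν hν

theorem ExpPoly.differentiable_evalFlow (β : ExpPoly) : Differentiable ℂ fun s => evalFlow s β := by
  simp only [evalFlow_eq_sum, Finsupp.sum]
  refine Differentiable.fun_sum fun ν _ => (Differentiable.const_cpow differentiable_id
    (Or.inl ?_)).const_mul _
  simp

end ExponentialPolynomials

end AnisoLP

namespace AnisoLP

/-! ### Orbits of linear maps as exponential polynomials -/

section Orbits

open Polynomial

variable {n : ℕ}

/-- The flow of `β` decays like `qᵗ`. -/
def ExpPoly.FlowDecays (q : ℝ) (β : ExpPoly) : Prop :=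
  ∃ K : ℝ, 0 ≤ K ∧ ∀ s : ℂ, 0 ≤ s.re → ‖evalFlow s β‖ ≤ K * q ^ s.re

theorem ExpPoly.FlowDecays.mono {q q' : ℝ} (hq : 0 ≤ q) (hqq : q ≤ q') {β : ExpPoly}
    (h : FlowDecays q β) : FlowDecays q' β := by
  obtain ⟨K, hK, hb⟩ := h
  refine ⟨K, hK, fun s hs => (hb s hs).trans ?_⟩
  gcongr

theorem ExpPoly.FlowDecays.add {q : ℝ} {β β' : ExpPoly} (h : FlowDecays q β)
    (h' : FlowDecays q β') : FlowDecays q (β + β') := by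
  obtain ⟨K, hK, hb⟩ := h
  obtain ⟨K', hK', hb'⟩ := h'
  refine ⟨K + K', by positivity, fun s hs => ?_⟩
  rw [map_add, add_mul]
  exact (norm_add_le _ _).trans (add_le_add (hb s hs) (hb' s hs))

/-- Binomial expansion of T = S + ν with S nilpotent on v. As C(k, j) = 0 for j > k and S^j v = 0
for j ≥ N, the range of summation can be taken independent of k, which makes the coefficient of ν^k
a polynomial in k. -/
theorem pow_apply_eq_sum_choose {V : Type*} [AddCommGroup V] [Module ℂ V] (T : Module.End ℂ V)
    (ν : ℂ) (hν : ν ≠ 0) (v : V) (N : ℕ) (hN : ((T - ν • (1 : Module.End ℂ V)) ^ N) v = 0) (k : ℕ) :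
    (T ^ k) v = ∑ j ∈ Finset.range N, ((k.choose j : ℂ) * (ν ^ k * (ν⁻¹) ^ j)) •
      ((T - ν • (1 : Module.End ℂ V)) ^ j) v := by
  set S := T - ν • (1 : Module.End ℂ V) with hS
  have hT : T = S + ν • (1 : Module.End ℂ V) := by rw [hS]; abel
  have hc : Commute S (ν • (1 : Module.End ℂ V)) := (Commute.one_right S).smul_right ν
  have hz : ∀ j, N ≤ j → (S ^ j) v = 0 := by
    intro j hj
    obtain ⟨i, rfl⟩ := Nat.exists_eq_add_of_le hj
    rw [add_comm, pow_add, Module.End.mul_apply, hN, map_zero]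
  have h1 : (T ^ k) v = ∑ j ∈ Finset.range (k + 1), ((k.choose j : ℂ) * (ν ^ k * (ν⁻¹) ^ j)) •
      (S ^ j) v := by
    rw [hT, hc.add_pow, LinearMap.sum_apply]
    refine Finset.sum_congr rfl fun j hj => ?_
    have hjk : j ≤ k := Nat.lt_succ_iff.1 (Finset.mem_range.1 hj)
    rw [_root_.smul_pow, one_pow, mul_smul_comm, mul_one, ← nsmul_eq_mul', LinearMap.smul_apply,
      LinearMap.smul_apply, ← Nat.cast_smul_eq_nsmul ℂ, smul_smul]
    congr 2
    rw [inv_pow, ← div_eq_mul_inv, eq_div_iff (pow_ne_zero _ hν), ← pow_add,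
      Nat.sub_add_cancel hjk]
  rw [h1]
  rcases le_total (k + 1) N with h | h
  · refine Finset.sum_subset (Finset.range_mono h) fun j _ hj => ?_
    have : k < j := by simpa using hj
    rw [Nat.choose_eq_zero_of_lt this, Nat.cast_zero, zero_mul, zero_smul]
  · refine (Finset.sum_subset (Finset.range_mono h) fun j _ hj => ?_).symm
    rw [hz j (by simpa using hj), smul_zero]

/-- Every vector is a sum of generalised eigenvectors, and on each of these the binomial expansion
has a single frequency ν. The binomial coefficient C(k, j) is the value at k of a falling factorial
polynomial divided by j!. -/
theorem exists_expPoly_orbit (T : Module.End ℂ (Fin n → ℂ))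
    (hT : ∀ (ν : ℂ) w, T w = ν • w → w ≠ 0 → ν ≠ 0 ∧ ‖ν‖ < 1) (v : Fin n → ℂ) :
    ∃ (α : Fin n → ExpPoly) (q : ℝ), 0 < q ∧ q < 1 ∧
      (∀ k l, ExpPoly.evalNat k (α l) = (T ^ k) v l) ∧ ∀ l, ExpPoly.FlowDecays q (α l) := by
  have hv : v ∈ ⨆ μ, T.maxGenEigenspace μ := by
    rw [Module.End.iSup_maxGenEigenspace_eq_top]; trivial
  induction hv using Submodule.iSup_induction' with
  | zero =>
    refine ⟨0, 1 / 2, by norm_num, by norm_num, by simp, fun l => ⟨0, le_rfl, fun s _ => ?_⟩⟩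
    simp
  | add x y _ _ hx hy =>
    obtain ⟨α, q, hq0, hq1, h, hd⟩ := hx
    obtain ⟨α', q', hq0', hq1', h', hd'⟩ := hy
    refine ⟨α + α', max q q', lt_max_of_lt_left hq0, max_lt hq1 hq1', fun k l => ?_, fun l => ?_⟩
    · simp [h, h']
    · exact ((hd l).mono hq0.le (le_max_left _ _)).add ((hd' l).mono hq0'.le (le_max_right _ _))
  | mem ν v hv =>
    rcases eq_or_ne v 0 with rfl | hv0
    · refine ⟨0, 1 / 2, by norm_num, by norm_num, by simp, fun l => ⟨0, le_rfl, fun s _ => ?_⟩⟩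
      simp
    have hex := (Module.End.mem_maxGenEigenspace T ν v).1 hv
    classical
    obtain ⟨hν0, hν1⟩ : ν ≠ 0 ∧ ‖ν‖ < 1 := by
      -- The last non-zero vector of the chain (T - ν)^N v is a genuine eigenvector, to which the
      -- hypothesis on eigenvalues applies.
      have hfind := Nat.find_spec hex
      have hpos : Nat.find hex ≠ 0 := by
        intro h0
        rw [h0, pow_zero] at hfind
        exact hv0 hfind
      obtain ⟨N, hN⟩ := Nat.exists_eq_succ_of_ne_zero hpos
      refine hT ν (((T - ν • (1 : Module.End ℂ (Fin n → ℂ))) ^ N) v) ?_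
        (Nat.find_min hex (by omega))
      rw [hN, pow_succ', Module.End.mul_apply, LinearMap.sub_apply, LinearMap.smul_apply,
        Module.End.one_apply] at hfind
      exact sub_eq_zero.1 hfind
    obtain ⟨N, hN⟩ := hex
    let u : ℕ → Fin n → ℂ := fun j => ((T - ν • (1 : Module.End ℂ (Fin n → ℂ))) ^ j) v
    refine ⟨fun l => MonoidAlgebra.single (Units.mk0 ν hν0) (∑ j ∈ Finset.range N,
      C (u j l * (ν⁻¹) ^ j / (j.factorial : ℂ)) * descPochhammer ℂ j), ‖ν‖,
      norm_pos_iff.2 hν0, hν1, fun k l => ?_, fun l => ?_⟩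
    · rw [ExpPoly.evalNat_single, pow_apply_eq_sum_choose T ν hν0 v N hN k, Finset.sum_apply,
        eval_finsetSum, Finset.sum_mul]
      refine Finset.sum_congr rfl fun j _ => ?_
      simp only [eval_mul, eval_C, descPochhammer_eval_eq_descFactorial, Units.val_mk0,
        Pi.smul_apply, smul_eq_mul, Nat.descFactorial_eq_factorial_mul_choose, Nat.cast_mul]
      have : (j.factorial : ℂ) ≠ 0 := by exact_mod_cast j.factorial_ne_zero
      field_simp
      simp only [u]
      ring
    · refine ExpPoly.norm_evalFlow_le _ fun μ hμ => ?_
      rw [MonoidAlgebra.coeff_single] at hμ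
      rw [Finset.mem_singleton.1 (Finsupp.support_single_subset hμ), Units.val_mk0]

end Orbits

/-! ### The complexified Fourier transform of a compactly supported function -/

section ComplexFourier

variable {n : ℕ}

/-- The phase `-2πi ∑ x_l z_l`. -/
def phase (x : Rn n) (z : Fin n → ℂ) : ℂ := -2 * Real.pi * Complex.I * ∑ l, (x l : ℂ) * z l

/-- The Fourier–Laplace transform `∫ e^{-2πi x·z} ψ(x) dx`. -/
def complexFourier (ψ : 𝓢(Rn n, ℂ)) (z : Fin n → ℂ) : ℂ := ∫ x, Complex.exp (phase x z) * ψ x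

theorem complexFourier_ofReal (ψ : 𝓢(Rn n, ℂ)) (ξ : Rn n) :
    complexFourier ψ (fun l => (ξ l : ℂ)) = 𝓕 (ψ : Rn n → ℂ) ξ := by
  rw [Real.fourier_eq', complexFourier]
  refine integral_congr_ae (ae_of_all _ fun x => ?_)
  simp only [smul_eq_mul, phase]
  congr 2
  have : (inner ℝ x ξ : ℝ) = ∑ l, x l * ξ l := by
    simp [PiLp.inner_apply, mul_comm]
  rw [this]
  push_cast
  ring

theorem norm_phase_le (x : Rn n) (z : Fin n → ℂ) :
    ‖phase x z‖ ≤ 2 * Real.pi * n * ‖x‖ * ‖z‖ := by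
  have h1 : ‖∑ l, (x l : ℂ) * z l‖ ≤ n * (‖x‖ * ‖z‖) := by
    suffices h2 : ∀ l ∈ Finset.univ, ‖(x l : ℂ) * z l‖ ≤ ‖x‖ * ‖z‖ by
      simpa using norm_sum_le_of_le _ h2
    intro l _
    rw [norm_mul, Complex.norm_real]
    gcongr
    · exact PiLp.norm_apply_le x l
    · exact norm_le_pi_norm z l
  rw [phase, norm_mul]
  have h2 : ‖(-2 * Real.pi * Complex.I : ℂ)‖ = 2 * Real.pi := by
    simp [abs_of_pos Real.pi_pos]
  rw [h2]
  calc 2 * Real.pi * ‖∑ l, (x l : ℂ) * z l‖ ≤ 2 * Real.pi * (n * (‖x‖ * ‖z‖)) := by gcongr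
    _ = _ := by ring

theorem continuous_phase {Y : Type*} [TopologicalSpace Y] {f : Y → Rn n} {g : Y → Fin n → ℂ}
    (hf : Continuous f) (hg : Continuous g) : Continuous fun y => phase (f y) (g y) := by
  unfold phase
  fun_prop

variable {ψ : 𝓢(Rn n, ℂ)}

theorem exists_support_radius (hψ : HasCompactSupport ψ) :
    ∃ R : ℝ, 0 < R ∧ ∀ x, ψ x ≠ 0 → ‖x‖ ≤ R := by
  obtain ⟨R, hR, h⟩ := hψ.isCompact.isBounded.exists_pos_norm_le
  exact ⟨R, hR, fun x hx => h x (subset_tsupport _ hx)⟩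

theorem integrable_mul_of_hasCompactSupport (hψ : HasCompactSupport ψ) {f : Rn n → ℂ}
    (hf : Continuous f) : Integrable fun x => f x * ψ x :=
  (hf.mul ψ.continuous).integrable_of_hasCompactSupport hψ.mul_left

/-- The Taylor coefficients of the Fourier–Laplace transform. -/
def taylorCoeff (ψ : 𝓢(Rn n, ℂ)) (m : ℕ) (f : Fin m → Fin n) : ℂ :=
  (-2 * Real.pi * Complex.I) ^ m / m.factorial * ∫ x, (∏ i, (x (f i) : ℂ)) * ψ x

/-- The exponential is expanded under the integral; on the bounded support of ψ the phase is O(‖z‖),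
which controls the remainder uniformly. -/
theorem exists_taylor_bound (hψ : HasCompactSupport ψ) (D : ℕ) (R : ℝ) : ∃ K : ℝ, 0 ≤ K ∧
    ∀ z : Fin n → ℂ, ‖z‖ ≤ R → ‖complexFourier ψ z - ∑ m ∈ Finset.range D,
      ∑ f : Fin m → Fin n, taylorCoeff ψ m f * ∏ i, z (f i)‖ ≤ K * ‖z‖ ^ D := by
  obtain ⟨ρ, hρ, hsupp⟩ := exists_support_radius hψ
  set c := 2 * Real.pi * n * ρ with hc
  have hc0 : 0 ≤ c := by positivity
  have hψi : Integrable fun x => ‖ψ x‖ := ψ.integrable.norm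
  refine ⟨c ^ D * Real.exp (c * R) * ∫ x, ‖ψ x‖, by positivity, fun z hz => ?_⟩
  have hpoly : ∑ m ∈ Finset.range D, ∑ f : Fin m → Fin n, taylorCoeff ψ m f * ∏ i, z (f i) =
      ∫ x, (∑ m ∈ Finset.range D, phase x z ^ m / m.factorial) * ψ x := by
    have h1 : ∀ x, (∑ m ∈ Finset.range D, phase x z ^ m / m.factorial) * ψ x =
        ∑ m ∈ Finset.range D, ∑ f : Fin m → Fin n,
          ((-2 * Real.pi * Complex.I) ^ m / m.factorial * ∏ i, z (f i)) *
            ((∏ i, (x (f i) : ℂ)) * ψ x) := by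
      intro x
      rw [Finset.sum_mul]
      refine Finset.sum_congr rfl fun m _ => ?_
      rw [phase, mul_pow, Fintype.sum_pow, Finset.mul_sum, Finset.sum_div, Finset.sum_mul]
      refine Finset.sum_congr rfl fun f _ => ?_
      rw [Finset.prod_mul_distrib]
      ring
    have hint : ∀ (m : ℕ) (f : Fin m → Fin n),
        Integrable fun x : Rn n => (∏ i, (x (f i) : ℂ)) * ψ x := fun m f =>
      integrable_mul_of_hasCompactSupport hψ (by fun_prop)
    simp only [h1]
    rw [integral_finsetSum _ fun m _ => integrable_finsetSum _ fun f _ => (hint m f).const_mul _]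
    refine Finset.sum_congr rfl fun m _ => ?_
    rw [integral_finsetSum _ fun f _ => (hint m f).const_mul _]
    refine Finset.sum_congr rfl fun f _ => ?_
    rw [integral_const_mul, taylorCoeff]
    ring
  have hph : Continuous fun x : Rn n => phase x z :=
    continuous_phase continuous_id continuous_const
  rw [hpoly, complexFourier, ← integral_sub
    (integrable_mul_of_hasCompactSupport hψ (by fun_prop))
    (integrable_mul_of_hasCompactSupport hψ (by fun_prop)),
    mul_right_comm, ← integral_const_mul]
  refine norm_integral_le_of_norm_le (hψi.const_mul _) (ae_of_all _ fun x => ?_)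
  rw [← sub_mul, norm_mul]
  rcases eq_or_ne (ψ x) 0 with h0 | h0
  · simp [h0]
  gcongr
  have hp : ‖phase x z‖ ≤ c * ‖z‖ := by
    refine (norm_phase_le x z).trans ?_
    rw [hc]
    gcongr
    exact hsupp x h0
  calc _ ≤ ‖phase x z‖ ^ D * Real.exp ‖phase x z‖ := Complex.norm_exp_sub_sum_le_norm_mul_exp _ _
    _ ≤ (c * ‖z‖) ^ D * Real.exp (c * R) := by gcongr; exact hp.trans (by gcongr)
    _ = _ := by ring

theorem exists_complexFourier_bound (hψ : HasCompactSupport ψ) (R : ℝ) : ∃ K : ℝ, 0 ≤ K ∧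
    ∀ z : Fin n → ℂ, ‖z‖ ≤ R → ‖complexFourier ψ z‖ ≤ K := by
  obtain ⟨K, hK, h⟩ := exists_taylor_bound hψ 0 R
  exact ⟨K, hK, fun z hz => by simpa using h z hz⟩

/-- Differentiation under the integral: for s near s₀ and x in the compact support, the
differentiated integrand is bounded by a constant multiple of |ψ|. -/
theorem differentiable_complexFourier_comp (hψ : HasCompactSupport ψ) {z : ℂ → Fin n → ℂ}
    (hz : ∀ l, Differentiable ℂ fun s => z s l) : Differentiable ℂ fun s => complexFourier ψ (z s) := by
  intro s₀
  have hzc : Continuous z := continuous_pi fun l => (hz l).continuous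
  obtain ⟨z', hz'c, hph⟩ : ∃ z' : ℂ → Fin n → ℂ, Continuous z' ∧ ∀ (x : Rn n) (s : ℂ),
      HasDerivAt (fun s => phase x (z s)) (phase x (z' s)) s :=
    ⟨fun s l => deriv (fun s => z s l) s,
      continuous_pi fun l => ((hz l).contDiff (n := 1)).continuous_deriv le_rfl,
      fun x s => (HasDerivAt.fun_sum fun l _ => ((hz l s).hasDerivAt.const_mul _)).const_mul _⟩
  obtain ⟨ρ, hρ, hsupp⟩ := exists_support_radius hψ
  have hcont : Continuous fun p : ℂ × Rn n =>
      Complex.exp (phase p.2 (z p.1)) * phase p.2 (z' p.1) :=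
    (Complex.continuous_exp.comp (continuous_phase continuous_snd (hzc.comp continuous_fst))).mul
      (continuous_phase continuous_snd (hz'c.comp continuous_fst))
  have hcomp : IsCompact (Metric.closedBall s₀ 1 ×ˢ Metric.closedBall (0 : Rn n) ρ) :=
    (isCompact_closedBall s₀ 1).prod (isCompact_closedBall (0 : Rn n) ρ)
  obtain ⟨K, hK⟩ : ∃ K, ∀ p ∈ Metric.closedBall s₀ 1 ×ˢ Metric.closedBall (0 : Rn n) ρ,
      ‖Complex.exp (phase p.2 (z p.1)) * phase p.2 (z' p.1)‖ ≤ K :=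
    hcomp.exists_bound_of_continuousOn hcont.continuousOn
  have hx : ∀ s, Continuous fun x : Rn n => Complex.exp (phase x (z s)) := fun s =>
    Complex.continuous_exp.comp (continuous_phase continuous_id continuous_const)
  have := hasDerivAt_integral_of_dominated_loc_of_deriv_le (μ := (volume : Measure (Rn n)))
    (F := fun s x => Complex.exp (phase x (z s)) * ψ x)
    (F' := fun s x => Complex.exp (phase x (z s)) * phase x (z' s) * ψ x)
    (bound := fun x => K * ‖ψ x‖) (x₀ := s₀) (Metric.ball_mem_nhds s₀ one_pos)
    (Eventually.of_forall fun s => ((hx s).mul ψ.continuous).aestronglyMeasurable)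
    (integrable_mul_of_hasCompactSupport hψ (hx s₀))
    (((hcont.comp (continuous_const.prodMk continuous_id)).mul
      ψ.continuous).aestronglyMeasurable)
    (ae_of_all _ fun x s hs => ?_) (ψ.integrable.norm.const_mul K)
    (ae_of_all _ fun x s _ => ((hph x s).cexp).mul_const _)
  · exact this.2.differentiableAt
  · rw [norm_mul]
    rcases eq_or_ne (ψ x) 0 with h0 | h0
    · simp [h0]
    gcongr
    exact hK (s, x) ⟨Metric.ball_subset_closedBall hs, by simpa using hsupp x h0⟩

end ComplexFourier

end AnisoLP

namespace AnisoLP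

/-! ### Zeros of a Fourier transform along an orbit -/

section Flow

variable {n : ℕ}

/-- Coordinatewise real part of a complex vector. -/
def reVec (w : Fin n → ℂ) : Rn n := WithLp.toLp 2 fun l => (w l).re

/-- Coordinatewise imaginary part of a complex vector. -/
def imVec (w : Fin n → ℂ) : Rn n := WithLp.toLp 2 fun l => (w l).im

/-- A real vector as a complex vector. -/
def toComplex (x : Rn n) : Fin n → ℂ := fun l => (x l : ℂ)

/-- The complexification of a real linear map. -/
def complexify (T : Rn n →L[ℝ] Rn n) : Module.End ℂ (Fin n → ℂ) where
  toFun w := toComplex (T (reVec w)) + Complex.I • toComplex (T (imVec w))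
  map_add' w v := by
    have h1 : reVec (w + v) = reVec w + reVec v := by ext l; simp [reVec]
    have h2 : imVec (w + v) = imVec w + imVec v := by ext l; simp [imVec]
    ext l
    simp only [h1, h2, map_add, toComplex, Pi.add_apply, Pi.smul_apply, PiLp.add_apply, smul_eq_mul]
    push_cast
    ring
  map_smul' c w := by
    have h1 : reVec (c • w) = c.re • reVec w - c.im • imVec w := by
      ext l; simp [reVec, imVec]
    have h2 : imVec (c • w) = c.re • imVec w + c.im • reVec w := by
      ext l; simp [reVec, imVec]
    ext l
    simp only [h1, h2, map_add, map_sub, map_smul, toComplex, Pi.add_apply, Pi.smul_apply,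
      PiLp.add_apply, PiLp.sub_apply, PiLp.smul_apply, smul_eq_mul, RingHom.id_apply]
    conv_rhs => rw [← Complex.re_add_im c]
    push_cast
    linear_combination (-(c.im : ℂ) * ((T (imVec w) l : ℝ) : ℂ)) * Complex.I_mul_I

theorem complexify_apply (T : Rn n →L[ℝ] Rn n) (w : Fin n → ℂ) :
    complexify T w = toComplex (T (reVec w)) + Complex.I • toComplex (T (imVec w)) := rfl

theorem reVec_complexify (T : Rn n →L[ℝ] Rn n) (w : Fin n → ℂ) :
    reVec (complexify T w) = T (reVec w) := by
  ext l; simp [complexify_apply, reVec, toComplex]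

theorem imVec_complexify (T : Rn n →L[ℝ] Rn n) (w : Fin n → ℂ) :
    imVec (complexify T w) = T (imVec w) := by
  ext l; simp [complexify_apply, imVec, toComplex]

theorem reVec_complexify_pow (T : Rn n →L[ℝ] Rn n) (w : Fin n → ℂ) (k : ℕ) :
    reVec ((complexify T ^ k) w) = (T ^ k) (reVec w) := by
  induction k with
  | zero => rfl
  | succ k ih =>
    rw [pow_succ', Module.End.mul_apply, reVec_complexify, ih, pow_succ']
    rfl

theorem imVec_complexify_pow (T : Rn n →L[ℝ] Rn n) (w : Fin n → ℂ) (k : ℕ) :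
    imVec ((complexify T ^ k) w) = (T ^ k) (imVec w) := by
  induction k with
  | zero => rfl
  | succ k ih =>
    rw [pow_succ', Module.End.mul_apply, imVec_complexify, ih, pow_succ']
    rfl

theorem norm_apply_le_reVec_add (w : Fin n → ℂ) (l : Fin n) :
    ‖w l‖ ≤ ‖reVec w‖ + ‖imVec w‖ := by
  refine (Complex.norm_le_abs_re_add_abs_im _).trans (add_le_add ?_ ?_)
  · exact PiLp.norm_apply_le (reVec w) l
  · exact PiLp.norm_apply_le (imVec w) l

theorem complexify_pow_toComplex (T : Rn n →L[ℝ] Rn n) (x : Rn n) (k : ℕ) :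
    (complexify T ^ k) (toComplex x) = toComplex ((T ^ k) x) := by
  have h1 := reVec_complexify_pow T (toComplex x) k
  have h2 := imVec_complexify_pow T (toComplex x) k
  have h3 : imVec (toComplex x) = 0 := by ext l; simp [imVec, toComplex]
  have h4 : reVec (toComplex x) = x := by ext l; simp [reVec, toComplex]
  rw [h3, map_zero] at h2
  rw [h4] at h1
  ext l
  apply Complex.ext
  · have := congrArg (fun v : Rn n => v l) h1
    simpa [reVec, toComplex] using this
  · have := congrArg (fun v : Rn n => v l) h2
    simpa [imVec, toComplex] using this

/-- An eigenvector for ν has orbit ν^k w, and decay of the powers of T excludes |ν| ≥ 1. Injectivity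
on real and imaginary parts excludes ν = 0. -/
theorem complexify_eigenvalue {T : Rn n →L[ℝ] Rn n} (hinj : Function.Injective T) {K q : ℝ}
    (hq0 : 0 < q) (hq : q < 1) (hT : ∀ (k : ℕ) x, ‖(T ^ k) x‖ ≤ K * q ^ k * ‖x‖)
    (ν : ℂ) (w : Fin n → ℂ) (hw : complexify T w = ν • w) (hw0 : w ≠ 0) : ν ≠ 0 ∧ ‖ν‖ < 1 := by
  have hre0 : reVec w = 0 → imVec w = 0 → False := by
    intro h1 h2
    apply hw0
    ext l
    have := norm_apply_le_reVec_add w l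
    rw [h1, h2, norm_zero, add_zero] at this
    exact norm_le_zero_iff.1 this
  constructor
  · rintro rfl
    rw [zero_smul] at hw
    have h1 := reVec_complexify T w
    have h2 := imVec_complexify T w
    have h3 : reVec (0 : Fin n → ℂ) = 0 := by ext l; simp [reVec]
    have h4 : imVec (0 : Fin n → ℂ) = 0 := by ext l; simp [imVec]
    rw [hw, h3] at h1
    rw [hw, h4] at h2
    exact hre0 (hinj (by rw [← h1, map_zero])) (hinj (by rw [← h2, map_zero]))
  · obtain ⟨l, hl⟩ : ∃ l, w l ≠ 0 := Function.ne_iff.1 hw0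
    have hpow : ∀ k : ℕ, (complexify T ^ k) w = ν ^ k • w := by
      intro k
      induction k with
      | zero => simp
      | succ k ih => rw [pow_succ', Module.End.mul_apply, ih, map_smul, hw, smul_smul, pow_succ]
    have hb : ∀ k : ℕ, ‖ν‖ ^ k * ‖w l‖ ≤ K * (‖reVec w‖ + ‖imVec w‖) * q ^ k := by
      intro k
      have h1 := norm_apply_le_reVec_add ((complexify T ^ k) w) l
      rw [reVec_complexify_pow, imVec_complexify_pow, hpow, Pi.smul_apply, norm_smul, norm_pow] at h1
      have h2 := hT k (reVec w)
      have h3 := hT k (imVec w)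
      calc _ ≤ _ := h1
        _ ≤ K * q ^ k * ‖reVec w‖ + K * q ^ k * ‖imVec w‖ := add_le_add h2 h3
        _ = _ := by ring
    by_contra hge
    push Not at hge
    have hlim : Tendsto (fun k : ℕ => K * (‖reVec w‖ + ‖imVec w‖) * q ^ k) atTop (𝓝 0) := by
      simpa using (tendsto_pow_atTop_nhds_zero_of_lt_one hq0.le hq).const_mul
        (K * (‖reVec w‖ + ‖imVec w‖))
    have hle : ‖w l‖ ≤ 0 := ge_of_tendsto' hlim fun k => by
      refine le_trans ?_ (hb k)
      exact le_mul_of_one_le_left (norm_nonneg _) (one_le_pow₀ hge)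
    exact hl (norm_le_zero_iff.1 hle)

/-- Averaging an exponential polynomial with its conjugate does not change its values on a real
orbit, but makes the flow real at real times. -/
theorem exists_real_expPoly_orbit {T : Rn n →L[ℝ] Rn n} (hinj : Function.Injective T) {K q : ℝ}
    (hq0 : 0 < q) (hq : q < 1) (hT : ∀ (k : ℕ) x, ‖(T ^ k) x‖ ≤ K * q ^ k * ‖x‖) (ξ : Rn n) :
    ∃ (α : Fin n → ExpPoly) (q' : ℝ), 0 < q' ∧ q' < 1 ∧
      (∀ k l, ExpPoly.evalNat k (α l) = ((T ^ k) ξ l : ℝ)) ∧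
      (∀ l, ExpPoly.FlowDecays q' (α l)) ∧
      ∀ (t : ℝ) l, (((ExpPoly.evalFlow t (α l)).re : ℝ) : ℂ) = ExpPoly.evalFlow t (α l) := by
  obtain ⟨α, q', h0, h1, hev, hd⟩ := exists_expPoly_orbit (complexify T)
    (complexify_eigenvalue hinj hq0 hq hT) (toComplex ξ)
  have hhalf : ∀ s : ℂ, ExpPoly.evalFlow s (MonoidAlgebra.single 1 (Polynomial.C (1 / 2))) = 1 / 2 := by
    intro s; simp [ExpPoly.evalFlow_single]
  refine ⟨fun l => MonoidAlgebra.single 1 (Polynomial.C (1 / 2)) * (α l + ExpPoly.conj (α l)), q',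
    h0, h1, fun k l => ?_, fun l => ?_, fun t l => ?_⟩
  · rw [map_mul, map_add, ExpPoly.evalNat_conj, hev, complexify_pow_toComplex,
      ExpPoly.evalNat_single]
    simp only [toComplex, Complex.conj_ofReal]
    simp
    ring
  · obtain ⟨C, hC, hb⟩ := hd l
    refine ⟨C, hC, fun s hs => ?_⟩
    rw [map_mul, hhalf, map_add, ExpPoly.evalFlow_conj, norm_mul]
    have h2 := hb s hs
    have h3 := hb (starRingEnd ℂ s) (by simpa using hs)
    rw [Complex.conj_re] at h3
    have h4 := norm_add_le (ExpPoly.evalFlow s (α l))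
      (starRingEnd ℂ (ExpPoly.evalFlow (starRingEnd ℂ s) (α l)))
    rw [RCLike.norm_conj] at h4
    have h5 : ‖(1 / 2 : ℂ)‖ = 1 / 2 := by norm_num
    rw [h5]
    linarith
  · rw [← Complex.conj_eq_iff_re, map_mul, hhalf, map_add, ExpPoly.evalFlow_conj,
      Complex.conj_ofReal, map_mul, map_add, Complex.conj_conj, add_comm (starRingEnd ℂ _),
      show starRingEnd ℂ (1 / 2) = 1 / 2 by
        rw [Complex.conj_eq_iff_real]; exact ⟨1 / 2, by norm_num⟩]

/-- If `𝓕 ψ` vanishes along the forward orbit of `ξ` under a contraction, it vanishes along a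
continuous curve from `ξ` to `0`. -/
theorem exists_curve_of_fourier_orbit_eq_zero {T : Rn n →L[ℝ] Rn n} (hinj : Function.Injective T)
    {K q : ℝ} (hK : 0 ≤ K) (hq0 : 0 < q) (hq : q < 1)
    (hT : ∀ (k : ℕ) x, ‖(T ^ k) x‖ ≤ K * q ^ k * ‖x‖)
    {ψ : 𝓢(Rn n, ℂ)} (hψ : HasCompactSupport ψ) {ξ : Rn n}
    (h0 : ∀ k : ℕ, 𝓕 (ψ : Rn n → ℂ) ((T ^ k) ξ) = 0) :
    ∃ γ : ℝ → Rn n, Continuous γ ∧ γ 0 = ξ ∧ Tendsto γ atTop (𝓝 0) ∧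
      ∀ t, 0 ≤ t → 𝓕 (ψ : Rn n → ℂ) (γ t) = 0 := by
  obtain ⟨α, q', hq0', hq', hev, hdec, hreal⟩ := exists_real_expPoly_orbit hinj hq0 hq hT ξ
  choose M hM hMb using hdec
  let z : ℂ → Fin n → ℂ := fun s l => ExpPoly.evalFlow s (α l)
  have hzb : ∀ s : ℂ, 0 ≤ s.re → ‖z s‖ ≤ (∑ l, M l) * q' ^ s.re := by
    intro s hs
    refine (pi_norm_le_iff_of_nonneg (mul_nonneg (Finset.sum_nonneg fun l _ => hM l)
      (Real.rpow_nonneg hq0'.le _))).2 fun l => (hMb l s hs).trans ?_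
    gcongr
    exact Finset.single_le_sum (f := M) (fun l _ => hM l) (Finset.mem_univ l)
  set M' := ∑ l, M l with hM'
  have hM0 : 0 ≤ M' := Finset.sum_nonneg fun l _ => hM l
  have hzb' : ∀ s : ℂ, 0 ≤ s.re → ‖z s‖ ≤ M' := fun s hs =>
    (hzb s hs).trans (mul_le_of_le_one_right hM0 (Real.rpow_le_one hq0'.le hq'.le hs))
  have hGd : Differentiable ℂ fun s => complexFourier ψ (z s) :=
    differentiable_complexFourier_comp hψ fun l => ExpPoly.differentiable_evalFlow (α l)
  -- superexponential decay along the positive real axis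
  have hsup : ∀ D : ℕ, ∃ C : ℝ, ∀ t : ℝ, 0 ≤ t →
      ‖complexFourier ψ (z t)‖ ≤ C * (max q q' ^ D) ^ t := by
    intro D
    set R := max M' (K * ‖ξ‖) with hR
    obtain ⟨C, hC, hTay⟩ := exists_taylor_bound hψ D R
    let ι : ℂ → ExpPoly := fun c => MonoidAlgebra.single 1 (Polynomial.C c)
    -- The Taylor polynomial of ψ̂ of order below D, formally composed with the orbit. Both
    -- `evalNat` and `evalFlow` are ring homomorphisms, so the same β gives the Taylor polynomial
    -- along the orbit and along the flow.
    let β : ExpPoly := ∑ m ∈ Finset.range D, ∑ f : Fin m → Fin n,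
      ι (taylorCoeff ψ m f) * ∏ i, α (f i)
    have hβN : ∀ k, ExpPoly.evalNat k β = ∑ m ∈ Finset.range D, ∑ f : Fin m → Fin n,
        taylorCoeff ψ m f * ∏ i, (((T ^ k) ξ (f i) : ℝ) : ℂ) := by
      intro k
      simp only [β, ι, map_sum, map_mul, map_prod, hev, ExpPoly.evalNat_single]
      simp
    have hβF : ∀ s, ExpPoly.evalFlow s β = ∑ m ∈ Finset.range D, ∑ f : Fin m → Fin n,
        taylorCoeff ψ m f * ∏ i, z s (f i) := by
      intro s
      simp only [β, ι, map_sum, map_mul, map_prod, ExpPoly.evalFlow_single]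
      simp [z]
    have hnorm : ∀ x : Rn n, ‖toComplex x‖ ≤ ‖x‖ := fun x =>
      (pi_norm_le_iff_of_nonneg (norm_nonneg _)).2 fun l => by
        rw [toComplex, Complex.norm_real]; exact PiLp.norm_apply_le x l
    have hsmall : ∀ k : ℕ, ‖ExpPoly.evalNat k β‖ ≤ (C * (K * ‖ξ‖) ^ D) * (q ^ D) ^ k := by
      intro k
      have h1 : ‖toComplex ((T ^ k) ξ)‖ ≤ K * q ^ k * ‖ξ‖ := (hnorm _).trans (hT k ξ)
      have h2 : ‖toComplex ((T ^ k) ξ)‖ ≤ R := by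
        refine h1.trans (le_trans ?_ (le_max_right _ _))
        have : q ^ k ≤ 1 := pow_le_one₀ hq0.le hq.le
        have : K * q ^ k ≤ K := mul_le_of_le_one_right hK this
        gcongr
      have h3 := hTay _ h2
      have h4 : complexFourier ψ (toComplex ((T ^ k) ξ)) = 0 :=
        (complexFourier_ofReal ψ _).trans (h0 k)
      rw [h4, zero_sub, norm_neg] at h3
      rw [hβN]
      refine h3.trans ?_
      calc C * ‖toComplex ((T ^ k) ξ)‖ ^ D ≤ C * (K * q ^ k * ‖ξ‖) ^ D := by gcongr
        _ = _ := by ring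
    -- On the orbit ψ̂ vanishes, so β equals minus the Taylor remainder and is O(q^{Dk}). Only
    -- frequencies with |ν| ≤ q^D survive, which forces the same decay along the flow.
    have hsupp := ExpPoly.norm_le_of_isBigO (pow_pos hq0 D) β hsmall
    obtain ⟨C', hC', hflow⟩ := ExpPoly.norm_evalFlow_le β hsupp
    refine ⟨C * M' ^ D + C', fun t ht => ?_⟩
    have ht' : 0 ≤ (t : ℂ).re := by simpa using ht
    have h1 := hTay (z t) ((hzb' t ht').trans (le_max_left _ _))
    rw [← hβF] at h1
    have h2 := hflow t ht'
    have h3 := hzb t ht'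
    rw [Complex.ofReal_re] at h2 h3
    have h4 : ‖complexFourier ψ (z t)‖ ≤ ‖complexFourier ψ (z t) - ExpPoly.evalFlow t β‖ +
        ‖ExpPoly.evalFlow t β‖ := by
      simpa using norm_add_le (complexFourier ψ (z t) - ExpPoly.evalFlow t β)
        (ExpPoly.evalFlow t β)
    have h5 : (q' ^ t) ^ D ≤ (max q q' ^ D) ^ t := by
      rw [← Real.rpow_natCast, ← Real.rpow_natCast, ← Real.rpow_mul hq0'.le, mul_comm,
        Real.rpow_mul hq0'.le]
      gcongr
      exact le_max_right _ _
    have h6 : (q ^ D) ^ t ≤ (max q q' ^ D) ^ t := by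
      gcongr
      exact le_max_left _ _
    calc ‖complexFourier ψ (z t)‖ ≤ C * (M' * q' ^ t) ^ D + C' * (q ^ D) ^ t := by
          refine h4.trans (add_le_add (h1.trans ?_) h2)
          gcongr
      _ = C * M' ^ D * (q' ^ t) ^ D + C' * (q ^ D) ^ t := by ring
      _ ≤ C * M' ^ D * (max q q' ^ D) ^ t + C' * (max q q' ^ D) ^ t := by gcongr
      _ = _ := by ring
  obtain ⟨B, hB, hBb⟩ := exists_complexFourier_bound hψ M'
  have hq1 : max q q' < 1 := max_lt hq hq'
  have hqpos : 0 < max q q' := lt_max_of_lt_left hq0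
  have hzero : Set.EqOn (fun s => complexFourier ψ (z s)) 0 {s | 0 ≤ s.re} := by
    refine PhragmenLindelof.eq_zero_on_right_half_plane_of_superexponential_decay
      hGd.diffContOnCl ⟨0, by norm_num, 0, ?_⟩ ?_ ⟨B, fun x => hBb _ (hzb' _ (by simp))⟩
    · refine Asymptotics.IsBigO.of_bound B ?_
      filter_upwards [mem_inf_of_right (mem_principal_self _)] with s hs
      have : ‖complexFourier ψ (z s)‖ ≤ B := hBb _ (hzb' _ (le_of_lt hs))
      simpa using this
    · intro N
      -- The Taylor order D is chosen so large that the decay absorbs e^{Nt} and still leaves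
      -- e^{-t}.
      obtain ⟨D, hD⟩ : ∃ D : ℕ, max q q' ^ D < Real.exp (-((N : ℝ) + 1)) :=
        exists_pow_lt_of_lt_one (Real.exp_pos _) hq1
      obtain ⟨C, hC⟩ := hsup D
      have hlim : Tendsto (fun t : ℝ => |C| * Real.exp (-t)) atTop (𝓝 0) := by
        simpa using (Real.tendsto_exp_neg_atTop_nhds_zero).const_mul |C|
      refine squeeze_zero' (Eventually.of_forall fun t => by positivity) ?_ hlim
      filter_upwards [eventually_ge_atTop 0] with t ht
      have h1 := hC t ht
      have h2 : (max q q' ^ D) ^ t ≤ Real.exp (-((N : ℝ) + 1) * t) := by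
        rw [Real.exp_mul]
        exact Real.rpow_le_rpow (by positivity) hD.le ht
      have h3 : 0 ≤ (max q q' ^ D) ^ t := by positivity
      calc Real.exp t ^ N * ‖complexFourier ψ (z t)‖
          ≤ Real.exp t ^ N * (|C| * Real.exp (-((N : ℝ) + 1) * t)) := by
            gcongr
            exact h1.trans ((mul_le_mul_of_nonneg_right (le_abs_self C) h3).trans (by gcongr))
        _ = |C| * (Real.exp (N * t) * Real.exp (-((N : ℝ) + 1) * t)) := by
            rw [Real.exp_nat_mul]; ring
        _ = |C| * Real.exp (-t) := by
            rw [← Real.exp_add]; ring_nf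
  have hγ : ∀ t : ℝ, toComplex (reVec (z t)) = z t := fun t => funext fun l => hreal t l
  refine ⟨fun t => reVec (z t), ?_, ?_, ?_, fun t ht => ?_⟩
  · refine (PiLp.continuous_toLp 2 _).comp (continuous_pi fun l => ?_)
    exact Complex.continuous_re.comp
      ((ExpPoly.differentiable_evalFlow (α l)).continuous.comp Complex.continuous_ofReal)
  · ext l
    have h1 := hev 0 l
    rw [← ExpPoly.evalFlow_zero] at h1
    simp [reVec, z, h1]
  · have hz0 : Tendsto (fun t : ℝ => z t) atTop (𝓝 0) := by
      refine squeeze_zero_norm' (a := fun t => M' * q' ^ t) ?_ ?_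
      · filter_upwards [eventually_ge_atTop 0] with t ht
        simpa using hzb t (by simpa using ht)
      · simpa using (tendsto_rpow_atTop_of_base_lt_one q' (by linarith) hq').const_mul M'
    have hc : Continuous (reVec : (Fin n → ℂ) → Rn n) :=
      (PiLp.continuous_toLp 2 _).comp (continuous_pi fun l =>
        Complex.continuous_re.comp (continuous_apply l))
    have h0 : reVec (0 : Fin n → ℂ) = 0 := by ext l; simp [reVec]
    have := (hc.tendsto 0).comp hz0
    rwa [h0] at this
  · rw [← complexFourier_ofReal]
    have := hzero (x := (t : ℂ)) (by simpa using ht)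
    have h2 : (fun l => (reVec (z t) l : ℂ)) = z t := hγ t
    simpa [h2] using this

end Flow

end AnisoLP

namespace AnisoLP

/-! ### Anisotropic dilates -/

section Dilates

variable {n : ℕ} {A : Dilation n}

theorem dilate_apply (φ : 𝓢(Rn n, ℂ)) (k : ℤ) (x : Rn n) :
    dilate A φ k x = ((A.b ^ (-k) : ℝ) : ℂ) * φ (A.pow (-k) x) := by
  simp [dilate]

theorem norm_dilate_apply (φ : 𝓢(Rn n, ℂ)) (k : ℤ) (x : Rn n) :
    ‖dilate A φ k x‖ = A.b ^ (-k) * ‖φ (A.pow (-k) x)‖ := by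
  rw [dilate_apply, norm_mul, Complex.norm_real, Real.norm_of_nonneg (zpow_nonneg A.b_pos.le _)]

theorem det_pow (A : Dilation n) (k : ℤ) :
    |LinearMap.det ((A.pow k : Rn n →L[ℝ] Rn n) : Rn n →ₗ[ℝ] Rn n)| = A.b ^ k := by
  have h1 := Measure.addHaar_image_continuousLinearMap (volume : Measure (Rn n))
    (A.pow k : Rn n →L[ℝ] Rn n) (Metric.ball 0 1)
  have h2 := A.volume_image_pow k (Metric.ball 0 1)
  have h3 : ENNReal.ofReal |LinearMap.det ((A.pow k : Rn n →L[ℝ] Rn n) : Rn n →ₗ[ℝ] Rn n)| *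
      volume (Metric.ball (0 : Rn n) 1) =
      ENNReal.ofReal (A.b ^ k) * volume (Metric.ball (0 : Rn n) 1) := h1.symm.trans h2
  rw [ENNReal.mul_left_inj (Metric.measure_ball_pos _ _ one_pos).ne' measure_ball_lt_top.ne,
    ENNReal.ofReal_eq_ofReal_iff (abs_nonneg _) (zpow_nonneg A.b_pos.le _)] at h3
  exact h3

theorem map_pow_volume (A : Dilation n) (k : ℤ) :
    Measure.map (A.pow k) (volume : Measure (Rn n)) = ENNReal.ofReal (A.b ^ (-k)) • volume := by
  have h := Measure.map_linearMap_addHaar_eq_smul_addHaar (volume : Measure (Rn n))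
    (f := ((A.pow k : Rn n →L[ℝ] Rn n) : Rn n →ₗ[ℝ] Rn n)) (by
      intro h0
      have := det_pow A k
      rw [h0, abs_zero] at this
      exact (zpow_pos A.b_pos k).ne this)
  rw [abs_inv, det_pow, ← zpow_neg] at h
  exact h

theorem integral_comp_pow (A : Dilation n) (k : ℤ) {E : Type*} [NormedAddCommGroup E]
    [NormedSpace ℝ E] (f : Rn n → E) :
    ∫ x, f (A.pow k x) = (A.b ^ (-k)) • ∫ x, f x := by
  have h := (A.pow k).toHomeomorph.measurableEmbedding.integral_map
    (μ := (volume : Measure (Rn n))) f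
  have h2 : ∫ y, f y ∂(Measure.map (A.pow k) (volume : Measure (Rn n))) = ∫ x, f (A.pow k x) := h
  rw [← h2, map_pow_volume, integral_smul_measure,
    ENNReal.toReal_ofReal (zpow_nonneg A.b_pos.le _)]

theorem lintegral_comp_pow (A : Dilation n) (k : ℤ) (f : Rn n → ℝ≥0∞) :
    ∫⁻ x, f (A.pow k x) = ENNReal.ofReal (A.b ^ (-k)) * ∫⁻ x, f x := by
  have h := (A.pow k).toHomeomorph.measurableEmbedding.lintegral_map
    (μ := (volume : Measure (Rn n))) f
  have h2 : ∫⁻ y, f y ∂(Measure.map (A.pow k) (volume : Measure (Rn n))) = ∫⁻ x, f (A.pow k x) := h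
  rw [← h2, map_pow_volume, lintegral_smul_measure, smul_eq_mul]

theorem zpow_neg_mul_cancel (A : Dilation n) (k : ℤ) : A.b ^ (-k) * A.b ^ k = 1 := by
  rw [← zpow_add₀ A.b_pos.ne']; simp

/-- The transpose of `A ^ k`. -/
def Dilation.transpose (A : Dilation n) (k : ℤ) : Rn n →L[ℝ] Rn n :=
  ContinuousLinearMap.adjoint (A.pow k : Rn n →L[ℝ] Rn n)

theorem inner_transpose (k : ℤ) (x ξ : Rn n) :
    (inner ℝ x (A.transpose k ξ) : ℝ) = inner ℝ (A.pow k x) ξ :=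
  ContinuousLinearMap.adjoint_inner_right (A.pow k : Rn n →L[ℝ] Rn n) x ξ

theorem transpose_add (j k : ℤ) (ξ : Rn n) :
    A.transpose (j + k) ξ = A.transpose j (A.transpose k ξ) := by
  refine ext_inner_left ℝ fun x => ?_
  rw [inner_transpose, inner_transpose, inner_transpose, add_comm, A.pow_add_apply]

@[simp] theorem transpose_zero (ξ : Rn n) : A.transpose 0 ξ = ξ := by
  refine ext_inner_left ℝ fun x => ?_
  rw [inner_transpose, A.pow_zero_apply]

theorem norm_transpose (k : ℤ) : ‖A.transpose k‖ = ‖(A.pow k : Rn n →L[ℝ] Rn n)‖ := by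
  rw [Dilation.transpose, LinearIsometryEquiv.norm_map]

theorem norm_transpose_apply_le (k : ℤ) (ξ : Rn n) :
    ‖A.transpose k ξ‖ ≤ ‖(A.pow k : Rn n →L[ℝ] Rn n)‖ * ‖ξ‖ := by
  rw [← norm_transpose]; exact (A.transpose k).le_opNorm ξ

theorem fourier_dilate (φ : 𝓢(Rn n, ℂ)) (k : ℤ) (ξ : Rn n) :
    𝓕 (dilate A φ k) ξ = 𝓕 φ (A.transpose k ξ) := by
  rw [SchwartzMap.fourier_coe, SchwartzMap.fourier_coe, Real.fourier_eq, Real.fourier_eq]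
  have h := integral_comp_pow A (-k)
    (fun v => Real.fourierChar (-(inner ℝ v (A.transpose k ξ) : ℝ)) • φ v)
  rw [neg_neg] at h
  have h2 : ∀ v, Real.fourierChar (-(inner ℝ v ξ : ℝ)) • dilate A φ k v =
      ((A.b ^ (-k) : ℝ)) • (Real.fourierChar (-(inner ℝ (A.pow (-k) v) (A.transpose k ξ) : ℝ)) •
        φ (A.pow (-k) v)) := by
    intro v
    rw [inner_transpose, A.pow_pow_neg, dilate_apply, smul_comm, Complex.real_smul]
  simp only [h2]
  rw [integral_smul, h, smul_smul, zpow_neg_mul_cancel, one_smul]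

theorem dilate_sconv (a c : 𝓢(Rn n, ℂ)) (k : ℤ) :
    dilate A (sconv a c) k = sconv (dilate A a k) (dilate A c k) :=
  eq_of_fourier_eq fun ξ => by simp only [fourier_dilate, fourier_sconv]

theorem dilate_dilate (a : 𝓢(Rn n, ℂ)) (j k : ℤ) :
    dilate A (dilate A a j) k = dilate A a (j + k) :=
  eq_of_fourier_eq fun ξ => by simp only [fourier_dilate, transpose_add]

theorem dilate_sub (a c : 𝓢(Rn n, ℂ)) (k : ℤ) :
    dilate A (a - c) k = dilate A a k - dilate A c k := by
  ext x; simp [dilate, mul_sub]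

end Dilates

end AnisoLP

namespace AnisoLP

/-! ### The Tauberian condition -/

section Tauberian

variable {n : ℕ} {A : Dilation n} {Δ : Set (Rn n)}

theorem transpose_neg_one_pow (k : ℕ) (ξ : Rn n) :
    ((A.transpose (-1)) ^ k) ξ = A.transpose (-k) ξ := by
  induction k with
  | zero => simp
  | succ k ih =>
    rw [pow_succ', mul_apply_eq_comp, ih, ← transpose_add]
    congr 2
    push_cast; ring

theorem transpose_injective (k : ℤ) : Function.Injective (A.transpose k) := by
  refine Function.LeftInverse.injective (g := A.transpose (-k)) fun x => ?_
  rw [← transpose_add]; simp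

/-- The lower bound on one annulus for `ψ̂` forces `ψ̂` to be non-zero somewhere on each orbit of
the transposed dilation. -/
theorem IsAdmissible.exists_fourier_transpose_ne_zero (hn : 0 < n) (g : Gauge A Δ) {d : ℕ}
    {ψ : 𝓢(Rn n, ℂ)} (hψ : IsAdmissible A Δ d ψ) {ξ : Rn n} (hξ : ξ ≠ 0) :
    ∃ k : ℤ, 𝓕 ψ (A.transpose k ξ) ≠ 0 := by
  by_contra! hzero
  obtain ⟨C, hC, hCb⟩ := g.norm_pow_neg_le
  have hr0 := g.r_pos
  -- The curve must start outside Δ. If all positive iterates of ξ stayed in Δ they would be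
  -- bounded; pulling back by the transpose of A^{-m}, whose norm is also O(r^{-m}), would give ξ =
  -- 0.
  obtain ⟨m, hm⟩ : ∃ m : ℕ, 1 ≤ ‖g.P (A.transpose m ξ)‖ := by
    by_contra! hlt
    have hlim : Tendsto (fun m : ℕ => C * (g.r ^ m)⁻¹ * ‖(g.P.symm : Rn n →L[ℝ] Rn n)‖) atTop
        (𝓝 0) := by
      have := (tendsto_pow_atTop_nhds_zero_of_lt_one (inv_nonneg.2 hr0.le)
        (inv_lt_one_of_one_lt₀ g.one_lt)).const_mul C
      simpa [inv_pow] using this.mul_const ‖(g.P.symm : Rn n →L[ℝ] Rn n)‖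
    have hle : ‖ξ‖ ≤ 0 := ge_of_tendsto' hlim fun m => by
      have h1 : ξ = A.transpose (-m) (A.transpose m ξ) := by rw [← transpose_add]; simp
      have h2 : ‖A.transpose m ξ‖ ≤ ‖(g.P.symm : Rn n →L[ℝ] Rn n)‖ := by
        have := (g.P.symm : Rn n →L[ℝ] Rn n).le_opNorm (g.P (A.transpose m ξ))
        simp only [ContinuousLinearEquiv.coe_coe, ContinuousLinearEquiv.symm_apply_apply] at this
        exact this.trans (mul_le_of_le_one_right (norm_nonneg _) (hlt m).le)
      calc ‖ξ‖ ≤ ‖(A.pow (-m) : Rn n →L[ℝ] Rn n)‖ * ‖A.transpose m ξ‖ := by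
            conv_lhs => rw [h1]
            exact norm_transpose_apply_le _ _
        _ ≤ _ := mul_le_mul (hCb m) h2 (norm_nonneg _) (by positivity)
    exact hξ (norm_le_zero_iff.1 hle)
  obtain ⟨γ, hγ, hγ0, hγt, hγz⟩ := exists_curve_of_fourier_orbit_eq_zero
    (T := A.transpose (-1)) (transpose_injective (A := A) (-1)) (K := C) (q := g.r⁻¹) (by linarith)
    (inv_pos.2 hr0) (inv_lt_one_of_one_lt₀ g.one_lt)
    (fun k x => by
      rw [transpose_neg_one_pow, inv_pow]
      exact (norm_transpose_apply_le _ _).trans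
        (mul_le_mul_of_nonneg_right (hCb k) (norm_nonneg _)))
    hψ.compact_support (ξ := A.transpose m ξ) (fun k => by
      rw [transpose_neg_one_pow, ← transpose_add, ← SchwartzMap.fourier_coe]
      exact hzero _)
  have hcont : Continuous fun t => ‖g.P (γ t)‖ := (g.P.continuous.comp hγ).norm
  have hlim : Tendsto (fun t => ‖g.P (γ t)‖) atTop (𝓝 0) := by
    have := ((g.P.continuous.tendsto 0).comp hγt).norm
    simpa using this
  obtain ⟨T, hT0, hT⟩ : ∃ T : ℝ, 0 ≤ T ∧ ‖g.P (γ T)‖ ≤ 1 :=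
    ((eventually_ge_atTop 0).and (hlim.eventually_le_const one_pos)).exists
  -- The curve runs from outside Δ to 0 and so meets the boundary ‖P x‖ = 1.
  obtain ⟨t, ht, htv⟩ := intermediate_value_Icc' hT0 hcont.continuousOn
    (⟨hT, by rw [hγ0]; exact hm⟩ : (1 : ℝ) ∈ Set.Icc _ _)
  have h0 : γ t ∉ A.B Δ 0 := by
    rw [g.mem_B]; simp only [neg_zero, A.pow_zero_apply]; exact not_lt.2 htv.ge
  have h1 : γ t ∈ A.B Δ 1 := by
    rw [g.mem_B]
    -- A boundary point of Δ has ‖P A⁻¹ x‖ ≤ 1/r < 1, hence lies in AΔ.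
    have := g.contr (γ t)
    dsimp only at htv
    rw [htv] at this
    by_contra! hge
    have := g.one_lt
    nlinarith
  have hrho := g.rho_eq_one h1 h0
  obtain ⟨c, hc, hcb⟩ := hψ.lower_bound
  have hs := g.one_le_hsNorm hn
  have := hcb (γ t) (by rw [hrho]; exact inv_le_one_of_one_le₀ (by linarith)) hrho.le
  rw [hγz t ht.1, norm_zero] at this
  linarith

end Tauberian

end AnisoLP

namespace AnisoLP

/-! ### The discrete Calderón reproducing formula -/

section Calderon

variable {n : ℕ} {A : Dilation n} {Δ : Set (Rn n)}

/-- The Fourier transform of `ζ` is supported in an annulus. -/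
def FourierAnnular (ζ : 𝓢(Rn n, ℂ)) : Prop :=
  ∃ ε R : ℝ, 0 < ε ∧ ∀ ξ, 𝓕 ζ ξ ≠ 0 → ε ≤ ‖ξ‖ ∧ ‖ξ‖ ≤ R

theorem norm_le_transpose (k : ℤ) (ξ : Rn n) :
    ‖ξ‖ ≤ ‖(A.pow k : Rn n →L[ℝ] Rn n)‖ * ‖A.transpose (-k) ξ‖ := by
  have h : ξ = A.transpose k (A.transpose (-k) ξ) := by rw [← transpose_add]; simp
  conv_lhs => rw [h]
  exact norm_transpose_apply_le _ _

theorem fourierAnnular_dilate {ζ : 𝓢(Rn n, ℂ)} (h : FourierAnnular ζ) (k : ℤ) :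
    FourierAnnular (dilate A ζ k) := by
  obtain ⟨ε, R, hε, hb⟩ := h
  refine ⟨ε / (‖(A.pow k : Rn n →L[ℝ] Rn n)‖ + 1), ‖(A.pow (-k) : Rn n →L[ℝ] Rn n)‖ * R,
    by positivity, fun ξ hξ => ?_⟩
  rw [fourier_dilate] at hξ
  obtain ⟨h1, h2⟩ := hb _ hξ
  constructor
  · rw [div_le_iff₀ (by positivity)]
    have := norm_transpose_apply_le (A := A) k ξ
    nlinarith [norm_nonneg ξ]
  · have := norm_le_transpose (A := A) (-k) ξ
    rw [neg_neg] at this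
    exact this.trans (by gcongr)

theorem exists_fourier_eq {θ : Rn n → ℂ} (h1 : HasCompactSupport θ) (h2 : ContDiff ℝ (⊤ : ℕ∞) θ) :
    ∃ t : 𝓢(Rn n, ℂ), ∀ ξ, 𝓕 t ξ = θ ξ :=
  ⟨𝓕⁻ (h1.toSchwartzMap h2), fun ξ => by
    rw [FourierTransform.fourier_fourierInv_eq]; rfl⟩

/-- Approximation of the identity for distributions. -/
theorem tendsto_conv_sconv_dilate (g : Gauge A Δ) {H : 𝓢(Rn n, ℂ)} (hH : ∫ x, H x = 1)
    (f : 𝓢'(Rn n, ℂ)) (φ : 𝓢(Rn n, ℂ)) (y : Rn n) :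
    Tendsto (fun N : ℕ => conv f (sconv (dilate A H (-N)) φ) y) atTop (𝓝 (conv f φ y)) := by
  obtain ⟨C, hC, hCb⟩ := g.norm_pow_neg_le
  obtain ⟨D, K, hD, hDb⟩ := exists_growth_conv f φ
  have hr := g.one_lt
  -- The substitution z = y - A^{-N}u turns the convolution into an average of f∗φ over points
  -- converging to y.
  have heq : ∀ N : ℕ, conv f (sconv (dilate A H (-N)) φ) y =
      ∫ u, conv f φ (y - A.pow (-N) u) * H u := by
    intro N
    rw [sconv_comm, conv_sconv, ← integral_sub_left_eq_self _ volume y]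
    have h := integral_comp_pow A N (fun u => conv f φ (y - A.pow (-N) u) * H u)
    have h' : ∫ u, conv f φ (y - A.pow (-N) u) * H u = (A.b ^ (N : ℤ)) •
        ∫ x, conv f φ (y - A.pow (-N) (A.pow N x)) * H (A.pow N x) := by
      rw [h, smul_smul, mul_comm, zpow_neg_mul_cancel, one_smul]
    rw [h', ← integral_smul]
    refine integral_congr_ae (ae_of_all _ fun x => ?_)
    simp only [sub_sub_cancel, dilate_apply, neg_neg, A.pow_neg_pow, Complex.real_smul]
    ring
  simp only [heq]
  have hlim : conv f φ y = ∫ u, conv f φ y * H u := by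
    rw [integral_const_mul, hH, mul_one]
  rw [hlim]
  refine tendsto_integral_of_dominated_convergence
    (fun u => D * ((1 + ‖y‖) * C) ^ K * ((1 + ‖u‖) ^ K * ‖H u‖)) (fun N => ?_)
    ((integrable_growth_mul H K).const_mul _) (fun N => ae_of_all _ fun u => ?_)
    (ae_of_all _ fun u => ?_)
  · exact (((continuous_conv f φ).comp (continuous_const.sub (A.pow (-N)).continuous)).mul
      H.continuous).aestronglyMeasurable
  · have h1 : ‖A.pow (-N) u‖ ≤ C * ‖u‖ := by
      refine ((A.pow (-N) : Rn n →L[ℝ] Rn n).le_opNorm u).trans ?_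
      refine mul_le_mul_of_nonneg_right ((hCb N).trans ?_) (norm_nonneg _)
      exact mul_le_of_le_one_right (by linarith) (inv_le_one_of_one_le₀ (one_le_pow₀ hr.le))
    have h2 : 1 + ‖y - A.pow (-N) u‖ ≤ (1 + ‖y‖) * C * (1 + ‖u‖) := by
      have := norm_sub_le y (A.pow (-N) u)
      have h3 : 0 ≤ ‖y‖ * C * ‖u‖ := by positivity
      nlinarith [norm_nonneg y, norm_nonneg u]
    rw [norm_mul]
    calc ‖conv f φ (y - A.pow (-N) u)‖ * ‖H u‖
        ≤ (D * ((1 + ‖y‖) * C * (1 + ‖u‖)) ^ K) * ‖H u‖ := by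
          gcongr
          exact (hDb _).trans (by gcongr)
      _ = _ := by rw [mul_pow]; ring
  · have hz : Tendsto (fun N : ℕ => A.pow (-N) u) atTop (𝓝 0) := by
      rw [tendsto_zero_iff_norm_tendsto_zero]
      have hl : Tendsto (fun m : ℕ => C * (g.r ^ m)⁻¹ * ‖u‖) atTop (𝓝 0) := by
        have := (tendsto_pow_atTop_nhds_zero_of_lt_one (inv_nonneg.2 g.r_pos.le)
          (inv_lt_one_of_one_lt₀ hr)).const_mul C
        simpa [inv_pow] using this.mul_const ‖u‖
      refine squeeze_zero (fun _ => norm_nonneg _) (fun N => ?_) hl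
      exact ((A.pow (-N) : Rn n →L[ℝ] Rn n).le_opNorm u).trans
        (mul_le_mul_of_nonneg_right (hCb N) (norm_nonneg _))
    have := ((continuous_conv f φ).tendsto y).comp
      (by simpa using (tendsto_const_nhds (x := y)).sub hz :
        Tendsto (fun N : ℕ => y - A.pow (-N) u) atTop (𝓝 y))
    exact this.mul_const _

/-- By associativity the value at y is the pairing of f∗H_N with the test function φ(y - ·), so the
weak vanishing at infinity applies directly. -/
theorem tendsto_conv_sconv_dilate_zero {f : 𝓢'(Rn n, ℂ)} (hf : VanishesWeaklyAtInfinity A f)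
    (H φ : 𝓢(Rn n, ℂ)) (y : Rn n) :
    Tendsto (fun N : ℕ => conv f (sconv (dilate A H N) φ) y) atTop (𝓝 0) := by
  have h := (hf H (reflectTranslate φ y)).comp tendsto_natCast_atTop_atTop
  refine h.congr fun N => ?_
  rw [conv_sconv]
  simp only [Function.comp_apply, reflectTranslate_apply]

/-- Division of an annular function by the orbit of a Tauberian function. -/
theorem exists_tauberian_decomposition {ψ w : 𝓢(Rn n, ℂ)} (hw : FourierAnnular w)
    (hψ : ∀ ξ : Rn n, ξ ≠ 0 → ∃ k : ℤ, 𝓕 ψ (A.transpose k ξ) ≠ 0) :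
    ∃ (s : Finset ℤ) (t : ℤ → 𝓢(Rn n, ℂ)), (∀ m, FourierAnnular (t m)) ∧
      w = ∑ m ∈ s, sconv (dilate A ψ m) (t m) := by
  obtain ⟨ε, R, hε, hb⟩ := hw
  let K : Set (Rn n) := Metric.closedBall 0 R ∩ {ξ | ε ≤ ‖ξ‖}
  have hKc : IsCompact K := (isCompact_closedBall 0 R).inter_right
    (isClosed_le continuous_const continuous_norm)
  have hwK : ∀ ξ, ξ ∉ K → 𝓕 w ξ = 0 := fun ξ hξ => by
    by_contra h
    exact hξ ⟨by simpa using (hb ξ h).2, (hb ξ h).1⟩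
  have hcont : ∀ m : ℤ, ContDiff ℝ (⊤ : ℕ∞) fun ξ => 𝓕 ψ (A.transpose m ξ) := fun m =>
    ((𝓕 ψ).smooth _).comp (A.transpose m).contDiff
  obtain ⟨s, hs⟩ := hKc.elim_finite_subcover (fun m : ℤ => {ξ | 𝓕 ψ (A.transpose m ξ) ≠ 0})
    (fun m => isOpen_ne_fun (hcont m).continuous continuous_const) (fun ξ hξ => by
      have h0 : ξ ≠ 0 := by
        rintro rfl
        have : ε ≤ ‖(0 : Rn n)‖ := hξ.2
        rw [norm_zero] at this; linarith
      obtain ⟨k, hk⟩ := hψ ξ h0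
      exact Set.mem_iUnion.2 ⟨k, hk⟩)
  -- Multiplying by conjugates makes the divisor a finite sum of squares, which can vanish only
  -- where all the translates of ψ̂ along the orbit vanish. Compactness of the annulus makes
  -- finitely many scales suffice.
  let Q : Rn n → ℂ := fun ξ => ∑ m ∈ s, starRingEnd ℂ (𝓕 ψ (A.transpose m ξ)) *
    𝓕 ψ (A.transpose m ξ)
  have hconj : ∀ m : ℤ, ContDiff ℝ (⊤ : ℕ∞) fun ξ => starRingEnd ℂ (𝓕 ψ (A.transpose m ξ)) :=
    fun m => Complex.conjCLE.contDiff.comp (hcont m)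
  have hQs : ContDiff ℝ (⊤ : ℕ∞) Q := ContDiff.sum fun m _ => (hconj m).mul (hcont m)
  have hQ : ∀ ξ ∈ K, Q ξ ≠ 0 := by
    intro ξ hξ h0
    obtain ⟨m, hm, hne⟩ : ∃ m ∈ s, 𝓕 ψ (A.transpose m ξ) ≠ 0 := by
      simpa using hs hξ
    have h1 : Q ξ = ((∑ m ∈ s, Complex.normSq (𝓕 ψ (A.transpose m ξ)) : ℝ) : ℂ) := by
      simp only [Q, Complex.ofReal_sum, Complex.normSq_eq_conj_mul_self]
    rw [h1, Complex.ofReal_eq_zero,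
      Finset.sum_eq_zero_iff_of_nonneg fun _ _ => Complex.normSq_nonneg _] at h0
    exact hne (Complex.normSq_eq_zero.1 (h0 m hm))
  let θ : ℤ → Rn n → ℂ := fun m ξ => 𝓕 w ξ * (starRingEnd ℂ (𝓕 ψ (A.transpose m ξ)) / Q ξ)
  have hθK : ∀ m ξ, ξ ∉ K → θ m ξ = 0 := fun m ξ hξ => by simp only [θ, hwK ξ hξ, zero_mul]
  have hθc : ∀ m, HasCompactSupport (θ m) := fun m => HasCompactSupport.intro hKc (hθK m)
  -- At points of K the divisor is non-zero; off the closed set K the quotient is locally zero.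
  have hθs : ∀ m, ContDiff ℝ (⊤ : ℕ∞) (θ m) := fun m => by
    rw [contDiff_iff_contDiffAt]
    intro ξ
    by_cases hξ : ξ ∈ K
    · simp only [θ, div_eq_mul_inv]
      exact ((𝓕 w).smooth _).contDiffAt.mul
        ((hconj m).contDiffAt.mul (hQs.contDiffAt.inv (hQ ξ hξ)))
    · refine (contDiffAt_const (c := (0 : ℂ))).congr_of_eventuallyEq ?_
      filter_upwards [hKc.isClosed.isOpen_compl.mem_nhds hξ] with x hx using hθK m x hx
  choose t ht using fun m => exists_fourier_eq (hθc m) (hθs m)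
  refine ⟨s, t, fun m => ⟨ε, R, hε, fun ξ hξ => ?_⟩, eq_of_fourier_eq fun ξ => ?_⟩
  · rw [ht] at hξ
    exact hb ξ (left_ne_zero_of_mul hξ)
  · have h1 : 𝓕 (∑ m ∈ s, sconv (dilate A ψ m) (t m)) ξ =
        ∑ m ∈ s, 𝓕 ψ (A.transpose m ξ) * θ m ξ := by
      have : 𝓕 (∑ m ∈ s, sconv (dilate A ψ m) (t m)) =
          ∑ m ∈ s, 𝓕 (sconv (dilate A ψ m) (t m)) :=
        map_sum (FourierTransform.fourierCLM ℂ 𝓢(Rn n, ℂ)) _ _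
      rw [this, sum_apply]
      exact Finset.sum_congr rfl fun m _ => by rw [fourier_sconv, fourier_dilate, ht]
    rw [h1]
    by_cases hξ : ξ ∈ K
    · have h2 : ∑ m ∈ s, 𝓕 ψ (A.transpose m ξ) * θ m ξ = 𝓕 w ξ * (Q ξ / Q ξ) := by
        simp only [θ, Q, Finset.sum_div, Finset.mul_sum]
        exact Finset.sum_congr rfl fun m _ => by ring
      rw [h2, div_self (hQ ξ hξ), mul_one]
    · simp [hwK ξ hξ, hθK _ ξ hξ]

/-- Take Ĥ equal to 1 on the unit ball and 0 outside the ball of radius 2. For small ξ both ξ and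
its image under the transpose of A⁻¹ lie in the unit ball, for large ξ both lie outside the larger
ball, and the difference vanishes in each case. -/
theorem exists_annular_partition : ∃ H : 𝓢(Rn n, ℂ), ∫ x, H x = 1 ∧
    FourierAnnular (dilate A H (-1) - H) := by
  let h : ContDiffBump (0 : Rn n) := ⟨1, 2, one_pos, one_lt_two⟩
  obtain ⟨H, hH⟩ := exists_fourier_eq (θ := fun ξ : Rn n => ((h ξ : ℝ) : ℂ))
    (h.hasCompactSupport.comp_left Complex.ofReal_zero)
    (Complex.ofRealCLM.contDiff.comp h.contDiff)
  have h1 : ∀ ξ : Rn n, ‖ξ‖ ≤ 1 → 𝓕 H ξ = 1 := fun ξ hξ => by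
    rw [hH, h.one_of_mem_closedBall (by simpa using hξ), Complex.ofReal_one]
  have h2 : ∀ ξ : Rn n, 2 ≤ ‖ξ‖ → 𝓕 H ξ = 0 := fun ξ hξ => by
    rw [hH, h.zero_of_le_dist (by simpa using hξ), Complex.ofReal_zero]
  refine ⟨H, ?_, ?_⟩
  · have := h1 0 (by simp)
    rw [SchwartzMap.fourier_coe, Real.fourier_eq] at this
    simpa only [inner_zero_right, neg_zero, AddChar.map_zero_eq_one, one_smul] using this
  · refine ⟨(1 + ‖(A.pow (-1) : Rn n →L[ℝ] Rn n)‖)⁻¹, 2 + ‖(A.pow 1 : Rn n →L[ℝ] Rn n)‖ * 2,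
      by positivity, fun ξ hξ => ?_⟩
    have hsub : 𝓕 (dilate A H (-1) - H) ξ = 𝓕 H (A.transpose (-1) ξ) - 𝓕 H ξ := by
      rw [← fourier_dilate]
      have : 𝓕 (dilate A H (-1) - H) = 𝓕 (dilate A H (-1)) - 𝓕 H :=
        map_sub (FourierTransform.fourierCLM ℂ 𝓢(Rn n, ℂ)) _ _
      rw [this]; rfl
    rw [hsub] at hξ
    have hle := norm_transpose_apply_le (A := A) (-1) ξ
    have hge := norm_le_transpose (A := A) 1 ξ
    have hn1 := norm_nonneg (A.pow (-1) : Rn n →L[ℝ] Rn n)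
    have hn2 := norm_nonneg (A.pow 1 : Rn n →L[ℝ] Rn n)
    constructor
    · by_contra! hlt
      rw [inv_eq_one_div, lt_div_iff₀ (by positivity)] at hlt
      exact hξ (by rw [h1 _ (by nlinarith [norm_nonneg ξ]), h1 ξ (by nlinarith [norm_nonneg ξ]),
        sub_self])
    · by_contra! hlt
      refine hξ ?_
      rw [h2 ξ (by nlinarith), h2, sub_self]
      by_contra! h3
      nlinarith

theorem sum_Ioc_telescope (N : ℕ) {E : Type*} [AddCommGroup E] (F : ℤ → E) :
    ∑ k ∈ Finset.Ioc (-N : ℤ) N, (F (k - 1) - F k) = F (-N) - F N := by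
  induction N with
  | zero => simp
  | succ N ih =>
    have : Finset.Ioc (-((N + 1 : ℕ) : ℤ)) (N + 1 : ℕ) =
        insert ((N : ℤ) + 1) (insert (-(N : ℤ)) (Finset.Ioc (-N : ℤ) N)) := by
      ext k; simp; omega
    rw [this, Finset.sum_insert (by simp), Finset.sum_insert (by simp), ih]
    rw [show (-(N : ℤ) - 1) = -((N + 1 : ℕ) : ℤ) by push_cast; ring,
      show (N : ℤ) + 1 - 1 = N by ring]
    push_cast
    abel

/-- The discrete Calderón reproducing formula for distributions vanishing weakly at infinity. -/
theorem exists_calderon (g : Gauge A Δ) {ψ : 𝓢(Rn n, ℂ)}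
    (hψ : ∀ ξ : Rn n, ξ ≠ 0 → ∃ k : ℤ, 𝓕 ψ (A.transpose k ξ) ≠ 0) :
    ∃ (s : Finset ℤ) (ζ : ℤ → 𝓢(Rn n, ℂ)), (∀ m, FourierAnnular (ζ m)) ∧
      ∀ f : 𝓢'(Rn n, ℂ), VanishesWeaklyAtInfinity A f → ∀ (φ : 𝓢(Rn n, ℂ)) (y : Rn n),
        Tendsto (fun N : ℕ => ∑ k ∈ Finset.Ioc (-N : ℤ) N, ∑ m ∈ s,
          ∫ z, conv f (dilate A ψ (k + m)) z * sconv (dilate A (ζ m) (k + m)) φ (y - z))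
          atTop (𝓝 (conv f φ y)) := by
  obtain ⟨H, hH1, hH⟩ := exists_annular_partition (A := A)
  obtain ⟨s, t, ht, hdec⟩ := exists_tauberian_decomposition hH hψ
  -- The shift by -m brings both factors of each term to the common scale k + m.
  refine ⟨s, fun m => dilate A (t m) (-m), fun m => fourierAnnular_dilate (ht m) _, fun f hf φ y => ?_⟩
  have hlim := (tendsto_conv_sconv_dilate g hH1 f φ y).sub (tendsto_conv_sconv_dilate_zero hf H φ y)
  rw [sub_zero] at hlim
  refine hlim.congr fun N => ?_
  -- H_{-N} - H_N telescopes into dilates of the annular function H_{-1} - H, each of which is then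
  -- split by the division above.
  rw [← sum_Ioc_telescope N fun k => conv f (sconv (dilate A H k) φ) y]
  refine Finset.sum_congr rfl fun k _ => ?_
  have hk : dilate A H (k - 1) - dilate A H k =
      ∑ m ∈ s, sconv (dilate A ψ (k + m)) (dilate A (dilate A (t m) (-m)) (k + m)) := by
    have h1 : dilate A H (k - 1) - dilate A H k = dilate A (dilate A H (-1) - H) k := by
      rw [dilate_sub, dilate_dilate, neg_add_eq_sub]
    have h2 : ∀ u : ℤ → 𝓢(Rn n, ℂ), dilate A (∑ m ∈ s, u m) k = ∑ m ∈ s, dilate A (u m) k :=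
      fun u => by simp only [dilate, map_sum, Finset.smul_sum]
    rw [h1, hdec, h2]
    refine Finset.sum_congr rfl fun m _ => ?_
    rw [dilate_sconv, dilate_dilate, dilate_dilate]
    congr 2 <;> ring
  rw [← conv_sub, ← sconv_sub_left, hk, sconv_sum_left, conv_sum]
  exact Finset.sum_congr rfl fun m _ => by rw [sconv_assoc, conv_sconv]

end Calderon

end AnisoLP

namespace AnisoLP

/-! ### Almost orthogonality of annular functions and dilates -/

section Kernel

variable {n : ℕ} {A : Dilation n} {Δ : Set (Rn n)}

theorem exists_weight_bound (ζ : 𝓢(Rn n, ℂ)) (N : ℕ) :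
    ∃ C : ℝ, 0 ≤ C ∧ ∀ v, (1 + ‖v‖) ^ N * ‖ζ v‖ ≤ C :=
  ⟨2 ^ N * ((Finset.Iic (N, 0)).sup fun m => SchwartzMap.seminorm ℂ m.1 m.2) ζ, by positivity,
    fun v => by
      have := SchwartzMap.one_add_le_sup_seminorm_apply (𝕜 := ℂ) (m := (N, 0)) le_rfl le_rfl ζ v
      rwa [norm_iteratedFDeriv_zero] at this⟩

theorem weight_le_mul (x h : Rn n) : 1 + ‖x‖ ≤ (1 + ‖x - h‖) * (1 + ‖h‖) := by
  have : ‖x‖ ≤ ‖x - h‖ + ‖h‖ := by simpa using norm_add_le (x - h) h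
  nlinarith [norm_nonneg (x - h), norm_nonneg h]

/-- For ‖h‖ ≤ 1 this is the mean value inequality; for ‖h‖ ≥ 1 the two values are estimated
separately, at the cost of moving the weight from v - h to v. -/
theorem exists_difference_bound (ζ : 𝓢(Rn n, ℂ)) (N : ℕ) : ∃ C : ℝ, 0 ≤ C ∧ ∀ v h,
    (1 + ‖v‖) ^ N * ‖ζ (v - h) - ζ v‖ ≤ C * (‖h‖ * (1 + ‖h‖) ^ N) := by
  obtain ⟨C₁, hC₁, h1⟩ := norm_iteratedFDeriv_sub_le ζ N 0
  obtain ⟨C₂, hC₂, h2⟩ := exists_weight_bound ζ N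
  refine ⟨C₁ + 2 * C₂, by positivity, fun v h => ?_⟩
  have hW : 1 ≤ (1 + ‖h‖) ^ N := one_le_pow₀ (by simp)
  have hh := norm_nonneg h
  rcases le_total ‖h‖ 1 with hle | hge
  · have h3 := h1 v (-h) (by simpa using hle)
    have h4 : ‖iteratedFDeriv ℝ 0 ζ (v + -h) - iteratedFDeriv ℝ 0 ζ v‖ = ‖ζ (v - h) - ζ v‖ := by
      rw [← sub_eq_add_neg, iteratedFDeriv_zero_eq_comp, Function.comp_apply, Function.comp_apply,
        ← map_sub, LinearIsometryEquiv.norm_map]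
    rw [h4, norm_neg] at h3
    calc _ ≤ C₁ * ‖h‖ := h3
      _ ≤ (C₁ + 2 * C₂) * (‖h‖ * (1 + ‖h‖) ^ N) :=
        mul_le_mul (by linarith) (le_mul_of_one_le_right hh hW) hh (by positivity)
  · have h3 : (1 + ‖v‖) ^ N * ‖ζ (v - h)‖ ≤ C₂ * (1 + ‖h‖) ^ N := by
      calc _ ≤ ((1 + ‖v - h‖) * (1 + ‖h‖)) ^ N * ‖ζ (v - h)‖ := by
            gcongr; exact weight_le_mul v h
        _ = ((1 + ‖v - h‖) ^ N * ‖ζ (v - h)‖) * (1 + ‖h‖) ^ N := by rw [mul_pow]; ring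
        _ ≤ _ := by gcongr; exact h2 _
    have h4 : (1 + ‖v‖) ^ N * ‖ζ v‖ ≤ C₂ * (1 + ‖h‖) ^ N :=
      (h2 v).trans (le_mul_of_one_le_right hC₂ hW)
    calc _ ≤ (1 + ‖v‖) ^ N * (‖ζ (v - h)‖ + ‖ζ v‖) := by gcongr; exact norm_sub_le _ _
      _ ≤ 2 * C₂ * (1 + ‖h‖) ^ N := by linarith
      _ ≤ (C₁ + 2 * C₂) * (‖h‖ * (1 + ‖h‖) ^ N) := by
        refine mul_le_mul (by linarith) (le_mul_of_one_le_left (by positivity) hge) (by positivity)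
          (by positivity)

theorem sconv_dilate_apply (ζ φ : 𝓢(Rn n, ℂ)) (m : ℤ) (v : Rn n) :
    sconv ζ (dilate A φ m) v = ∫ u, ζ (v - A.pow m u) * φ u := by
  rw [sconv_apply']
  have h := integral_comp_pow A (-m) (fun u => ζ (v - A.pow m u) * φ u)
  rw [neg_neg] at h
  have h' : ∫ u, ζ (v - A.pow m u) * φ u = (A.b ^ (-m)) •
      ∫ x, ζ (v - A.pow m (A.pow (-m) x)) * φ (A.pow (-m) x) := by
    rw [h, smul_smul, zpow_neg_mul_cancel, one_smul]
  rw [h', ← integral_smul]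
  refine integral_congr_ae (ae_of_all _ fun x => ?_)
  simp only [dilate_apply, A.pow_pow_neg, Complex.real_smul]
  ring

theorem integrable_comp_sub_mul (ζ φ : 𝓢(Rn n, ℂ)) (m : ℤ) (v : Rn n) :
    Integrable fun u => ζ (v - A.pow m u) * φ u := by
  obtain ⟨C, hC, hb⟩ := exists_weight_bound ζ 0
  refine (φ.integrable.norm.const_mul C).mono'
    ((ζ.continuous.comp (continuous_const.sub (A.pow m).continuous)).mul
      φ.continuous).aestronglyMeasurable (ae_of_all _ fun u => ?_)
  rw [norm_mul]
  gcongr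
  simpa using hb (v - A.pow m u)

theorem weight_apply_le (m : ℤ) (u : Rn n) :
    1 + ‖A.pow m u‖ ≤ (1 + ‖(A.pow m : Rn n →L[ℝ] Rn n)‖) * (1 + ‖u‖) := by
  have := (A.pow m : Rn n →L[ℝ] Rn n).le_opNorm u
  simp only [ContinuousLinearEquiv.coe_coe] at this
  nlinarith [norm_nonneg (A.pow m : Rn n →L[ℝ] Rn n), norm_nonneg u]

/-- The estimate without cancellation. Its loss, a power of 1 + ‖A^m‖, is repaired by moving
derivatives when m ≥ 0. -/
theorem exists_sconv_dilate_bound (ζ φ : 𝓢(Rn n, ℂ)) (N : ℕ) : ∃ C : ℝ, 0 ≤ C ∧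
    ∀ (m : ℤ) (v : Rn n), (1 + ‖v‖) ^ N * ‖sconv ζ (dilate A φ m) v‖ ≤
      C * (1 + ‖(A.pow m : Rn n →L[ℝ] Rn n)‖) ^ N := by
  obtain ⟨C, hC, hb⟩ := exists_weight_bound ζ N
  refine ⟨C * ∫ u, (1 + ‖u‖) ^ N * ‖φ u‖, mul_nonneg hC (integral_nonneg fun u => by positivity),
    fun m v => ?_⟩
  set a := ‖(A.pow m : Rn n →L[ℝ] Rn n)‖
  rw [sconv_dilate_apply]
  have h1 : ∀ u, (1 + ‖v‖) ^ N * ‖ζ (v - A.pow m u) * φ u‖ ≤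
      C * (1 + a) ^ N * ((1 + ‖u‖) ^ N * ‖φ u‖) := by
    intro u
    rw [norm_mul]
    calc _ ≤ ((1 + ‖v - A.pow m u‖) * ((1 + a) * (1 + ‖u‖))) ^ N *
          (‖ζ (v - A.pow m u)‖ * ‖φ u‖) := by
          gcongr
          exact (weight_le_mul v (A.pow m u)).trans (by gcongr; exact weight_apply_le m u)
      _ = ((1 + ‖v - A.pow m u‖) ^ N * ‖ζ (v - A.pow m u)‖) *
          ((1 + a) ^ N * ((1 + ‖u‖) ^ N * ‖φ u‖)) := by rw [mul_pow, mul_pow]; ring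
      _ ≤ C * ((1 + a) ^ N * ((1 + ‖u‖) ^ N * ‖φ u‖)) := by gcongr; exact hb _
      _ = _ := by ring
  calc _ ≤ (1 + ‖v‖) ^ N * ∫ u, ‖ζ (v - A.pow m u) * φ u‖ := by
        gcongr; exact norm_integral_le_integral_norm _
    _ = ∫ u, (1 + ‖v‖) ^ N * ‖ζ (v - A.pow m u) * φ u‖ := by rw [integral_const_mul]
    _ ≤ ∫ u, C * (1 + a) ^ N * ((1 + ‖u‖) ^ N * ‖φ u‖) :=
        integral_mono ((integrable_comp_sub_mul ζ φ m v).norm.const_mul _)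
          ((integrable_growth_mul φ N).const_mul _) h1
    _ = _ := by rw [integral_const_mul]; ring

/-- The Fourier transform of ω_i is ζ̂(ξ) ξ_i / (2πi |ξ|²), smooth because ζ̂ vanishes near 0. The
ω_i are again annular, so the representation can be iterated. -/
theorem FourierAnnular.exists_divergence {ζ : 𝓢(Rn n, ℂ)} (h : FourierAnnular ζ) :
    ∃ ω : Fin n → 𝓢(Rn n, ℂ), (∀ i, FourierAnnular (ω i)) ∧
      ∀ ξ : Rn n, 𝓕 ζ ξ = ∑ i, 2 * Real.pi * Complex.I * (ξ i : ℝ) * 𝓕 (ω i) ξ := by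
  obtain ⟨ε, R, hε, hb⟩ := h
  have hζ0 : ∀ ξ : Rn n, ‖ξ‖ < ε → 𝓕 ζ ξ = 0 := fun ξ hξ => by
    by_contra hne; exact absurd (hb ξ hne).1 (not_le.2 hξ)
  let θ : Fin n → Rn n → ℂ := fun i ξ =>
    𝓕 ζ ξ * (((ξ i / ‖ξ‖ ^ 2 : ℝ) : ℂ) * (2 * Real.pi * Complex.I)⁻¹)
  have hθ0 : ∀ i ξ, 𝓕 ζ ξ = 0 → θ i ξ = 0 := fun i ξ hξ => by simp only [θ, hξ, zero_mul]
  have hc : ∀ i, HasCompactSupport (θ i) := fun i =>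
    HasCompactSupport.intro (isCompact_closedBall 0 R) fun ξ hξ => hθ0 i ξ (by
      by_contra hne; exact hξ (by simpa using (hb ξ hne).2))
  have hs : ∀ i, ContDiff ℝ (⊤ : ℕ∞) (θ i) := fun i => by
    rw [contDiff_iff_contDiffAt]
    intro ξ
    rcases eq_or_ne ξ 0 with rfl | hξ
    · refine (contDiffAt_const (c := (0 : ℂ))).congr_of_eventuallyEq ?_
      filter_upwards [Metric.ball_mem_nhds (0 : Rn n) hε] with x hx
      exact hθ0 i x (hζ0 x (by simpa using hx))
    · have hcoord : ContDiff ℝ (⊤ : ℕ∞) fun ξ : Rn n => ξ i :=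
        (EuclideanSpace.proj i : Rn n →L[ℝ] ℝ).contDiff
      have hdiv : ContDiffAt ℝ (⊤ : ℕ∞) (fun ξ : Rn n => ξ i / ‖ξ‖ ^ 2) ξ :=
        hcoord.contDiffAt.div (contDiff_norm_sq ℝ).contDiffAt (by positivity)
      exact ((𝓕 ζ).smooth _).contDiffAt.mul
        ((Complex.ofRealCLM.contDiff.contDiffAt.comp ξ hdiv).mul contDiffAt_const)
  choose ω hω using fun i => exists_fourier_eq (hc i) (hs i)
  refine ⟨ω, fun i => ⟨ε, R, hε, fun ξ hξ => hb ξ fun h0 => hξ (by rw [hω, hθ0 i ξ h0])⟩,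
    fun ξ => ?_⟩
  rcases eq_or_ne ξ 0 with rfl | hξ
  · rw [hζ0 0 (by simpa using hε)]; simp
  · have h1 : ∀ i, 2 * Real.pi * Complex.I * (ξ i : ℝ) * 𝓕 (ω i) ξ =
        𝓕 ζ ξ * ((ξ i ^ 2 / ‖ξ‖ ^ 2 : ℝ) : ℂ) := fun i => by
      rw [hω]
      have := Complex.two_pi_I_ne_zero
      simp only [θ]
      push_cast
      field_simp
    rw [Finset.sum_congr rfl fun i _ => h1 i, ← Finset.mul_sum, ← Complex.ofReal_sum,
      ← Finset.sum_div, ← EuclideanSpace.real_norm_sq_eq, div_self (by positivity),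
      Complex.ofReal_one, mul_one]

/-- Transfer of one derivative from an annular function to a dilate. -/
theorem sconv_dilate_eq_sum {ζ : 𝓢(Rn n, ℂ)} {ω : Fin n → 𝓢(Rn n, ℂ)}
    (h : ∀ ξ : Rn n, 𝓕 ζ ξ = ∑ i, 2 * Real.pi * Complex.I * (ξ i : ℝ) * 𝓕 (ω i) ξ)
    (φ : 𝓢(Rn n, ℂ)) (m : ℤ) :
    sconv ζ (dilate A φ m) = ∑ i, ∑ l, (A.pow (-m) (EuclideanSpace.single i 1) l : ℂ) •
      sconv (ω i) (dilate A (LineDeriv.lineDerivOp (EuclideanSpace.single l (1 : ℝ)) φ) m) := by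
  refine eq_of_fourier_eq fun ξ => ?_
  have h1 : ∀ F : Fin n → Fin n → 𝓢(Rn n, ℂ), ∀ c : Fin n → Fin n → ℂ,
      𝓕 (∑ i, ∑ l, c i l • F i l) ξ = ∑ i, ∑ l, c i l * 𝓕 (F i l) ξ := by
    intro F c
    have : 𝓕 (∑ i, ∑ l, c i l • F i l) = ∑ i, ∑ l, c i l • 𝓕 (F i l) := by
      change FourierTransform.fourierCLM ℂ 𝓢(Rn n, ℂ) _ = _
      simp only [map_sum, map_smul]
      rfl
    rw [this, sum_apply]
    refine Finset.sum_congr rfl fun i _ => ?_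
    rw [sum_apply]
    rfl
  rw [h1]
  simp only [fourier_sconv, fourier_dilate, fourier_lineDeriv]
  rw [h ξ, Finset.sum_mul]
  refine Finset.sum_congr rfl fun i _ => ?_
  have h2 : (ξ i : ℝ) = ∑ l, A.pow (-m) (EuclideanSpace.single i 1) l *
      (inner ℝ (A.transpose m ξ) (EuclideanSpace.single l (1 : ℝ)) : ℝ) := by
    have h3 : (ξ i : ℝ) = inner ℝ (A.pow (-m) (EuclideanSpace.single i 1)) (A.transpose m ξ) := by
      rw [inner_transpose, A.pow_pow_neg, EuclideanSpace.inner_single_left]; simp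
    rw [h3, PiLp.inner_apply]
    refine Finset.sum_congr rfl fun l _ => ?_
    rw [EuclideanSpace.inner_single_right]
    simp [mul_comm]
  rw [h2, Complex.ofReal_sum, Finset.mul_sum, Finset.sum_mul, Finset.sum_mul]
  refine Finset.sum_congr rfl fun l _ => ?_
  push_cast
  ring

/-- Each transfer of a derivative from ζ to φ(A^{-m} ·) gains one factor ‖A^{-m}‖. The annular
support allows any number L of transfers. -/
theorem FourierAnnular.exists_sconv_dilate_bound (L N : ℕ) : ∀ {ζ : 𝓢(Rn n, ℂ)},
    FourierAnnular ζ → ∀ φ : 𝓢(Rn n, ℂ), ∃ C : ℝ, 0 ≤ C ∧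
    ∀ (m : ℤ) (v : Rn n), (1 + ‖v‖) ^ N * ‖sconv ζ (dilate A φ m) v‖ ≤
      C * ‖(A.pow (-m) : Rn n →L[ℝ] Rn n)‖ ^ L * (1 + ‖(A.pow m : Rn n →L[ℝ] Rn n)‖) ^ N := by
  induction L with
  | zero =>
    intro ζ _ φ
    simpa using AnisoLP.exists_sconv_dilate_bound (A := A) ζ φ N
  | succ L ih =>
    intro ζ hζ φ
    obtain ⟨ω, hω, heq⟩ := hζ.exists_divergence
    choose C hC hb using fun i l : Fin n =>
      ih (hω i) (LineDeriv.lineDerivOp (EuclideanSpace.single l (1 : ℝ)) φ)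
    refine ⟨∑ i, ∑ l, C i l, Finset.sum_nonneg fun i _ => Finset.sum_nonneg fun l _ => hC i l,
      fun m v => ?_⟩
    rw [sconv_dilate_eq_sum heq φ m]
    set a := ‖(A.pow (-m) : Rn n →L[ℝ] Rn n)‖ with ha
    set a' := ‖(A.pow m : Rn n →L[ℝ] Rn n)‖
    have hco : ∀ i l, ‖(A.pow (-m) (EuclideanSpace.single i 1) l : ℂ)‖ ≤ a := by
      intro i l
      rw [Complex.norm_real]
      refine (PiLp.norm_apply_le _ l).trans ?_
      have := (A.pow (-m) : Rn n →L[ℝ] Rn n).le_opNorm (EuclideanSpace.single i 1)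
      simpa using this
    have h1 : ∀ i l, (1 + ‖v‖) ^ N * ‖(A.pow (-m) (EuclideanSpace.single i 1) l : ℂ) *
        sconv (ω i) (dilate A (LineDeriv.lineDerivOp (EuclideanSpace.single l (1 : ℝ)) φ) m) v‖ ≤
        C i l * (a ^ (L + 1) * (1 + a') ^ N) := by
      intro i l
      rw [norm_mul]
      calc _ = ‖(A.pow (-m) (EuclideanSpace.single i 1) l : ℂ)‖ * ((1 + ‖v‖) ^ N *
            ‖sconv (ω i) (dilate A
              (LineDeriv.lineDerivOp (EuclideanSpace.single l (1 : ℝ)) φ) m) v‖) := by ring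
        _ ≤ a * (C i l * a ^ L * (1 + a') ^ N) :=
          mul_le_mul (hco i l) (hb i l m v) (by positivity) (norm_nonneg _)
        _ = _ := by ring
    have h2 : ‖(∑ i, ∑ l, (A.pow (-m) (EuclideanSpace.single i 1) l : ℂ) • sconv (ω i)
        (dilate A (LineDeriv.lineDerivOp (EuclideanSpace.single l (1 : ℝ)) φ) m)) v‖ ≤
        ∑ i, ∑ l, ‖(A.pow (-m) (EuclideanSpace.single i 1) l : ℂ) * sconv (ω i)
        (dilate A (LineDeriv.lineDerivOp (EuclideanSpace.single l (1 : ℝ)) φ) m) v‖ := by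
      rw [sum_apply]
      refine (norm_sum_le _ _).trans (Finset.sum_le_sum fun i _ => ?_)
      rw [sum_apply]
      exact norm_sum_le _ _
    calc _ ≤ (1 + ‖v‖) ^ N * ∑ i, ∑ l, ‖(A.pow (-m) (EuclideanSpace.single i 1) l : ℂ) *
          sconv (ω i) (dilate A
            (LineDeriv.lineDerivOp (EuclideanSpace.single l (1 : ℝ)) φ) m) v‖ := by gcongr
      _ ≤ (∑ i, ∑ l, C i l) * (a ^ (L + 1) * (1 + a') ^ N) := by
        simp only [Finset.mul_sum, Finset.sum_mul]
        exact Finset.sum_le_sum fun i _ => Finset.sum_le_sum fun l _ => h1 i l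
      _ = _ := by ring

/-- The dilate is concentrated at the small scale -m; since φ has mean zero, ζ may be replaced by
its increment over a displacement A^{-m}u, which is of size r^{-m}. -/
theorem exists_sconv_dilate_neg_bound (g : Gauge A Δ) (ζ : 𝓢(Rn n, ℂ)) {φ : 𝓢(Rn n, ℂ)}
    (hφ : ∫ x, φ x = 0) (N : ℕ) : ∃ C : ℝ, 0 ≤ C ∧ ∀ (m : ℕ) (v : Rn n),
      (1 + ‖v‖) ^ N * ‖sconv ζ (dilate A φ (-m)) v‖ ≤ C * (g.r ^ m)⁻¹ := by
  obtain ⟨K, hK, hKb⟩ := g.norm_pow_neg_le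
  obtain ⟨C, hC, hb⟩ := exists_difference_bound ζ N
  have hr := g.r_pos
  refine ⟨C * (K * (1 + K) ^ N) * ∫ u, (1 + ‖u‖) ^ (N + 1) * ‖φ u‖,
    mul_nonneg (by positivity) (integral_nonneg fun u => by positivity), fun m v => ?_⟩
  have hK1 : ‖(A.pow (-m) : Rn n →L[ℝ] Rn n)‖ ≤ K := (hKb m).trans
    (mul_le_of_le_one_right (by linarith) (inv_le_one_of_one_le₀ (one_le_pow₀ g.one_lt.le)))
  have hsub : sconv ζ (dilate A φ (-m)) v = ∫ u, (ζ (v - A.pow (-m) u) - ζ v) * φ u := by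
    rw [sconv_dilate_apply]
    simp only [sub_mul]
    rw [integral_sub (integrable_comp_sub_mul ζ φ (-m) v) (φ.integrable.const_mul _),
      integral_const_mul, hφ, mul_zero, sub_zero]
  have hint : Integrable fun u => (ζ (v - A.pow (-m) u) - ζ v) * φ u := by
    simp only [sub_mul]
    exact (integrable_comp_sub_mul ζ φ (-m) v).sub (φ.integrable.const_mul _)
  have h1 : ∀ u, (1 + ‖v‖) ^ N * ‖(ζ (v - A.pow (-m) u) - ζ v) * φ u‖ ≤
      C * (K * (1 + K) ^ N) * (g.r ^ m)⁻¹ * ((1 + ‖u‖) ^ (N + 1) * ‖φ u‖) := by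
    intro u
    rw [norm_mul, ← mul_assoc]
    have h2 : ‖A.pow (-m) u‖ ≤ K * (g.r ^ m)⁻¹ * (1 + ‖u‖) :=
      ((A.pow (-m) : Rn n →L[ℝ] Rn n).le_opNorm u).trans
        (mul_le_mul (hKb m) (by linarith [norm_nonneg u]) (norm_nonneg _) (by positivity))
    have h3 : 1 + ‖A.pow (-m) u‖ ≤ (1 + K) * (1 + ‖u‖) :=
      (weight_apply_le (-m) u).trans (by gcongr)
    calc _ ≤ C * (‖A.pow (-m) u‖ * (1 + ‖A.pow (-m) u‖) ^ N) * ‖φ u‖ := by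
          exact mul_le_mul_of_nonneg_right (hb v _) (norm_nonneg _)
      _ ≤ C * ((K * (g.r ^ m)⁻¹ * (1 + ‖u‖)) * ((1 + K) * (1 + ‖u‖)) ^ N) * ‖φ u‖ := by gcongr
      _ = _ := by rw [mul_pow]; ring
  rw [hsub]
  calc _ ≤ (1 + ‖v‖) ^ N * ∫ u, ‖(ζ (v - A.pow (-m) u) - ζ v) * φ u‖ := by
        gcongr; exact norm_integral_le_integral_norm _
    _ = ∫ u, (1 + ‖v‖) ^ N * ‖(ζ (v - A.pow (-m) u) - ζ v) * φ u‖ := by rw [integral_const_mul]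
    _ ≤ ∫ u, C * (K * (1 + K) ^ N) * (g.r ^ m)⁻¹ * ((1 + ‖u‖) ^ (N + 1) * ‖φ u‖) :=
        integral_mono (hint.norm.const_mul _) ((integrable_growth_mul φ (N + 1)).const_mul _) h1
    _ = _ := by rw [integral_const_mul]; ring

/-- Almost orthogonality with arbitrary decay. -/
theorem FourierAnnular.exists_almost_orthogonal (g : Gauge A Δ) {ζ : 𝓢(Rn n, ℂ)}
    (hζ : FourierAnnular ζ) {φ : 𝓢(Rn n, ℂ)} (hφ : ∫ x, φ x = 0) (N E : ℕ) :
    ∃ C : ℝ, 0 ≤ C ∧ ∀ (m : ℤ) (v : Rn n),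
      (1 + ‖(A.pow m : Rn n →L[ℝ] Rn n)‖) ^ E * ((1 + ‖v‖) ^ N * ‖sconv ζ (dilate A φ m) v‖) ≤
        C * (g.r ^ m.natAbs)⁻¹ := by
  obtain ⟨K, hK, hKb⟩ := g.norm_pow_neg_le
  obtain ⟨Q, -, hQ⟩ := g.exists_growth_exponent
  have hr := g.r_pos
  obtain ⟨C₁, hC₁, h1⟩ := exists_sconv_dilate_neg_bound g ζ hφ N
  -- Of the Q(E + N) + 1 derivatives, Q(E + N) cancel the growth of (1 + ‖A^m‖)^{E + N} and the
  -- remaining one yields the factor r^{-m}.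
  obtain ⟨C₂, hC₂, h2⟩ := hζ.exists_sconv_dilate_bound (A := A) (Q * (E + N) + 1) N φ
  refine ⟨(1 + K) ^ E * C₁ + C₂ * K ^ (Q * (E + N) + 1) * 2 ^ (E + N), by positivity,
    fun m v => ?_⟩
  obtain ⟨k, rfl | rfl⟩ := m.eq_nat_or_neg
  · have hrk : 1 ≤ g.r ^ k := one_le_pow₀ g.one_lt.le
    have h3 := h2 k v
    rw [Int.natAbs_natCast]
    set a := ‖(A.pow (k : ℤ) : Rn n →L[ℝ] Rn n)‖
    have ha : 1 + a ≤ 2 * (g.r ^ k) ^ Q := by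
      have := hQ k; have := one_le_pow₀ hrk (n := Q); linarith
    have ha' : ‖(A.pow (-k) : Rn n →L[ℝ] Rn n)‖ ≤ K * (g.r ^ k)⁻¹ := hKb k
    calc _ ≤ (1 + a) ^ E * (C₂ * ‖(A.pow (-k) : Rn n →L[ℝ] Rn n)‖ ^ (Q * (E + N) + 1) *
          (1 + a) ^ N) := by gcongr
      _ = C₂ * ‖(A.pow (-k) : Rn n →L[ℝ] Rn n)‖ ^ (Q * (E + N) + 1) * (1 + a) ^ (E + N) := by ring
      _ ≤ C₂ * (K * (g.r ^ k)⁻¹) ^ (Q * (E + N) + 1) * (2 * (g.r ^ k) ^ Q) ^ (E + N) := by gcongr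
      _ = C₂ * K ^ (Q * (E + N) + 1) * 2 ^ (E + N) * (g.r ^ k)⁻¹ *
          ((g.r ^ k)⁻¹ ^ (Q * (E + N)) * (g.r ^ k) ^ (Q * (E + N))) := by
        rw [mul_pow, mul_pow, pow_succ (g.r ^ k)⁻¹, ← pow_mul (g.r ^ k)]; ring
      _ = C₂ * K ^ (Q * (E + N) + 1) * 2 ^ (E + N) * (g.r ^ k)⁻¹ := by
        rw [← mul_pow, inv_mul_cancel₀ (by positivity), one_pow, mul_one]
      _ ≤ _ := by
        gcongr
        exact le_add_of_nonneg_left (by positivity)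
  · rw [Int.natAbs_neg, Int.natAbs_natCast]
    have hK1 : ‖(A.pow (-k) : Rn n →L[ℝ] Rn n)‖ ≤ K := (hKb k).trans
      (mul_le_of_le_one_right (by linarith) (inv_le_one_of_one_le₀ (one_le_pow₀ g.one_lt.le)))
    calc _ ≤ (1 + K) ^ E * (C₁ * (g.r ^ k)⁻¹) :=
          mul_le_mul (pow_le_pow_left₀ (by positivity) (by gcongr) E) (h1 k v) (by positivity)
            (by positivity)
      _ = (1 + K) ^ E * C₁ * (g.r ^ k)⁻¹ := by ring
      _ ≤ _ := by
        gcongr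
        exact le_add_of_nonneg_right (by positivity)

end Kernel

end AnisoLP

namespace AnisoLP

/-! ### Pointwise control by the maximal function of local square averages -/

section MaximalControl

variable {n : ℕ} {A : Dilation n} {Δ : Set (Rn n)}

theorem ofReal_b_add (A : Dilation n) (j k : ℤ) : ENNReal.ofReal (A.b ^ (j + k)) =
    ENNReal.ofReal (A.b ^ j) * ENNReal.ofReal (A.b ^ k) := by
  rw [zpow_add₀ A.b_pos.ne', ENNReal.ofReal_mul (zpow_nonneg A.b_pos.le _)]

theorem ofReal_b_ne_zero (A : Dilation n) (k : ℤ) : ENNReal.ofReal (A.b ^ k) ≠ 0 := by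
  simpa using zpow_pos A.b_pos k

theorem ofReal_b_neg (A : Dilation n) (k : ℤ) :
    ENNReal.ofReal (A.b ^ (-k)) = (ENNReal.ofReal (A.b ^ k))⁻¹ := by
  rw [zpow_neg, ENNReal.ofReal_inv_of_pos (zpow_pos A.b_pos k)]

/-- The square average of `F` on the dilated ball `x + B_k`. -/
def squareAverage (A : Dilation n) (Δ : Set (Rn n)) (F : Rn n → ℝ≥0∞) (k : ℤ) (x : Rn n) : ℝ≥0∞ :=
  (ENNReal.ofReal (A.b ^ (-k)) * ∫⁻ y in A.dball Δ x k, F y ^ 2) ^ (1 / 2 : ℝ)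

/-- The weight `1 + ‖v‖`. -/
def weight (v : Rn n) : ℝ≥0∞ := 1 + ‖v‖ₑ

theorem weight_eq_ofReal (v : Rn n) : weight v = ENNReal.ofReal (1 + ‖v‖) := by
  rw [weight, ENNReal.ofReal_add one_pos.le (norm_nonneg _), ofReal_norm, ENNReal.ofReal_one]

theorem one_le_weight (v : Rn n) : 1 ≤ weight v := le_self_add

theorem weight_ne_zero (v : Rn n) : weight v ≠ 0 := (one_pos.trans_le (one_le_weight v)).ne'

theorem weight_ne_top (v : Rn n) : weight v ≠ ∞ := by simp [weight]

theorem weight_add_le (u v : Rn n) : weight (u + v) ≤ weight u * weight v := by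
  calc weight (u + v) ≤ 1 + (‖u‖ₑ + ‖v‖ₑ) := by unfold weight; gcongr; exact enorm_add_le _ _
    _ ≤ 1 + (‖u‖ₑ + ‖v‖ₑ) + ‖u‖ₑ * ‖v‖ₑ := le_self_add
    _ = _ := by unfold weight; ring

theorem weight_neg (v : Rn n) : weight (-v) = weight v := by simp [weight]

theorem measurable_weight : Measurable (weight (n := n)) := by
  unfold weight; fun_prop

theorem lintegral_weight_lt_top : ∫⁻ v : Rn n, (weight v ^ (n + 1))⁻¹ < ∞ := by
  have h := finite_integral_one_add_norm (E := Rn n) (μ := volume) (r := ((n + 1 : ℕ) : ℝ))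
    (by simp)
  refine lt_of_eq_of_lt (lintegral_congr fun v => ?_) h
  rw [weight_eq_ofReal, Real.rpow_neg (by positivity), Real.rpow_natCast,
    ENNReal.ofReal_inv_of_pos (by positivity), ENNReal.ofReal_pow (by positivity)]

namespace Gauge

variable (g : Gauge A Δ)

theorem contr_int {j k : ℤ} (m : ℕ) (h : k = j + m) (x : Rn n) :
    g.r ^ m * ‖g.P (A.pow (-k) x)‖ ≤ ‖g.P (A.pow (-j) x)‖ := by
  have := g.contr_pow m (A.pow (-j) x)
  rwa [← A.pow_add_apply, show -(m : ℤ) + -j = -k by omega] at this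

/-- Since r^s ≥ 2, B_{k-s} has radius at most 1/2 in the gauge of scale k, and two such radii fit
into B_k. -/
theorem dball_subset_of_mem {s : ℕ} (hs : 2 ≤ g.r ^ s) {k : ℤ} {z w : Rn n}
    (hw : w ∈ A.dball Δ z (k - s)) : A.dball Δ z (k - s) ⊆ A.dball Δ w k := by
  intro y hy
  rw [g.mem_dball] at *
  have h1 := g.contr_int s (show k = (k - s) + s by ring) (y - z)
  have h2 := g.contr_int s (show k = (k - s) + s by ring) (w - z)
  have h3 : g.P (A.pow (-k) (y - w)) = g.P (A.pow (-k) (y - z)) - g.P (A.pow (-k) (w - z)) := by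
    rw [← map_sub, ← map_sub]; congr 2; abel
  rw [h3]
  refine (norm_sub_le _ _).trans_lt ?_
  nlinarith [norm_nonneg (g.P (A.pow (-k) (y - z))), norm_nonneg (g.P (A.pow (-k) (w - z)))]

/-- Cauchy-Schwarz on the small ball, which lies in w + B_k for every one of its points w. Having
the bound at all these w at once is what later permits any exponent p > 0. -/
theorem setLIntegral_le_squareAverage {s : ℕ} (hs : 2 ≤ g.r ^ s) {F : Rn n → ℝ≥0∞}
    (hF : Measurable F) {k : ℤ} {z w : Rn n} (hw : w ∈ A.dball Δ z (k - s)) :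
    ENNReal.ofReal (A.b ^ (-k)) * ∫⁻ y in A.dball Δ z (k - s), F y ≤
      ENNReal.ofReal (A.b ^ (-(s : ℤ))) ^ (1 / 2 : ℝ) * squareAverage A Δ F k w := by
  have h1 := ENNReal.lintegral_mul_le_Lp_mul_Lq (volume.restrict (A.dball Δ z (k - s)))
    Real.HolderConjugate.two_two hF.aemeasurable (aemeasurable_const (b := (1 : ℝ≥0∞)))
  simp only [Pi.mul_apply, mul_one, ENNReal.one_rpow, lintegral_const, one_mul,
    Measure.restrict_apply_univ, g.volume_dball] at h1
  have h2 : ∫⁻ y in A.dball Δ z (k - s), F y ^ (2 : ℝ) ≤ ∫⁻ y in A.dball Δ w k, F y ^ 2 := by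
    simp only [ENNReal.rpow_two]
    exact lintegral_mono_set (g.dball_subset_of_mem hs hw)
  have hB := ofReal_b_ne_zero A k
  have hB' : ENNReal.ofReal (A.b ^ k) ≠ ∞ := ENNReal.ofReal_ne_top
  set J := ∫⁻ y in A.dball Δ w k, F y ^ 2
  calc _ ≤ ENNReal.ofReal (A.b ^ (-k)) *
        (J ^ (1 / 2 : ℝ) * ENNReal.ofReal (A.b ^ (k - s)) ^ (1 / 2 : ℝ)) := by
        gcongr
        exact h1.trans (by gcongr)
    _ = _ := by
        rw [squareAverage, sub_eq_add_neg, ofReal_b_add, ofReal_b_neg A k,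
          ENNReal.mul_rpow_of_nonneg _ _ (by norm_num), ENNReal.mul_rpow_of_nonneg _ _ (by norm_num)]
        set B := ENNReal.ofReal (A.b ^ k)
        have h3 : B⁻¹ * B ^ (1 / 2 : ℝ) = B⁻¹ ^ (1 / 2 : ℝ) := by
          have h4 : B⁻¹ = B⁻¹ ^ (1 / 2 : ℝ) * B⁻¹ ^ (1 / 2 : ℝ) := by
            rw [← ENNReal.rpow_add _ _ (by simpa using hB') (by simpa using hB)]; norm_num
          conv_lhs => rw [h4]
          rw [mul_assoc, ← ENNReal.mul_rpow_of_nonneg _ _ (by norm_num),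
            ENNReal.inv_mul_cancel hB hB', ENNReal.one_rpow, mul_one]
        rw [← h3]
        ring

theorem setLIntegral_le_maximal (g : Gauge A Δ) {x z : Rn n} {k : ℤ}
    (hx : x ∈ A.dball Δ z k) (h : Rn n → ℝ≥0∞) :
    ∫⁻ y in A.dball Δ z k, h y ≤ ENNReal.ofReal (A.b ^ k) * A.maximal Δ h x := by
  have h1 : ⨍⁻ y in A.dball Δ z k, h y ∂volume ≤ A.maximal Δ h x :=
    le_iSup_of_le z (le_iSup_of_le k (le_iSup_of_le hx le_rfl))
  rw [setLAverage_eq, g.volume_dball, ENNReal.div_le_iff (ofReal_b_ne_zero A k)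
    ENNReal.ofReal_ne_top] at h1
  rwa [mul_comm]

/-- The index q + 1 is the first exponent with r^{q+1} above twice the relevant distance at scale k.
Half of the enlarged radius then covers the small ball and half the displacement x - z; b ≤ r^Q
turns this into a bound on the volume ratio. -/
theorem exists_engulfing (Q : ℕ) (hQ : A.b ≤ g.r ^ Q) : ∃ D : ℝ, 1 ≤ D ∧
    ∀ {s : ℕ}, 2 ≤ g.r ^ s → ∀ (k : ℤ) (x z : Rn n), ∃ q : ℕ,
      A.dball Δ z (k - s) ⊆ A.dball Δ x (k + q) ∧
      A.b ^ q ≤ (D * (1 + ‖A.pow (-k) (x - z)‖)) ^ Q := by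
  set p := ‖(g.P : Rn n →L[ℝ] Rn n)‖ with hp
  have hp0 : 0 ≤ p := norm_nonneg _
  have hr := g.one_lt
  refine ⟨g.r * (2 * (1 + p)), by nlinarith, fun {s} hs k x z => ?_⟩
  set t := ‖A.pow (-k) (x - z)‖ with ht
  have ht0 : 0 ≤ t := norm_nonneg _
  obtain ⟨q, hq1, hq2⟩ := exists_nat_pow_near
    (show 1 ≤ 2 * (1 + p) * (1 + t) by nlinarith [mul_nonneg hp0 ht0]) hr
  have hrq : (0 : ℝ) < g.r ^ (q + 1) := pow_pos g.r_pos _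
  refine ⟨q + 1, fun y hy => ?_, ?_⟩
  · rw [g.mem_dball] at *
    have h1 := g.contr_int (s + (q + 1)) (j := k - s) (k := k + (q + 1 : ℕ))
      (by push_cast; ring) (y - z)
    have h2 := g.contr_int (q + 1) (j := k) (k := k + (q + 1 : ℕ)) rfl (x - z)
    have h3 : g.P (A.pow (-(k + (q + 1 : ℕ))) (y - x)) =
        g.P (A.pow (-(k + (q + 1 : ℕ))) (y - z)) - g.P (A.pow (-(k + (q + 1 : ℕ))) (x - z)) := by
      rw [← map_sub, ← map_sub]; congr 2; abel
    have h4 : ‖g.P (A.pow (-k) (x - z))‖ ≤ p * t := (g.P : Rn n →L[ℝ] Rn n).le_opNorm _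
    rw [h3]
    refine (norm_sub_le _ _).trans_lt ?_
    set a := ‖g.P (A.pow (-(k + (q + 1 : ℕ))) (y - z))‖
    set c := ‖g.P (A.pow (-(k + (q + 1 : ℕ))) (x - z))‖
    have ha : 2 * a < 1 := by
      have h5 : 1 ≤ g.r ^ (q + 1) := one_le_pow₀ hr.le
      have ha0 : 0 ≤ a := norm_nonneg _
      calc 2 * a ≤ g.r ^ s * g.r ^ (q + 1) * a := by
            gcongr; nlinarith
        _ = g.r ^ (s + (q + 1)) * a := by rw [pow_add g.r s]
        _ < 1 := h1.trans_lt hy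
    have hc : 2 * c < 1 := by
      have hc0 : 0 ≤ c := norm_nonneg _
      by_contra! hge
      nlinarith [mul_nonneg hp0 ht0]
    linarith
  · calc A.b ^ (q + 1) ≤ (g.r ^ Q) ^ (q + 1) := by
          gcongr; exact A.b_pos.le
      _ = (g.r * g.r ^ q) ^ Q := by rw [← pow_succ', ← pow_mul, ← pow_mul, mul_comm]
      _ ≤ _ := by
          have := g.r_pos
          rw [mul_assoc]
          gcongr

/-- The p-th power of the bound by the square average at w is averaged over w in the small ball, and
the ball is enlarged until it contains x. The volume ratio costs the weight to the power Q, hence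
Q/p after taking p-th roots, rounded up to E. -/
theorem exists_setLIntegral_le_maximal {s : ℕ} (hs : 2 ≤ g.r ^ s) {p : ℝ} (hp : 0 < p) :
    ∃ (C : ℝ≥0) (E : ℕ), ∀ {F : Rn n → ℝ≥0∞}, Measurable F → ∀ (k : ℤ) (x z : Rn n),
      ENNReal.ofReal (A.b ^ (-k)) * ∫⁻ y in A.dball Δ z (k - s), F y ≤
        C * weight (A.pow (-k) (x - z)) ^ E *
          A.maximal Δ (fun y => squareAverage A Δ F k y ^ p) x ^ (1 / p) := by
  obtain ⟨Q, hQ, -⟩ := g.exists_growth_exponent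
  obtain ⟨D, hD, hDb⟩ := g.exists_engulfing Q hQ
  set c : ℝ≥0∞ := ENNReal.ofReal (A.b ^ (-(s : ℤ))) ^ (1 / 2 : ℝ) with hc
  have hctop : c ≠ ∞ := ENNReal.rpow_ne_top_of_nonneg (by norm_num) ENNReal.ofReal_ne_top
  have hcp : c ^ p ≠ ∞ := ENNReal.rpow_ne_top_of_nonneg hp.le hctop
  set K : ℝ≥0∞ := c ^ p * ENNReal.ofReal (A.b ^ (s : ℤ)) * ENNReal.ofReal D ^ Q with hK
  have hKtop : K ≠ ∞ := ENNReal.mul_ne_top (ENNReal.mul_ne_top hcp ENNReal.ofReal_ne_top)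
    (ENNReal.pow_ne_top ENNReal.ofReal_ne_top)
  refine ⟨(K ^ (1 / p)).toNNReal, ⌈(Q : ℝ) / p⌉₊, fun {F} hF k x z => ?_⟩
  rw [ENNReal.coe_toNNReal (ENNReal.rpow_ne_top_of_nonneg (by positivity) hKtop)]
  set I := ENNReal.ofReal (A.b ^ (-k)) * ∫⁻ y in A.dball Δ z (k - s), F y with hI
  set M := A.maximal Δ (fun y => squareAverage A Δ F k y ^ p) x with hM
  set W := weight (A.pow (-k) (x - z)) with hW
  obtain ⟨q, hq, hqb⟩ := hDb hs k x z
  have hx : x ∈ A.dball Δ x (k + q) := by rw [g.mem_dball]; simp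
  have h1 : I ^ p * ENNReal.ofReal (A.b ^ (k - s)) ≤
      c ^ p * (ENNReal.ofReal (A.b ^ (k + q)) * M) := by
    calc I ^ p * ENNReal.ofReal (A.b ^ (k - s)) = ∫⁻ _ in A.dball Δ z (k - s), I ^ p := by
          rw [setLIntegral_const, g.volume_dball]
      _ ≤ ∫⁻ w in A.dball Δ z (k - s), c ^ p * squareAverage A Δ F k w ^ p := by
          refine setLIntegral_mono' (g.measurableSet_dball _ _) fun w hw => ?_
          rw [← ENNReal.mul_rpow_of_nonneg _ _ hp.le]
          exact ENNReal.rpow_le_rpow (g.setLIntegral_le_squareAverage hs hF hw) hp.le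
      _ = c ^ p * ∫⁻ w in A.dball Δ z (k - s), squareAverage A Δ F k w ^ p :=
          lintegral_const_mul' _ _ hcp
      _ ≤ c ^ p * ∫⁻ w in A.dball Δ x (k + q), squareAverage A Δ F k w ^ p := by
          gcongr
      _ ≤ _ := by gcongr; exact g.setLIntegral_le_maximal hx _
  have h2 : I ^ p ≤ K * W ^ Q * M := by
    have h3 : ENNReal.ofReal (A.b ^ (q : ℤ)) ≤ (ENNReal.ofReal D * W) ^ Q := by
      rw [hW, weight_eq_ofReal, ← ENNReal.ofReal_mul (by linarith),
        ← ENNReal.ofReal_pow (by positivity), zpow_natCast]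
      exact ENNReal.ofReal_le_ofReal hqb
    have h4 : c ^ p * (ENNReal.ofReal (A.b ^ (k + q)) * M) =
        (c ^ p * ENNReal.ofReal (A.b ^ (s : ℤ)) * ENNReal.ofReal (A.b ^ (q : ℤ)) * M) *
          ENNReal.ofReal (A.b ^ (k - s)) := by
      rw [show k + (q : ℤ) = (s : ℤ) + (q : ℤ) + (k - s) by ring, ofReal_b_add, ofReal_b_add]
      ring
    rw [h4, ENNReal.mul_le_mul_iff_left (ofReal_b_ne_zero A _) ENNReal.ofReal_ne_top] at h1
    calc I ^ p ≤ _ := h1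
      _ ≤ c ^ p * ENNReal.ofReal (A.b ^ (s : ℤ)) * (ENNReal.ofReal D * W) ^ Q * M := by gcongr
      _ = _ := by rw [hK, mul_pow]; ring
  have h5 : I = (I ^ p) ^ (1 / p) := by
    rw [← ENNReal.rpow_mul, mul_one_div_cancel hp.ne', ENNReal.rpow_one]
  rw [h5]
  calc (I ^ p) ^ (1 / p) ≤ (K * W ^ Q * M) ^ (1 / p) :=
        ENNReal.rpow_le_rpow h2 (by positivity)
    _ = K ^ (1 / p) * (W ^ Q) ^ (1 / p) * M ^ (1 / p) := by
        rw [ENNReal.mul_rpow_of_nonneg _ _ (by positivity),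
          ENNReal.mul_rpow_of_nonneg _ _ (by positivity)]
    _ ≤ _ := by
        gcongr
        rw [← ENNReal.rpow_natCast, ← ENNReal.rpow_mul, ← ENNReal.rpow_natCast W ⌈_⌉₊]
        refine ENNReal.rpow_le_rpow_of_exponent_le (one_le_weight _) ?_
        rw [mul_one_div]
        exact Nat.le_ceil _

end Gauge

end MaximalControl

end AnisoLP

namespace AnisoLP

/-! ### Weighted integrals controlled by the maximal function -/

section MaximalControl

variable {n : ℕ} {A : Dilation n} {Δ : Set (Rn n)}

namespace Gauge

variable (g : Gauge A Δ)

theorem weight_le_of_norm_lt_one {v : Rn n} (hv : ‖g.P v‖ < 1) :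
    weight v ≤ 1 + ‖(g.P.symm : Rn n →L[ℝ] Rn n)‖ₑ := by
  unfold weight
  gcongr
  have h := (g.P.symm : Rn n →L[ℝ] Rn n).le_opNorm (g.P v)
  simp only [ContinuousLinearEquiv.coe_coe, ContinuousLinearEquiv.symm_apply_apply] at h
  have h2 : ‖v‖ ≤ ‖(g.P.symm : Rn n →L[ℝ] Rn n)‖ :=
    h.trans (mul_le_of_le_one_right (norm_nonneg _) hv.le)
  rw [← ofReal_norm, ← ofReal_norm]
  exact ENNReal.ofReal_le_ofReal h2

theorem measurable_weight_comp (k : ℤ) (y : Rn n) :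
    Measurable fun z : Rn n => weight (A.pow (-k) (y - z)) :=
  measurable_weight.comp ((A.pow (-k)).continuous.comp (continuous_const.sub continuous_id)).measurable

/-- The weight at scale k varies by at most a constant factor over z + B_{k-s}. The normalisation
uses b^{-k} in place of b^{-(k-s)}, which accounts for b^s. -/
theorem inv_weight_le_setLIntegral {s : ℕ} (N : ℕ) (k : ℤ) (y z : Rn n) :
    (weight (A.pow (-k) (y - z)) ^ N)⁻¹ ≤
      ENNReal.ofReal (A.b ^ (s : ℤ)) * (1 + ‖(g.P.symm : Rn n →L[ℝ] Rn n)‖ₑ) ^ N *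
        (ENNReal.ofReal (A.b ^ (-k)) *
          ∫⁻ z' in A.dball Δ z (k - s), (weight (A.pow (-k) (y - z')) ^ N)⁻¹) := by
  set c : ℝ≥0∞ := 1 + ‖(g.P.symm : Rn n →L[ℝ] Rn n)‖ₑ with hc
  have hc0 : c ^ N ≠ 0 := pow_ne_zero _ (by simp [hc])
  have hct : c ^ N ≠ ∞ := ENNReal.pow_ne_top (by simp [hc])
  set w := weight (A.pow (-k) (y - z)) with hw
  have h1 : (c ^ N * w ^ N)⁻¹ * ENNReal.ofReal (A.b ^ (k - s)) ≤
      ∫⁻ z' in A.dball Δ z (k - s), (weight (A.pow (-k) (y - z')) ^ N)⁻¹ := by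
    rw [← g.volume_dball z (k - s), ← setLIntegral_const]
    refine setLIntegral_mono' (g.measurableSet_dball _ _) fun z' hz' => ?_
    rw [ENNReal.inv_le_inv, ← mul_pow]
    gcongr
    have h2 : A.pow (-k) (y - z') = A.pow (-k) (-(z' - z)) + A.pow (-k) (y - z) := by
      rw [← map_add]; congr 1; abel
    rw [h2]
    refine (weight_add_le _ _).trans ?_
    gcongr
    rw [map_neg, weight_neg]
    refine g.weight_le_of_norm_lt_one ?_
    rw [g.mem_dball] at hz'
    have h3 := g.contr_int s (show k = (k - s) + s by ring) (z' - z)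
    have h4 : 1 ≤ g.r ^ s := one_le_pow₀ g.one_lt.le
    nlinarith [norm_nonneg (g.P (A.pow (-k) (z' - z)))]
  calc (w ^ N)⁻¹ = (ENNReal.ofReal (A.b ^ (s : ℤ)) * (ENNReal.ofReal (A.b ^ (-k)) *
        ENNReal.ofReal (A.b ^ (k - s)))) * (c ^ N * (c ^ N * w ^ N)⁻¹) := by
        rw [← ofReal_b_add, ← ofReal_b_add, show (s : ℤ) + (-k + (k - s)) = 0 by ring, zpow_zero,
          ENNReal.ofReal_one, one_mul, ENNReal.mul_inv (Or.inl hc0) (Or.inl hct), ← mul_assoc,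
          ENNReal.mul_inv_cancel hc0 hct, one_mul]
    _ = ENNReal.ofReal (A.b ^ (s : ℤ)) * c ^ N * (ENNReal.ofReal (A.b ^ (-k)) *
        ((c ^ N * w ^ N)⁻¹ * ENNReal.ofReal (A.b ^ (k - s)))) := by ring
    _ ≤ _ := by gcongr

/-- The weight is replaced by its local averages and the integrals are exchanged; symmetry of the
relation z' ∈ z + B_{k-s} moves the averaging onto F. -/
theorem lintegral_mul_inv_weight_le {s : ℕ} (N : ℕ) {F : Rn n → ℝ≥0∞} (hF : Measurable F) (k : ℤ)
    (y : Rn n) : ∫⁻ z, F z * (weight (A.pow (-k) (y - z)) ^ N)⁻¹ ≤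
      ENNReal.ofReal (A.b ^ (s : ℤ)) * (1 + ‖(g.P.symm : Rn n →L[ℝ] Rn n)‖ₑ) ^ N *
        ∫⁻ z', (weight (A.pow (-k) (y - z')) ^ N)⁻¹ *
          (ENNReal.ofReal (A.b ^ (-k)) * ∫⁻ z in A.dball Δ z' (k - s), F z) := by
  set K : ℝ≥0∞ := ENNReal.ofReal (A.b ^ (s : ℤ)) * (1 + ‖(g.P.symm : Rn n →L[ℝ] Rn n)‖ₑ) ^ N
    with hK
  have hKt : K ≠ ∞ := ENNReal.mul_ne_top ENNReal.ofReal_ne_top (ENNReal.pow_ne_top (by simp))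
  set β := ENNReal.ofReal (A.b ^ (-k)) with hβ
  have hβt : β ≠ ∞ := ENNReal.ofReal_ne_top
  let u : Rn n → ℝ≥0∞ := fun z => (weight (A.pow (-k) (y - z)) ^ N)⁻¹
  have hu : Measurable u := ((measurable_weight_comp k y).pow_const N).inv
  have hS : MeasurableSet {q : Rn n × Rn n | q.2 ∈ A.dball Δ q.1 (k - s)} := by
    simp only [g.mem_dball]
    refine (isOpen_lt ?_ continuous_const).measurableSet
    exact (g.P.continuous.comp ((A.pow _).continuous.comp
      (continuous_snd.sub continuous_fst))).norm
  let T : Rn n → Rn n → ℝ≥0∞ := fun z z' => (A.dball Δ z (k - s)).indicator (fun z' => F z * u z') z'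
  have hT : Measurable (Function.uncurry T) := by
    have : Function.uncurry T = {q : Rn n × Rn n | q.2 ∈ A.dball Δ q.1 (k - s)}.indicator
        fun q => F q.1 * u q.2 := by
      ext ⟨z, z'⟩; rfl
    rw [this]
    exact ((hF.comp measurable_fst).mul (hu.comp measurable_snd)).indicator hS
  calc ∫⁻ z, F z * u z ≤ ∫⁻ z, K * β * ∫⁻ z', T z z' := by
        refine lintegral_mono fun z => ?_
        have h1 := g.inv_weight_le_setLIntegral (s := s) N k y z
        have h2 : ∫⁻ z', T z z' = F z * ∫⁻ z' in A.dball Δ z (k - s), u z' := by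
          rw [← lintegral_const_mul _ hu, ← lintegral_indicator (g.measurableSet_dball _ _)]
        rw [h2]
        calc F z * u z ≤ F z * (K * (β * ∫⁻ z' in A.dball Δ z (k - s), u z')) := by
              gcongr
          _ = _ := by ring
    _ = K * β * ∫⁻ z', ∫⁻ z, T z z' := by
        rw [lintegral_const_mul' _ _ (ENNReal.mul_ne_top hKt hβt),
          lintegral_lintegral_swap hT.aemeasurable]
    _ = K * ∫⁻ z', β * ∫⁻ z, T z z' := by
        rw [lintegral_const_mul' _ _ hβt, mul_assoc]
    _ = K * ∫⁻ z', u z' * (β * ∫⁻ z in A.dball Δ z' (k - s), F z) := by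
        congr 1
        refine lintegral_congr fun z' => ?_
        have h3 : ∀ z, T z z' = (A.dball Δ z' (k - s)).indicator (fun z => u z' * F z) z := by
          intro z
          by_cases h : z ∈ A.dball Δ z' (k - s)
          · rw [Set.indicator_of_mem h]
            exact (Set.indicator_of_mem (g.mem_dball_comm.1 h) _).trans (mul_comm _ _)
          · rw [Set.indicator_of_notMem h]
            exact Set.indicator_of_notMem (fun h' => h (g.mem_dball_comm.1 h')) _
        simp only [h3]
        rw [lintegral_indicator (g.measurableSet_dball _ _), lintegral_const_mul _ hF]
        ring

theorem lintegral_inv_weight_comp (k : ℤ) (y : Rn n) (N : ℕ) :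
    ∫⁻ z, (weight (A.pow (-k) (y - z)) ^ N)⁻¹ =
      ENNReal.ofReal (A.b ^ k) * ∫⁻ v : Rn n, (weight v ^ N)⁻¹ := by
  rw [lintegral_sub_left_eq_self (fun z => (weight (A.pow (-k) z) ^ N)⁻¹) y,
    lintegral_comp_pow A (-k) fun v => (weight v ^ N)⁻¹, neg_neg]

/-- Of the exponent E + (n + 1), E powers absorb the growth in the estimate of local averages by the
maximal function at x, and n + 1 powers make the remaining weight integrable. -/
theorem exists_lintegral_mul_inv_weight_le (g : Gauge A Δ) {p : ℝ} (hp : 0 < p) :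
    ∃ (C : ℝ≥0) (E : ℕ),
    ∀ {F : Rn n → ℝ≥0∞}, Measurable F → ∀ (k : ℤ) (x y : Rn n),
      ∫⁻ z, F z * (weight (A.pow (-k) (y - z)) ^ (E + (n + 1)))⁻¹ ≤
        C * ENNReal.ofReal (A.b ^ k) * weight (A.pow (-k) (x - y)) ^ E *
          A.maximal Δ (fun y => squareAverage A Δ F k y ^ p) x ^ (1 / p) := by
  obtain ⟨s, hs⟩ := pow_unbounded_of_one_lt 2 g.one_lt
  obtain ⟨C, E, hC⟩ := g.exists_setLIntegral_le_maximal hs.le hp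
  set K : ℝ≥0∞ := ENNReal.ofReal (A.b ^ (s : ℤ)) *
    (1 + ‖(g.P.symm : Rn n →L[ℝ] Rn n)‖ₑ) ^ (E + (n + 1)) with hK
  have hKt : K ≠ ∞ := ENNReal.mul_ne_top ENNReal.ofReal_ne_top (ENNReal.pow_ne_top (by simp))
  set J : ℝ≥0∞ := ∫⁻ v : Rn n, (weight v ^ (n + 1))⁻¹ with hJ
  have hJt : J ≠ ∞ := lintegral_weight_lt_top.ne
  refine ⟨K.toNNReal * C * J.toNNReal, E, fun {F} hF k x y => ?_⟩
  rw [ENNReal.coe_mul, ENNReal.coe_mul, ENNReal.coe_toNNReal hKt, ENNReal.coe_toNNReal hJt]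
  refine (g.lintegral_mul_inv_weight_le (s := s) (E + (n + 1)) hF k y).trans ?_
  set M := A.maximal Δ (fun y => squareAverage A Δ F k y ^ p) x ^ (1 / p)
  set w := weight (A.pow (-k) (x - y)) with hw
  have h1 : ∀ z', (weight (A.pow (-k) (y - z')) ^ (E + (n + 1)))⁻¹ *
      (ENNReal.ofReal (A.b ^ (-k)) * ∫⁻ z in A.dball Δ z' (k - s), F z) ≤
      (weight (A.pow (-k) (y - z')) ^ (n + 1))⁻¹ * (C * w ^ E * M) := by
    intro z'
    set v := weight (A.pow (-k) (y - z')) with hv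
    have hv0 : v ^ E ≠ 0 := pow_ne_zero _ (weight_ne_zero _)
    have hvt : v ^ E ≠ ∞ := ENNReal.pow_ne_top (weight_ne_top _)
    have h2 : weight (A.pow (-k) (x - z')) ≤ w * v := by
      have : x - z' = (x - y) + (y - z') := by abel
      rw [this, map_add]
      exact weight_add_le _ _
    calc _ ≤ (v ^ (E + (n + 1)))⁻¹ * (C * (w * v) ^ E * M) := by
          refine mul_le_mul_right ((hC hF k x z').trans ?_) _
          gcongr
      _ = (v ^ (n + 1))⁻¹ * ((v ^ E)⁻¹ * v ^ E) * (C * w ^ E * M) := by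
          rw [pow_add, ENNReal.mul_inv (Or.inl hv0) (Or.inl hvt), mul_pow]; ring
      _ = _ := by rw [ENNReal.inv_mul_cancel hv0 hvt, mul_one]
  calc _ ≤ K * ∫⁻ z', (weight (A.pow (-k) (y - z')) ^ (n + 1))⁻¹ * (C * w ^ E * M) := by
        exact mul_le_mul_right (lintegral_mono h1) _
    _ = _ := by
        have hmeas : Measurable fun z' => (weight (A.pow (-k) (y - z')) ^ (n + 1))⁻¹ :=
          ((measurable_weight_comp k y).pow_const _).inv
        rw [lintegral_mul_const _ hmeas, lintegral_inv_weight_comp]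
        ring

/-- Annular dilates paired with dilates of a mean-zero function are controlled by the maximal
function of local square averages, with geometric decay in the scale difference. -/
theorem exists_lintegral_sconv_le_maximal {ζ : 𝓢(Rn n, ℂ)} (hζ : FourierAnnular ζ)
    {φ : 𝓢(Rn n, ℂ)} (hφ : ∫ x, φ x = 0) {p : ℝ} (hp : 0 < p) : ∃ C : ℝ≥0,
    ∀ {F : Rn n → ℝ≥0∞}, Measurable F → ∀ (k j : ℤ) (x y : Rn n), y ∈ A.dball Δ x j →
      ∫⁻ z, F z * ‖sconv (dilate A ζ k) (dilate A φ j) (y - z)‖ₑ ≤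
        C * ENNReal.ofReal (g.r ^ (j - k).natAbs)⁻¹ *
          A.maximal Δ (fun y => squareAverage A Δ F k y ^ p) x ^ (1 / p) := by
  obtain ⟨C₁, E, h1⟩ := g.exists_lintegral_mul_inv_weight_le hp
  obtain ⟨C₂, hC₂, h2⟩ := hζ.exists_almost_orthogonal g hφ (E + (n + 1)) E
  set c : ℝ≥0∞ := 1 + ‖(g.P.symm : Rn n →L[ℝ] Rn n)‖ₑ with hc
  have hct : c ^ E ≠ ∞ := ENNReal.pow_ne_top (by simp [hc])
  refine ⟨C₂.toNNReal * C₁ * (c ^ E).toNNReal, fun {F} hF k j x y hy => ?_⟩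
  rw [ENNReal.coe_mul, ENNReal.coe_mul, ENNReal.coe_toNNReal hct]
  change _ ≤ ENNReal.ofReal C₂ * C₁ * c ^ E * _ * _
  set M := A.maximal Δ (fun y => squareAverage A Δ F k y ^ p) x ^ (1 / p)
  set m := j - k with hm
  set R : ℝ≥0∞ := ENNReal.ofReal (g.r ^ m.natAbs)⁻¹ with hR
  set β := ENNReal.ofReal (A.b ^ (-k)) with hβ
  set a : ℝ≥0∞ := 1 + ‖(A.pow m : Rn n →L[ℝ] Rn n)‖ₑ with ha
  have ha0 : a ^ E ≠ 0 := pow_ne_zero _ (by simp [ha])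
  have hat : a ^ E ≠ ∞ := ENNReal.pow_ne_top (by simp [ha])
  have hker : ∀ v, ‖sconv (dilate A ζ k) (dilate A φ j) v‖ₑ ≤
      β * (ENNReal.ofReal C₂ * R * (a ^ E)⁻¹) * (weight (A.pow (-k) v) ^ (E + (n + 1)))⁻¹ := by
    intro v
    have h3 : sconv (dilate A ζ k) (dilate A φ j) = dilate A (sconv ζ (dilate A φ m)) k := by
      rw [dilate_sconv, dilate_dilate, hm, sub_add_cancel]
    set κ := sconv ζ (dilate A φ m) with hκ
    have h4 : ‖dilate A κ k v‖ₑ = β * ‖κ (A.pow (-k) v)‖ₑ := by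
      rw [← ofReal_norm, norm_dilate_apply, ENNReal.ofReal_mul (zpow_nonneg A.b_pos.le _),
        ofReal_norm]
    rw [h3, h4, mul_assoc]
    gcongr
    set W := weight (A.pow (-k) v) ^ (E + (n + 1)) with hW
    have hW0 : W ≠ 0 := pow_ne_zero _ (weight_ne_zero _)
    have hWt : W ≠ ∞ := ENNReal.pow_ne_top (weight_ne_top _)
    have h5 : a ^ E * (W * ‖κ (A.pow (-k) v)‖ₑ) ≤ ENNReal.ofReal C₂ * R := by
      have h6 := ENNReal.ofReal_le_ofReal (h2 m (A.pow (-k) v))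
      rw [ENNReal.ofReal_mul (by positivity), ENNReal.ofReal_mul (by positivity),
        ENNReal.ofReal_mul hC₂, ENNReal.ofReal_pow (by positivity),
        ENNReal.ofReal_pow (by positivity), ofReal_norm, ← weight_eq_ofReal,
        ENNReal.ofReal_add one_pos.le (norm_nonneg _), ENNReal.ofReal_one, ofReal_norm] at h6
      exact h6
    calc ‖κ (A.pow (-k) v)‖ₑ = ((a ^ E)⁻¹ * a ^ E) * (W⁻¹ * W) * ‖κ (A.pow (-k) v)‖ₑ := by
          rw [ENNReal.inv_mul_cancel ha0 hat, ENNReal.inv_mul_cancel hW0 hWt, one_mul, one_mul]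
      _ = (a ^ E * (W * ‖κ (A.pow (-k) v)‖ₑ)) * ((a ^ E)⁻¹ * W⁻¹) := by ring
      _ ≤ (ENNReal.ofReal C₂ * R) * ((a ^ E)⁻¹ * W⁻¹) := by gcongr
      _ = _ := by ring
  -- Moving the base point from y to x costs the weight of x - y at scale k. As y ∈ x + B_j, this is
  -- at most a constant times 1 + ‖A^{j-k}‖, whose E-th power was built into the kernel bound.
  have hwt : weight (A.pow (-k) (x - y)) ≤ a * c := by
    have h3 : A.pow (-k) (x - y) = A.pow m (A.pow (-j) (x - y)) := by
      rw [← A.pow_add_apply]; congr 2; omega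
    have h4 := (A.pow m : Rn n →L[ℝ] Rn n).le_opENorm (A.pow (-j) (x - y))
    have h5 : weight (A.pow (-j) (x - y)) ≤ c :=
      g.weight_le_of_norm_lt_one (g.mem_dball.1 (g.mem_dball_comm.1 hy))
    rw [h3]
    calc weight (A.pow m (A.pow (-j) (x - y)))
        ≤ 1 + ‖(A.pow m : Rn n →L[ℝ] Rn n)‖ₑ * ‖A.pow (-j) (x - y)‖ₑ := by
          unfold weight; gcongr; exact h4
      _ ≤ 1 + ‖(A.pow m : Rn n →L[ℝ] Rn n)‖ₑ * ‖A.pow (-j) (x - y)‖ₑ +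
          (‖(A.pow m : Rn n →L[ℝ] Rn n)‖ₑ + ‖A.pow (-j) (x - y)‖ₑ) := le_self_add
      _ = a * weight (A.pow (-j) (x - y)) := by rw [ha, weight]; ring
      _ ≤ a * c := by gcongr
  have hβ1 : β * ENNReal.ofReal (A.b ^ k) = 1 := by
    rw [hβ, ← ofReal_b_add]; simp
  have hfin : β * (ENNReal.ofReal C₂ * R * (a ^ E)⁻¹) ≠ ∞ :=
    ENNReal.mul_ne_top ENNReal.ofReal_ne_top (ENNReal.mul_ne_top
      (ENNReal.mul_ne_top ENNReal.ofReal_ne_top ENNReal.ofReal_ne_top) (ENNReal.inv_ne_top.2 ha0))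
  calc _ ≤ ∫⁻ z, β * (ENNReal.ofReal C₂ * R * (a ^ E)⁻¹) *
        (F z * (weight (A.pow (-k) (y - z)) ^ (E + (n + 1)))⁻¹) := by
        refine lintegral_mono fun z => ?_
        calc _ ≤ F z * (β * (ENNReal.ofReal C₂ * R * (a ^ E)⁻¹) *
              (weight (A.pow (-k) (y - z)) ^ (E + (n + 1)))⁻¹) := by gcongr; exact hker _
          _ = _ := by ring
    _ = β * (ENNReal.ofReal C₂ * R * (a ^ E)⁻¹) *
        ∫⁻ z, F z * (weight (A.pow (-k) (y - z)) ^ (E + (n + 1)))⁻¹ :=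
        lintegral_const_mul' _ _ hfin
    _ ≤ β * (ENNReal.ofReal C₂ * R * (a ^ E)⁻¹) *
        (C₁ * ENNReal.ofReal (A.b ^ k) * (a * c) ^ E * M) := by
        gcongr
        exact (h1 hF k x y).trans (by gcongr)
    _ = (β * ENNReal.ofReal (A.b ^ k)) * ((a ^ E)⁻¹ * a ^ E) *
        (ENNReal.ofReal C₂ * C₁ * c ^ E * R * M) := by rw [mul_pow]; ring
    _ = _ := by rw [hβ1, ENNReal.inv_mul_cancel ha0 hat, one_mul, one_mul]

end Gauge

end MaximalControl

end AnisoLP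

namespace AnisoLP

/-! ### Comparison of area functions -/

section AreaComparison

variable {n : ℕ} {A : Dilation n} {Δ : Set (Rn n)}

theorem Gauge.measurable_squareAverage (g : Gauge A Δ) {F : Rn n → ℝ≥0∞} (hF : Measurable F)
    (k : ℤ) : Measurable (squareAverage A Δ F k) := by
  have hS : MeasurableSet {q : Rn n × Rn n | q.2 ∈ A.dball Δ q.1 k} := by
    simp only [g.mem_dball]
    refine (isOpen_lt ?_ continuous_const).measurableSet
    exact (g.P.continuous.comp ((A.pow _).continuous.comp
      (continuous_snd.sub continuous_fst))).norm
  have h1 : Measurable fun x => ∫⁻ y in A.dball Δ x k, F y ^ 2 := by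
    have h2 : Measurable fun x => ∫⁻ y, {q : Rn n × Rn n | q.2 ∈ A.dball Δ q.1 k}.indicator
        (fun q => F q.2 ^ 2) (x, y) :=
      (((hF.comp measurable_snd).pow_const 2).indicator hS).lintegral_prod_right'
    convert h2 using 2 with x
    rw [← lintegral_indicator (g.measurableSet_dball _ _)]
    rfl
  exact (h1.const_mul _).pow_const _

/-- Superlevel sets are unions of open dilated balls, whatever the function h. -/
theorem Gauge.measurable_maximal (g : Gauge A Δ) (h : Rn n → ℝ≥0∞) :
    Measurable (A.maximal Δ h) := by
  refine measurable_of_Ioi fun a => IsOpen.measurableSet ?_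
  have : A.maximal Δ h ⁻¹' Set.Ioi a = ⋃ (z : Rn n) (k : ℤ)
      (_ : a < ⨍⁻ y in A.dball Δ z k, h y ∂volume), A.dball Δ z k := by
    ext x
    simp only [Dilation.maximal, Set.mem_preimage, Set.mem_Ioi, lt_iSup_iff, Set.mem_iUnion,
      exists_prop, and_comm]
  rw [this]
  exact isOpen_iUnion fun z => isOpen_iUnion fun k => isOpen_iUnion fun _ => g.isOpen_dball z k

/-- The modulus of the convolution of `f` with `φ_k`. -/
def convNorm (A : Dilation n) (φ : 𝓢(Rn n, ℂ)) (f : 𝓢'(Rn n, ℂ)) (k : ℤ) (y : Rn n) : ℝ≥0∞ :=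
  ‖conv f (dilate A φ k) y‖ₑ

theorem measurable_convNorm (φ : 𝓢(Rn n, ℂ)) (f : 𝓢'(Rn n, ℂ)) (k : ℤ) :
    Measurable (convNorm A φ f k) :=
  (continuous_conv f _).measurable.enorm

theorem squareAverage_sq (F : Rn n → ℝ≥0∞) (k : ℤ) (x : Rn n) : squareAverage A Δ F k x ^ 2 =
    ENNReal.ofReal (A.b ^ (-k)) * ∫⁻ y in A.dball Δ x k, F y ^ 2 := by
  rw [squareAverage, ← ENNReal.rpow_two, ← ENNReal.rpow_mul]
  norm_num

theorem area_eq (φ : 𝓢(Rn n, ℂ)) (f : 𝓢'(Rn n, ℂ)) (x : Rn n) : area A Δ φ f x =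
    (∑' k : ℤ, squareAverage A Δ (convNorm A φ f k) k x ^ 2) ^ (1 / 2 : ℝ) := by
  simp only [squareAverage_sq]
  rfl

theorem Gauge.squareAverage_le (g : Gauge A Δ) {F : Rn n → ℝ≥0∞} {k : ℤ} {x : Rn n} {S : ℝ≥0∞}
    (h : ∀ y ∈ A.dball Δ x k, F y ≤ S) : squareAverage A Δ F k x ^ 2 ≤ S ^ 2 := by
  rw [squareAverage_sq]
  calc _ ≤ ENNReal.ofReal (A.b ^ (-k)) * ∫⁻ _ in A.dball Δ x k, S ^ 2 := by
        refine mul_le_mul_right (setLIntegral_mono' (g.measurableSet_dball _ _) fun y hy => ?_) _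
        gcongr
        exact h y hy
    _ = S ^ 2 * (ENNReal.ofReal (A.b ^ (-k)) * ENNReal.ofReal (A.b ^ k)) := by
        rw [setLIntegral_const, g.volume_dball]; ring
    _ = S ^ 2 := by rw [← ofReal_b_add]; simp

theorem tsum_mul_sq_le (R a : ℤ → ℝ≥0∞) :
    (∑' l, R l * a l) ^ 2 ≤ (∑' l, R l) * ∑' l, R l * a l ^ 2 := by
  have h := ENNReal.lintegral_mul_le_Lp_mul_Lq (Measure.count : Measure ℤ)
    Real.HolderConjugate.two_two (f := fun l => R l ^ (1 / 2 : ℝ))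
    (g := fun l => R l ^ (1 / 2 : ℝ) * a l) (Measurable.of_discrete.aemeasurable)
    (Measurable.of_discrete.aemeasurable)
  have h1 : ∀ t : ℝ≥0∞, t ^ (1 / 2 : ℝ) * t ^ (1 / 2 : ℝ) = t := fun t => by
    rw [← ENNReal.rpow_add_of_nonneg _ _ (by norm_num) (by norm_num)]; norm_num
  have h2 : ∀ t : ℝ≥0∞, (t ^ (1 / 2 : ℝ)) ^ (2 : ℕ) = t := fun t => by rw [sq, h1]
  simp only [lintegral_count, Pi.mul_apply, ← mul_assoc, h1, ENNReal.rpow_two, mul_pow, h2] at h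
  calc _ ≤ ((∑' l, R l) ^ (1 / 2 : ℝ) * (∑' l, R l * a l ^ 2) ^ (1 / 2 : ℝ)) ^ 2 := by
        gcongr
    _ = _ := by rw [mul_pow, h2, h2]

/-- Young's inequality ℓ¹ ∗ ℓ² ⊆ ℓ²: Cauchy-Schwarz with weights R, then the two sums are exchanged.
-/
theorem tsum_convolution_sq_le (R a : ℤ → ℝ≥0∞) :
    ∑' j, (∑' l, R (j - l) * a l) ^ 2 ≤ (∑' m, R m) ^ 2 * ∑' l, a l ^ 2 := by
  have h1 : ∀ j, ∑' l, R (j - l) = ∑' m, R m := fun j =>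
    (Equiv.subLeft j).tsum_eq R
  have h2 : ∀ l, ∑' j, R (j - l) = ∑' m, R m := fun l =>
    (Equiv.subRight l).tsum_eq R
  calc _ ≤ ∑' j, (∑' m, R m) * ∑' l, R (j - l) * a l ^ 2 := by
        refine ENNReal.tsum_le_tsum fun j => ?_
        rw [← h1 j]
        exact tsum_mul_sq_le (fun l => R (j - l)) a
    _ = (∑' m, R m) * ∑' l, ∑' j, R (j - l) * a l ^ 2 := by
        rw [ENNReal.tsum_mul_left, ENNReal.tsum_comm]
    _ = _ := by
        simp only [ENNReal.tsum_mul_right, h2, ENNReal.tsum_mul_left]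
        ring

theorem Gauge.tsum_geometric_ne_top (g : Gauge A Δ) :
    ∑' m : ℤ, ENNReal.ofReal (g.r ^ m.natAbs)⁻¹ ≠ ∞ := by
  have hr := g.r_pos
  have hs : Summable fun k : ℕ => (g.r ^ k)⁻¹ := by
    simpa [inv_pow] using summable_geometric_of_lt_one (inv_nonneg.2 hr.le)
      (inv_lt_one_of_one_lt₀ g.one_lt)
  have hsum : Summable fun m : ℤ => (g.r ^ m.natAbs)⁻¹ :=
    Summable.of_nat_of_neg (by simpa using hs) (by simpa using hs)
  exact hsum.tsum_ofReal_ne_top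

theorem Gauge.exists_area_le (g : Gauge A Δ) {ψ φ : 𝓢(Rn n, ℂ)}
    (hψ : ∀ ξ : Rn n, ξ ≠ 0 → ∃ k : ℤ, 𝓕 ψ (A.transpose k ξ) ≠ 0) (hφ : ∫ x, φ x = 0)
    {p : ℝ} (hp : 0 < p) : ∃ C : ℝ≥0, ∀ f : 𝓢'(Rn n, ℂ), VanishesWeaklyAtInfinity A f → ∀ x,
      area A Δ φ f x ≤ C * (∑' k : ℤ, A.maximal Δ
        (fun y => squareAverage A Δ (convNorm A ψ f k) k y ^ p) x ^ (2 / p)) ^ (1 / 2 : ℝ) := by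
  obtain ⟨s, ζ, hζ, hcal⟩ := exists_calderon g hψ
  choose C hC using fun m => g.exists_lintegral_sconv_le_maximal (hζ m) hφ hp
  let R : ℤ → ℝ≥0∞ := fun m => ENNReal.ofReal (g.r ^ m.natAbs)⁻¹
  refine ⟨(∑ m ∈ s, C m) * (∑' m, R m).toNNReal, fun f hf x => ?_⟩
  rw [ENNReal.coe_mul, ENNReal.coe_toNNReal g.tsum_geometric_ne_top]
  let M : ℤ → ℝ≥0∞ := fun k =>
    A.maximal Δ (fun y => squareAverage A Δ (convNorm A ψ f k) k y ^ p) x ^ (1 / p)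
  -- The bound at y ∈ x + B_j does not depend on y, so it passes to the square average over that
  -- ball. Each partial sum of the Calderón formula is below the full sum, so the estimate survives
  -- the limit.
  have hpt : ∀ j, ∀ y ∈ A.dball Δ x j, convNorm A φ f j y ≤
      (∑ m ∈ s, C m : ℝ≥0) * ∑' l, R (j - l) * M l := by
    intro j y hy
    have hlim := (hcal f hf (dilate A φ j) y).enorm
    refine le_of_tendsto' hlim fun N => ?_
    calc _ ≤ ∑ k ∈ Finset.Ioc (-N : ℤ) N, ∑ m ∈ s, C m * (R (j - (k + m)) * M (k + m)) := by
          refine (enorm_sum_le _ _).trans (Finset.sum_le_sum fun k _ => ?_)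
          refine (enorm_sum_le _ _).trans (Finset.sum_le_sum fun m _ => ?_)
          refine (enorm_integral_le_lintegral_enorm _).trans ?_
          simp only [enorm_mul]
          rw [← mul_assoc]
          exact hC m (measurable_convNorm ψ f (k + m)) (k + m) j x y hy
      _ = ∑ m ∈ s, ∑ k ∈ Finset.Ioc (-N : ℤ) N, C m * (R (j - (k + m)) * M (k + m)) :=
          Finset.sum_comm
      _ ≤ ∑ m ∈ s, C m * ∑' l, R (j - l) * M l := by
          refine Finset.sum_le_sum fun m _ => ?_
          rw [← Finset.mul_sum]
          gcongr
          refine (ENNReal.sum_le_tsum _).trans ?_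
          exact ((Equiv.addRight m).tsum_eq fun l => R (j - l) * M l).le
      _ = _ := by rw [← Finset.sum_mul, ENNReal.ofNNReal_finsetSum]
  have hM : ∀ k, M k ^ 2 = A.maximal Δ
      (fun y => squareAverage A Δ (convNorm A ψ f k) k y ^ p) x ^ (2 / p) := fun k => by
    rw [← ENNReal.rpow_two, ← ENNReal.rpow_mul]
    congr 1; ring
  simp only [← hM]
  set D : ℝ≥0∞ := ((∑ m ∈ s, C m : ℝ≥0) : ℝ≥0∞)
  have hsq : ∑' j : ℤ, squareAverage A Δ (convNorm A φ f j) j x ^ 2 ≤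
      (D * ∑' m, R m) ^ 2 * ∑' k, M k ^ 2 := by
    calc _ ≤ ∑' j, D ^ 2 * (∑' l, R (j - l) * M l) ^ 2 := by
          refine ENNReal.tsum_le_tsum fun j => ?_
          rw [← mul_pow]
          exact g.squareAverage_le (hpt j)
      _ ≤ D ^ 2 * ((∑' m, R m) ^ 2 * ∑' k, M k ^ 2) := by
          rw [ENNReal.tsum_mul_left]
          gcongr
          exact tsum_convolution_sq_le R M
      _ = _ := by rw [mul_pow]; ring
  rw [area_eq]
  calc _ ≤ ((D * ∑' m, R m) ^ 2 * ∑' k, M k ^ 2) ^ (1 / 2 : ℝ) :=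
        ENNReal.rpow_le_rpow hsq (by norm_num)
    _ = _ := by
        rw [ENNReal.mul_rpow_of_nonneg _ _ (by norm_num), ← ENNReal.rpow_two, ← ENNReal.rpow_mul]
        norm_num
        rfl

/-! ### From the pointwise bound to the quasi-norm -/

theorem convexify_inv {X : FunNorm n} {p : ℝ} (f : Rn n → ℝ≥0∞) :
    convexify X (1 / p) f = X (fun x => f x ^ (1 / p)) ^ p := by
  rw [convexify, one_div_one_div]

theorem IsAdmissible.integral_eq_zero {d : ℕ} {φ : 𝓢(Rn n, ℂ)} (hφ : IsAdmissible A Δ d φ) :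
    ∫ x, φ x = 0 := by
  simpa using hφ.moments 0 (by simp)

/-- Domination of one area function by another in a space with the Fefferman-Stein inequality. -/
theorem exists_norm_area_le (hn : 0 < n) (g : Gauge A Δ) {X : FunNorm n}
    (hX : IsBallQuasiBanach A Δ X) {pm : ℝ} (hpm : 0 < pm) (hFS : FeffermanStein A Δ X pm) {d : ℕ}
    {φ ψ : 𝓢(Rn n, ℂ)} (hφ : IsAdmissible A Δ d φ) (hψ : IsAdmissible A Δ d ψ) :
    ∃ C : ℝ≥0, ∀ f : 𝓢'(Rn n, ℂ), VanishesWeaklyAtInfinity A f →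
      X (area A Δ φ f) ≤ C * X (area A Δ ψ f) := by
  -- This p is admissible for the Fefferman-Stein inequality and makes u = 2/p > 1.
  set p := min pm 1 / 2 with hp
  have hmin : 0 < min pm 1 := lt_min hpm one_pos
  have hp0 : 0 < p := by positivity
  have hppm : p < pm := by linarith [min_le_left pm 1]
  have hp1 : p < 1 := by linarith [min_le_right pm 1]
  have hu : 1 < 2 / p := by rw [lt_div_iff₀ hp0]; linarith
  obtain ⟨C₁, h1⟩ := g.exists_area_le (fun ξ => hψ.exists_fourier_transpose_ne_zero hn g)
    hφ.integral_eq_zero hp0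
  obtain ⟨C₂, h2⟩ := hFS p hp0 hppm (2 / p) hu
  refine ⟨C₁ * C₂ ^ (1 / p), fun f hf => ?_⟩
  let G : ℤ → Rn n → ℝ≥0∞ := fun k y => squareAverage A Δ (convNorm A ψ f k) k y ^ p
  have hG : ∀ k, Measurable (G k) := fun k =>
    (g.measurable_squareAverage (measurable_convNorm ψ f k) k).pow_const p
  -- The vector-valued inequality is stated for sequences, so the scales are reindexed; the sums do
  -- not depend on the order.
  let e : ℕ ≃ ℤ := Equiv.intEquivNat.symm
  let U : Rn n → ℝ≥0∞ := fun x => (∑' k : ℤ, A.maximal Δ (G k) x ^ (2 / p)) ^ (1 / 2 : ℝ)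
  have hU : Measurable U :=
    (Measurable.tsum fun k => (g.measurable_maximal (G k)).pow_const _).pow_const _
  have hexp : 1 / (2 / p) * (1 / p) = 1 / 2 := by field_simp
  -- With G_k^p as entries, the outer powers 1/u and 1/p combine to 1/2: both sides become p-th
  -- powers of quasi-norms, and the right-hand function is exactly S_ψ(f).
  have h3 := h2 (fun i => G (e i)) fun i => (hG _).aemeasurable
  rw [convexify_inv, convexify_inv] at h3
  have h4 : ∀ x, ((∑' i, A.maximal Δ (G (e i)) x ^ (2 / p)) ^ (1 / (2 / p))) ^ (1 / p) = U x := by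
    intro x
    rw [← ENNReal.rpow_mul, hexp, e.tsum_eq fun k => A.maximal Δ (G k) x ^ (2 / p)]
  have h5 : ∀ x, ((∑' i, G (e i) x ^ (2 / p)) ^ (1 / (2 / p))) ^ (1 / p) = area A Δ ψ f x := by
    intro x
    rw [← ENNReal.rpow_mul, hexp, e.tsum_eq fun k => G k x ^ (2 / p), area_eq]
    congr 2
    ext k
    simp only [G]
    rw [← ENNReal.rpow_mul, mul_div_cancel₀ _ hp0.ne', ENNReal.rpow_two]
  simp only [h4, h5] at h3
  have h6 : X U ≤ (C₂ ^ (1 / p) : ℝ≥0) * X (area A Δ ψ f) := by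
    have h7 := ENNReal.rpow_le_rpow h3 (one_div_pos.2 hp0).le
    rwa [ENNReal.mul_rpow_of_nonneg _ _ (one_div_pos.2 hp0).le, ← ENNReal.rpow_mul,
      ← ENNReal.rpow_mul, mul_one_div_cancel hp0.ne', ENNReal.rpow_one, ENNReal.rpow_one,
      ← ENNReal.coe_rpow_of_nonneg _ (one_div_pos.2 hp0).le] at h7
  have hφm : Measurable (area A Δ φ f) := by
    have : area A Δ φ f = fun x =>
        (∑' k : ℤ, squareAverage A Δ (convNorm A φ f k) k x ^ 2) ^ (1 / 2 : ℝ) :=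
      funext (area_eq φ f)
    rw [this]
    exact (Measurable.tsum fun k =>
      (g.measurable_squareAverage (measurable_convNorm φ f k) k).pow_const 2).pow_const _
  calc X (area A Δ φ f) ≤ X (fun x => C₁ * U x) :=
        hX.mono _ _ (hU.const_mul _).aemeasurable hφm.aemeasurable (ae_of_all _ (h1 f hf))
    _ = C₁ * X U := hX.smul _ _ hU.aemeasurable
    _ ≤ C₁ * ((C₂ ^ (1 / p) : ℝ≥0) * X (area A Δ ψ f)) := by gcongr
    _ = _ := by rw [ENNReal.coe_mul, mul_assoc]

end AreaComparison

end AnisoLP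

end

/-! ### The two-sided estimate -/

theorem mainTheorem9 (n : ℕ) (hn : 0 < n)
    (A : AnisoLP.Dilation n)
    (Δ : Set (AnisoLP.Rn n)) (hΔ : A.IsUnitEllipsoid Δ)
    (X : AnisoLP.FunNorm n) (hX : AnisoLP.IsBallQuasiBanach A Δ X)
    (pm θ₀ p₀ : ℝ) (hpm : 0 < pm) (hθ₀ : 0 < θ₀) (hθ₀' : θ₀ < min pm 1) (hp₀ : θ₀ < p₀)
    (hX₁ : AnisoLP.FeffermanStein A Δ X pm)
    (hX₂ : AnisoLP.AssociateMaximal A Δ X θ₀ p₀)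
    (d : ℕ) (φ ψ : 𝓢(AnisoLP.Rn n, ℂ))
    (hφ : AnisoLP.IsAdmissible A Δ d φ) (hψ : AnisoLP.IsAdmissible A Δ d ψ) :
    ∃ C : ℝ≥0, 0 < C ∧ ∀ f : 𝓢'(AnisoLP.Rn n, ℂ), AnisoLP.VanishesWeaklyAtInfinity A f →
      X (AnisoLP.area A Δ φ f) ≤ C * X (AnisoLP.area A Δ ψ f) ∧
      X (AnisoLP.area A Δ ψ f) ≤ C * X (AnisoLP.area A Δ φ f) := by
  obtain ⟨g⟩ := hΔ.exists_gauge
  obtain ⟨C₁, h₁⟩ := AnisoLP.exists_norm_area_le hn g hX hpm hX₁ hφ hψ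
  obtain ⟨C₂, h₂⟩ := AnisoLP.exists_norm_area_le hn g hX hpm hX₁ hψ hφ
  refine ⟨C₁ + C₂ + 1, by positivity, fun f hf => ⟨(h₁ f hf).trans ?_, (h₂ f hf).trans ?_⟩⟩
  · gcongr
    rw [add_assoc]
    exact le_self_add
  · gcongr
    rw [add_comm C₁, add_assoc]
    exact le_self_add
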